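/- Let $M$ be a closed (compact, without boundary), connected smooth manifold of real dimension $4$ with a smooth almost complex structure $J$, and let $\alpha$ be a closed smooth $J$-anti-invariant $2$-form on $M$ (that is, $\alpha(Ju,Jv)=-\alpha(u,v)$) which does not vanish identically. Let $Z=\alpha^{-1}(0)$, and let $\Lambda_J^-$ be the total space of the rank-two bundle of $J$-anti-invariant alternating bilinear forms on $TM$, its fibres oriented by the bases $(\varphi,\varphi(J\cdot,\cdot))$, $\varphi\neq0$. Let $\Gamma_\alpha:M\to\Lambda_J^-$ be the section given by $\alpha$, and identify $M$ with the zero section. Let $D\subset\mathbb C$ be the open unit disk and $C$ a subset of a space $X$. A continuous map $\sigma:D\to X$ is *admissible* with respect to $C$ if there is a compact $K\subset D$ with $C\cap\overline{\sigma(D\setminus K)}=\emptyset$; a homotopy $h:[0,1]\times D\to X$ is admissible if there is a compact $K\subset D$ with $C\cap\overline{h([0,1]\times(D\setminus K))}=\emptyset$. Let $\sigma:D\to M$ be admissible with respect to $Z$. Then $\Gamma_\alpha\circ\sigma$ is admissible with respect to $M\subset\Lambda_J^-$. By a transverse perturbation of $\Gamma_\alpha\circ\sigma$ we mean a continuous map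 $\sigma':D\to\Lambda_J^-$ that is homotopic to $\Gamma_\alpha\circ\sigma$ by an admissible homotopy (with respect to $M$), is smooth near $\sigma'^{-1}(M)$, and is transverse to $M$ there. Arbitrarily small transverse perturbations exist: for every open $W\subset D\times\Lambda_J^-$ containing the graph of $\Gamma_\alpha\circ\sigma$, there is one for which the whole homotopy has its graphs in $W$. For every transverse perturbation $\sigma'$ the set $\sigma'^{-1}(M)$ is finite, and the sum of the signs of its points (the sign at $z$ is that of the vertical part $T_zD\to(\Lambda_J^-)_{\pi(\sigma'(z))}$ of $d\sigma'$ with respect to the orientations above) does not depend on $\sigma'$. Denote this integer by $I_\alpha(\sigma)$. The assignment $I_\alpha$ is a positive cohomology assignment to $Z$ in the sense of Taubes: 1. if $\sigma:D\to M$ is admissible and $\sigma(D)\cap Z=\emptyset$, then $I_\alpha(\sigma)=0$; 2. if $\sigma_0,\sigma_1$ are admissible and are homotopic by an admissible homotopy, then $I_\alpha(\sigma_0)=I_\alpha(\sigma_1)$; 3. if $\sigma$ is admissible and $\theta:D\to D$ is a proper continuous map of degree $k$, then $\sigma\circ\theta$ is admissible and $I_\alpha(\sigma\circ\theta)=k\,I_\alpha(\sigma)$;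 4. if $\sigma$ is admissible and $\sigma^{-1}(Z)$ is contained in a disjoint union $\bigcup_iD_i$ with $D_i=\theta_i(D)$, where the $\theta_i:D\to D$ are orientation preserving topological embeddings, then all $\sigma\circ\theta_i$ are admissible, only finitely many $I_\alpha(\sigma\circ\theta_i)$ are nonzero, and $I_\alpha(\sigma)=\sum_iI_\alpha(\sigma\circ\theta_i)$; 5. if $\sigma$ is admissible and a (smooth) $J$-holomorphic embedding with $\sigma^{-1}(Z)\neq\emptyset$, then $I_\alpha(\sigma)>0$. -/

import Mathlib

open Set Filter Topology Bundle
open scoped Manifold ContDiff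

noncomputable section

/-! ### The disk, winding numbers, degree and orientation -/

/-- The standard open unit disk in `ℂ`. -/
def unitDisk : TopologicalSpace.Opens ℂ := ⟨Metric.ball (0 : ℂ) 1, Metric.isOpen_ball⟩

/-- The standard open unit disk, as a (real two-dimensional smooth) manifold. -/
abbrev Disk : Type := unitDisk

/-- A self-map of the disk as a function on `ℂ`, extended by zero. It is only ever used at points
of the disk. -/
def diskExtend (θ : C(Disk, Disk)) (z : ℂ) : ℂ := by
  classical
  exact if h : z ∈ unitDisk then ((θ ⟨z, h⟩ : Disk) : ℂ) else 0

/-- The loop `γ : [0, 2π] → ℂ \ {0}` has winding number `k` about the origin: it has a continuous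
logarithm that increases by `2πik`. -/
def HasWindingNumber (γ : ℝ → ℂ) (k : ℤ) : Prop :=
  ∃ φ : ℝ → ℂ, Continuous φ ∧ (∀ t, Complex.exp (φ t) = γ t) ∧
    φ (2 * Real.pi) = φ 0 + k * (2 * Real.pi * Complex.I)

/-- The proper map `θ : D → D` has degree `k`: on all circles `|z| = r` with `r` close to `1` it
has winding number `k` about the origin. -/
def HasDegree (θ : C(Disk, Disk)) (k : ℤ) : Prop :=
  ∃ r₀ : ℝ, r₀ < 1 ∧ ∀ r : ℝ, r₀ < r → r < 1 →
    HasWindingNumber (fun t => diskExtend θ (circleMap 0 r t)) k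

/-- The embedding `θ : D → D` preserves the orientation: it has local degree `1` at every point,
that is, it maps every small positively oriented circle about `z` to a loop that winds
once about `θ z`. -/
def PreservesOrientation (θ : C(Disk, Disk)) : Prop :=
  ∀ (z : Disk) (ρ : ℝ), 0 < ρ → Metric.closedBall (z : ℂ) ρ ⊆ (unitDisk : Set ℂ) →
    HasWindingNumber (fun t => diskExtend θ (circleMap (z : ℂ) ρ t) - ((θ z : Disk) : ℂ)) 1

/-! ### Admissible maps and homotopies -/

section Admissible

variable {X : Type*} [TopologicalSpace X]

/-- A continuous map `σ : D → X` is admissible with respect to `C` if `C` stays away from what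
`σ` does near the boundary of `D`: for some compact `K ⊆ D` the closure of
`σ (D \ K)` does not meet `C`. In particular `C ∩ closure (σ D) ⊆ σ K ⊆ σ D`. -/
def Admissible (C : Set X) (σ : C(Disk, X)) : Prop :=
  ∃ K : Set Disk, IsCompact K ∧ Disjoint C (closure (σ '' Kᶜ))

/-- A homotopy `h : [0,1] × D → X` is admissible with respect to `C` if, for some compact
`K ⊆ D`, the closure of `h ([0,1] × (D \ K))` does not meet `C`. -/
def AdmissibleHomotopy (C : Set X) {σ₀ σ₁ : C(Disk, X)} (h : σ₀.Homotopy σ₁) : Prop :=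
  ∃ K : Set Disk, IsCompact K ∧ Disjoint C (closure (h '' {p | p.2 ∉ K}))

/-- The admissible maps `D → X` with respect to `C`. -/
abbrev AdmissibleMap (C : Set X) : Type _ := {σ : C(Disk, X) // Admissible C σ}

end Admissible

/-! ### Almost complex 4-manifolds -/

/-- The model space `ℝ⁴`. -/
abbrev R4 : Type := EuclideanSpace ℝ (Fin 4)

section Manifold

variable (M : Type*) [TopologicalSpace M] [ChartedSpace R4 M] [IsManifold (𝓡 4) ∞ M]

/-- The fibre at `x` of the bundle of bilinear forms on the tangent bundle. -/
abbrev BilinFiber (x : M) : Type :=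
  TangentSpace (𝓡 4) x →L[ℝ] TangentSpace (𝓡 4) x →L[ℝ] ℝ

/-- The total space of the bundle `T*M ⊗ T*M` of bilinear forms on `M`. -/
abbrev BilinBundle : Type _ := TotalSpace (R4 →L[ℝ] R4 →L[ℝ] ℝ) (BilinFiber M)

/-- A smooth almost complex structure on `M`. -/
structure AlmostComplexStructure where
  /-- The endomorphism of each tangent space. -/
  toFun : ∀ x : M, TangentSpace (𝓡 4) x →L[ℝ] TangentSpace (𝓡 4) x
  smooth : ContMDiff (𝓡 4) ((𝓡 4).prod 𝓘(ℝ, R4 →L[ℝ] R4)) ∞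
    (fun x => TotalSpace.mk' (R4 →L[ℝ] R4)
      (E := fun x : M => TangentSpace (𝓡 4) x →L[ℝ] TangentSpace (𝓡 4) x) x (toFun x))
  sq_eq_neg : ∀ (x : M) (v : TangentSpace (𝓡 4) x), toFun x (toFun x v) = -v

variable {M}

namespace AlmostComplexStructure

variable (J : AlmostComplexStructure M)

/-- `β` is an element of the fibre of `Λ_J⁻` at `x`: an alternating bilinear form on `T_x M`
with `β(Ju, Jv) = -β(u, v)`. -/
def IsAntiInvariant (x : M) (β : BilinFiber M x) : Prop :=
  (∀ u v, β u v = -β v u) ∧ ∀ u v, β (J.toFun x u) (J.toFun x v) = -β u v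

/-- The total space of the bundle `Λ_J⁻`, with the topology of a subspace of the bundle of
bilinear forms, in which it is an embedded submanifold. -/
abbrev AntiInvBundle : Type _ := {p : BilinBundle M // J.IsAntiInvariant p.proj p.snd}

/-- The zero section of `Λ_J⁻`, that is, `M` as a subset of the total space. -/
def zeroSection : Set J.AntiInvBundle := {p | p.1.snd = 0}

/-- A `J`-holomorphic embedding of the disk: a smooth embedding (a topological embedding
with injective derivatives) whose derivative intertwines `i` and `J`. -/
structure IsHolomorphicEmbedding (σ : Disk → M) : Prop where
  smooth : ContMDiff 𝓘(ℝ, ℂ) (𝓡 4) ∞ σ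
  isEmbedding : IsEmbedding σ
  immersion : ∀ z : Disk, Function.Injective (mfderiv 𝓘(ℝ, ℂ) (𝓡 4) σ z)
  holomorphic : ∀ (z : Disk) (v : ℂ),
    mfderiv 𝓘(ℝ, ℂ) (𝓡 4) σ z (Complex.I * v : ℂ) =
      J.toFun (σ z) (mfderiv 𝓘(ℝ, ℂ) (𝓡 4) σ z v)

/-- A positive cohomology assignment to the set `C`, in the sense of Taubes. -/
structure IsPositiveCohomologyAssignment (C : Set M) (I : AdmissibleMap C → ℤ) : Prop where
  /-- Disks that do not meet `C` have value zero. -/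
  eq_zero : ∀ σ : AdmissibleMap C, (∀ z, σ.1 z ∉ C) → I σ = 0
  /-- Invariance under admissible homotopies. -/
  homotopy : ∀ (σ₀ σ₁ : AdmissibleMap C) (h : σ₀.1.Homotopy σ₁.1),
    AdmissibleHomotopy C h → I σ₀ = I σ₁
  /-- Composition with a proper map of degree `k`. -/
  degree : ∀ (σ : AdmissibleMap C) (θ : C(Disk, Disk)) (k : ℤ), IsProperMap θ → HasDegree θ k →
    ∃ h : Admissible C (σ.1.comp θ), I ⟨σ.1.comp θ, h⟩ = k * I σ
  /-- Additivity over disjoint embedded disks that contain all the intersections. Only finitely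
  many terms of the sum are nonzero. -/
  additive : ∀ (σ : AdmissibleMap C) (ι : Type) (θ : ι → C(Disk, Disk)),
    (∀ i, IsEmbedding (θ i)) → (∀ i, PreservesOrientation (θ i)) →
    Pairwise (fun i j => Disjoint (range (θ i)) (range (θ j))) →
    σ.1 ⁻¹' C ⊆ ⋃ i, range (θ i) →
    ∃ h : ∀ i, Admissible C (σ.1.comp (θ i)),
      {i | I ⟨σ.1.comp (θ i), h i⟩ ≠ 0}.Finite ∧
      I σ = ∑ᶠ i, I ⟨σ.1.comp (θ i), h i⟩
  /-- Positivity on `J`-holomorphic embedded disks. -/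
  pos : ∀ σ : AdmissibleMap C, J.IsHolomorphicEmbedding σ.1 → (∃ z, σ.1 z ∈ C) → 0 < I σ

/-! ### Intersections of disks in `Λ_J⁻` with the zero section -/

/-- The vertical derivative `T_z D → Λ_x` of `s : D → Λ_J⁻` at `z`, read in the
trivialization at `x = π (s z)` of the bundle of bilinear forms. It is used only where
`s z` is in the zero section; there it does not depend on the trivialization, and it is
the composition of `ds` with the projection
`T_{0_x} Λ_J⁻ = Λ_x ⊕ T_x M → Λ_x`. -/
def verticalDeriv (s : C(Disk, J.AntiInvBundle)) (z : Disk) (v : ℂ) :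
    BilinFiber M (s z).1.proj :=
  (trivializationAt (R4 →L[ℝ] R4 →L[ℝ] ℝ) (BilinFiber M) (s z).1.proj).symm (s z).1.proj
    (mfderiv 𝓘(ℝ, ℂ) 𝓘(ℝ, R4 →L[ℝ] R4 →L[ℝ] ℝ)
      (fun w : Disk => (trivializationAt (R4 →L[ℝ] R4 →L[ℝ] ℝ) (BilinFiber M) (s z).1.proj
        (s w).1).2) z v)

/-- The set of parameters at which `s : D → Λ_J⁻` meets the zero section. -/
def intersectionSet (s : C(Disk, J.AntiInvBundle)) : Set Disk := s ⁻¹' J.zeroSection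

/-- `s : D → Λ_J⁻` is transverse to the zero section: near each intersection point it is smooth,
and there `T_z D` together with the tangent space of the zero section spans the
tangent space of `Λ_J⁻`, that is, the vertical derivative is onto the fibre of `Λ_J⁻`. -/
def IsTransverse (s : C(Disk, J.AntiInvBundle)) : Prop :=
  ∀ z ∈ J.intersectionSet s,
    (∀ᶠ w in 𝓝 z, ContMDiffAt 𝓘(ℝ, ℂ) ((𝓡 4).prod 𝓘(ℝ, R4 →L[ℝ] R4 →L[ℝ] ℝ)) ∞
      (fun w' : Disk => (s w').1) w) ∧
    ∀ β : BilinFiber M (s z).1.proj, J.IsAntiInvariant (s z).1.proj β →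
      ∃ v : ℂ, J.verticalDeriv s z v = β

/-- The sign of a transverse intersection point of `s` with the zero section. The fibre of `Λ_J⁻`
is oriented by the bases `(φ, φ(J·,·))`, and `D` by `(1, i)`. The sign is `1` if
the vertical derivative preserves these orientations, and `-1` otherwise. (As
`M` is even-dimensional and oriented by `J`, and the total space is oriented as fibre plus base,
this is the usual sign of an intersection of oriented submanifolds.) -/
def intersectionSign (s : C(Disk, J.AntiInvBundle)) (z : Disk) : ℤ := by
  classical
  exact if ∃ a b : ℝ, 0 < b ∧ J.verticalDeriv s z Complex.I =
      a • J.verticalDeriv s z 1 +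
        b • (J.verticalDeriv s z 1).comp (J.toFun (s z).1.proj) then 1 else -1

/-- The sum of the signs of the intersection points of `s` with the zero section. -/
def signedCount (s : C(Disk, J.AntiInvBundle)) : ℤ :=
  ∑ᶠ z ∈ J.intersectionSet s, J.intersectionSign s z

end AlmostComplexStructure

/-! ### Anti-invariant forms -/

/-- A smooth `J`-anti-invariant 2-form on `M`. -/
structure AntiInvariantForm (J : AlmostComplexStructure M) where
  /-- The bilinear form on each tangent space. -/
  toFun : ∀ x : M, BilinFiber M x
  smooth : ContMDiff (𝓡 4) ((𝓡 4).prod 𝓘(ℝ, R4 →L[ℝ] R4 →L[ℝ] ℝ)) ∞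
    (fun x => (TotalSpace.mk' (R4 →L[ℝ] R4 →L[ℝ] ℝ) x (toFun x) : BilinBundle M))
  antiInvariant : ∀ x, J.IsAntiInvariant x (toFun x)

namespace AntiInvariantForm

variable {J : AlmostComplexStructure M} (α : AntiInvariantForm J)

/-- The pullback of `α` to `ℝ⁴` by the inverse of the chart around `x₀`. -/
def inChart (x₀ : M) (y : R4) : R4 →L[ℝ] R4 →L[ℝ] ℝ :=
  let A : R4 →L[ℝ] R4 := mfderiv 𝓘(ℝ, R4) (𝓡 4) (extChartAt (𝓡 4) x₀).symm y
  let β : R4 →L[ℝ] R4 →L[ℝ] ℝ := α.toFun ((extChartAt (𝓡 4) x₀).symm y)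
  β.bilinearComp A A

/-- `dα = 0`, in charts: `(dω)(u,v,w) = D_u ω(v,w) + D_v ω(w,u) + D_w ω(u,v)`. -/
def IsClosedForm : Prop :=
  ∀ x₀ : M, ∀ y ∈ (extChartAt (𝓡 4) x₀).target, ∀ u v w : R4,
    fderiv ℝ (α.inChart x₀) y u v w + fderiv ℝ (α.inChart x₀) y v w u +
      fderiv ℝ (α.inChart x₀) y w u v = 0

/-- The zero set `Z = α⁻¹(0)`. -/
def zeroSet : Set M := {x | α.toFun x = 0}

/-- The section `Γ_α : M → Λ_J⁻` given by `α`. -/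
def toSection : C(M, J.AntiInvBundle) where
  toFun x := ⟨TotalSpace.mk' _ x (α.toFun x), α.antiInvariant x⟩
  continuous_toFun := α.smooth.continuous.subtype_mk _

/-- `s : D → Λ_J⁻` is obtained from `Γ_α ∘ σ` by a homotopy through admissible maps (with respect
to the zero section) and is transverse to the zero section. -/
def IsTransversePerturbation (σ : C(Disk, M)) (s : C(Disk, J.AntiInvBundle)) : Prop :=
  (∃ h : (α.toSection.comp σ).Homotopy s, AdmissibleHomotopy J.zeroSection h) ∧ J.IsTransverse s

/-- There are arbitrarily small perturbations as above: for each neighbourhood `W` of the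
graph of `Γ_α ∘ σ` in `D × Λ_J⁻` there is one for which the homotopy stays in `W`. -/
def HasSmallTransversePerturbations (σ : C(Disk, M)) : Prop :=
  ∀ W : Set (Disk × J.AntiInvBundle), IsOpen W → (∀ z, (z, α.toSection (σ z)) ∈ W) →
    ∃ (s : C(Disk, J.AntiInvBundle)) (h : (α.toSection.comp σ).Homotopy s),
      AdmissibleHomotopy J.zeroSection h ∧ J.IsTransverse s ∧ ∀ t z, (z, h (t, z)) ∈ W

open Classical in
/-- The assignment `I_α`: the signed number of intersections with the zero section of a
transverse perturbation of `Γ_α ∘ σ`. -/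
def intersectionNumber (σ : AdmissibleMap α.zeroSet) : ℤ :=
  if h : ∃ s, α.IsTransversePerturbation σ.1 s then J.signedCount h.choose else 0

end AntiInvariantForm

end Manifold

end

namespace DiskIndex

/-! ### Winding numbers -/

/-! The bundle `Λ_J⁻` is a complex line bundle: multiplication by `i` is `β ↦ β(J·,·)`. Pulled back
to a disk by `σ` it becomes trivial, and `Γ_α ∘ σ` becomes a complex function without zeros near the
boundary. Its winding number along a circle near the boundary does not depend on the trivialization,
because two trivializations differ by a function without zeros on the whole disk. The plan is to
show that `I_α(σ)` is this winding number (`MapIndex`) and to read the axioms off it.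

To treat all disks at once, compactness of `M` gives a continuous, fibrewise complex linear
embedding of `Λ_J⁻` into a trivial bundle `M × ℂⁿ` (`exists_bundleEmbedding`). The fibres become a
continuous field of line projections, and a trivialization is a functional that is injective on the
lines (`exists_frame`).

The winding number along a circle is the sum of the local indices at the zeros inside
(`circleIndex_sum`), and at a transverse intersection the local index is the sign
(`hasLocalIndex_of_transverse`). An admissible homotopy keeps zeros away from the boundary, so the
signed count of every transverse perturbation is the index of `Γ_α ∘ σ`. Axioms 1 to 4 are then
properties of winding numbers; additivity needs `circleIndex_additive`, which reduces to finitely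
many zeros by a generic perturbation. Small transverse perturbations come from Sard's theorem in a
trivialization. Since `σ` is only continuous, the base point is also made constant near each zero
(`exists_collapse`), which makes the perturbation smooth there.

Positivity is the only place where `dα = 0` enters. Along a holomorphic disk `u` in a chart, write
`B` for the form and put `f = B(u_x, n) - i B(u_y, n)` with a constant vector `n` that is complex
independent of `u_x`. Anti-invariance and closedness cancel all derivatives of `B` in `∂̄f`, so
`|∂̄f| ≤ C|B| ≤ C'|f|` (`dbar_eq`, `exists_norm_dbar_le`). By the similarity principle, proved here
with the Cauchy transform, a zero of `f` is either interior to the zero set or isolated of positive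
index. The interior zeros form an open and closed subset of the disk; it is empty because the zeros
of an admissible disk are compact. Hence the index is a finite sum of positive integers. -/

/-- Used with `E = ℝ` for loops and with `E = ℝ × ℝ` for homotopies of loops. -/
theorem exists_continuous_log {E : Type*} [NormedAddCommGroup E] [NormedSpace ℝ E] {γ : E → ℂ}
    (hγ : Continuous γ) (h0 : ∀ x, γ x ≠ 0) :
    ∃ φ : E → ℂ, Continuous φ ∧ ∀ x, Complex.exp (φ x) = γ x := by
  have hs : IsSimplyConnected (univ : Set E) := by
    have : ContractibleSpace (univ : Set E) := convex_univ.contractibleSpace ⟨0, trivial⟩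
    have : SimplyConnectedSpace (univ : Set E) := inferInstance
    exact this
  obtain ⟨f, hf, he⟩ := Complex.exists_continuousOn_eqOn_exp_comp hs isOpen_univ
    hγ.continuousOn (by rintro ⟨x, -, hx⟩; exact h0 x hx)
  exact ⟨f, continuousOn_univ.1 hf, fun x => he (mem_univ x)⟩

/-- Distinct integer multiples of `2πi` are at distance more than `1`, so `g` is locally constant.
This is the uniqueness of continuous logarithms up to a constant. -/
theorem eq_of_exp_eq_one {X : Type*} [TopologicalSpace X] [PreconnectedSpace X] {g : X → ℂ}
    (hg : Continuous g) (h1 : ∀ x, Complex.exp (g x) = 1) (x y : X) : g x = g y := by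
  refine IsLocallyConstant.apply_eq_of_preconnectedSpace ?_ x y
  refine (IsLocallyConstant.iff_eventually_eq g).2 fun x => ?_
  have : ∀ᶠ y in 𝓝 x, dist (g y) (g x) < 1 := hg.continuousAt (Metric.ball_mem_nhds _ one_pos)
  filter_upwards [this] with y hy
  obtain ⟨n, hn⟩ := Complex.exp_eq_one_iff.1 (h1 y)
  obtain ⟨m, hm⟩ := Complex.exp_eq_one_iff.1 (h1 x)
  rw [dist_eq_norm, hn, hm, ← sub_mul, norm_mul] at hy
  have h2 : (1 : ℝ) ≤ ‖(2 * Real.pi * Complex.I : ℂ)‖ := by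
    simp [abs_of_pos Real.pi_pos]; linarith [Real.pi_gt_three]
  have h3 : ‖((n : ℂ) - m)‖ < 1 := by nlinarith [norm_nonneg ((n : ℂ) - m)]
  have h4 : ‖((n - m : ℤ) : ℂ)‖ < 1 := by push_cast; exact h3
  rw [Complex.norm_intCast] at h4
  have h5 : |n - m| < 1 := by exact_mod_cast h4
  have : n = m := by have := Int.abs_lt_one_iff.1 h5; omega
  rw [hn, hm, this]

theorem two_pi_I_ne : (2 * Real.pi * Complex.I : ℂ) ≠ 0 := Complex.two_pi_I_ne_zero

theorem exists_hasWindingNumber {γ : ℝ → ℂ} (hγ : Continuous γ) (h0 : ∀ t, γ t ≠ 0)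
    (hp : γ (2 * Real.pi) = γ 0) : ∃ k, HasWindingNumber γ k := by
  obtain ⟨φ, hφ, he⟩ := exists_continuous_log hγ h0
  have : Complex.exp (φ (2 * Real.pi)) = Complex.exp (φ 0) := by rw [he, he, hp]
  obtain ⟨n, hn⟩ := Complex.exp_eq_exp_iff_exists_int.1 this
  exact ⟨n, φ, hφ, he, hn⟩

theorem _root_.HasWindingNumber.unique {γ : ℝ → ℂ} {k l : ℤ} (hk : HasWindingNumber γ k)
    (hl : HasWindingNumber γ l) : k = l := by
  obtain ⟨φ, hφ, he, h⟩ := hk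
  obtain ⟨ψ, hψ, he', h'⟩ := hl
  have := eq_of_exp_eq_one (g := fun t => φ t - ψ t) (hφ.sub hψ)
    (fun t => by rw [Complex.exp_sub, he, he', div_self]; rw [← he]; exact Complex.exp_ne_zero _)
    (2 * Real.pi) 0
  simp only [h, h'] at this
  have h2 : (k - l : ℂ) * (2 * Real.pi * Complex.I) = 0 := by linear_combination this
  have h3 := (mul_eq_zero.1 h2).resolve_right two_pi_I_ne
  exact_mod_cast sub_eq_zero.1 h3

theorem _root_.HasWindingNumber.mul {γ δ : ℝ → ℂ} {k l : ℤ} (hk : HasWindingNumber γ k)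
    (hl : HasWindingNumber δ l) : HasWindingNumber (fun t => γ t * δ t) (k + l) := by
  obtain ⟨φ, hφ, he, h⟩ := hk
  obtain ⟨ψ, hψ, he', h'⟩ := hl
  refine ⟨fun t => φ t + ψ t, hφ.add hψ, fun t => by rw [Complex.exp_add, he, he'], ?_⟩
  simp only [h, h']; push_cast; ring

theorem _root_.HasWindingNumber.zpow {γ : ℝ → ℂ} {k : ℤ} (hk : HasWindingNumber γ k) (n : ℤ) :
    HasWindingNumber (fun t => γ t ^ n) (n * k) := by
  obtain ⟨φ, hφ, he, h⟩ := hk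
  refine ⟨fun t => n * φ t, by fun_prop, fun t => by rw [Complex.exp_int_mul, he], ?_⟩
  simp only [h]; push_cast; ring

theorem hasWindingNumber_const {c : ℂ} (hc : c ≠ 0) : HasWindingNumber (fun _ => c) 0 :=
  ⟨fun _ => Complex.log c, continuous_const, fun _ => Complex.exp_log hc, by simp⟩

theorem hasWindingNumber_circle {r : ℝ} (hr : 0 < r) (c : ℂ) :
    HasWindingNumber (fun t => circleMap c r t - c) 1 := by
  refine ⟨fun t => Complex.log r + t * Complex.I, by fun_prop, fun t => ?_, by push_cast; ring⟩
  simp only [Complex.exp_add, Complex.exp_log (show (r : ℂ) ≠ 0 by exact_mod_cast hr.ne'), circleMap]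
  simp

/-- Winding numbers are invariant under homotopies of loops. -/
theorem _root_.HasWindingNumber.homotopy {H : ℝ → ℝ → ℂ} {k : ℤ}
    (hH : ContinuousOn (fun p : ℝ × ℝ => H p.1 p.2) (Icc 0 1 ×ˢ univ))
    (h0 : ∀ s ∈ Icc (0 : ℝ) 1, ∀ t, H s t ≠ 0)
    (hp : ∀ s ∈ Icc (0 : ℝ) 1, H s (2 * Real.pi) = H s 0)
    (hk : HasWindingNumber (H 0) k) : HasWindingNumber (H 1) k := by
  -- Clamping the parameter to `[0, 1]` extends the homotopy to the whole plane, where a logarithm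
  -- exists.
  set c : ℝ → ℝ := fun s => (projIcc (0 : ℝ) 1 zero_le_one s : ℝ) with hc
  have hcm : ∀ s, c s ∈ Icc (0 : ℝ) 1 := fun s => (projIcc (0 : ℝ) 1 zero_le_one s).2
  have hcc : Continuous c := continuous_subtype_val.comp continuous_projIcc
  have hG : Continuous (fun p : ℝ × ℝ => H (c p.1) p.2) :=
    hH.comp_continuous (f := fun p : ℝ × ℝ => (c p.1, p.2)) (by fun_prop)
      (fun p => ⟨hcm _, trivial⟩)
  obtain ⟨Φ, hΦ, he⟩ := exists_continuous_log hG (fun p => h0 _ (hcm _) _)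
  have c0 : c 0 = 0 := by simp [hc]
  have c1 : c 1 = 1 := by simp [hc]
  obtain ⟨l, hl⟩ : ∃ l : ℤ, Φ (0, 2 * Real.pi) = Φ (0, 0) + l * (2 * Real.pi * Complex.I) := by
    apply Complex.exp_eq_exp_iff_exists_int.1
    rw [he, he]; exact hp _ (hcm _)
  -- The increment `Φ(s, 2π) - Φ(s, 0)` takes values in `2πiℤ`, so it is the same at `s = 0` and `s
  -- = 1`.
  have hl1 : Φ (1, 2 * Real.pi) = Φ (1, 0) + l * (2 * Real.pi * Complex.I) := by
    have := eq_of_exp_eq_one (g := fun s : ℝ => Φ (s, 2 * Real.pi) - Φ (s, 0)) (by fun_prop)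
      (fun s => by
        rw [Complex.exp_sub, he, he]; simp only [hp _ (hcm s)]; exact div_self (h0 _ (hcm _) _)) 1 0
    simp only [hl] at this
    linear_combination this
  have hW : ∀ s, c s = s → Φ (s, 2 * Real.pi) = Φ (s, 0) + l * (2 * Real.pi * Complex.I) →
      HasWindingNumber (H s) l := fun s hs hh =>
    ⟨fun t => Φ (s, t), by fun_prop, fun t => by rw [he]; simp only [hs], hh⟩
  rw [hk.unique (hW 0 c0 hl)]
  exact hW 1 c1 hl1

/-- Rouché: the segment from `γ t` to `δ t` stays off the origin. -/
theorem _root_.HasWindingNumber.of_close {γ δ : ℝ → ℂ} {k : ℤ} (hk : HasWindingNumber γ k)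
    (hγ : Continuous γ) (hδ : Continuous δ)
    (hpγ : γ (2 * Real.pi) = γ 0) (hpδ : δ (2 * Real.pi) = δ 0)
    (h : ∀ t, ‖δ t - γ t‖ < ‖γ t‖) : HasWindingNumber δ k := by
  have := HasWindingNumber.homotopy (H := fun s t => γ t + s * (δ t - γ t)) (k := k)
    (by fun_prop) (fun s hs t h0 => ?_) (fun s hs => by simp [hpγ, hpδ]) (by simpa using hk)
  · simpa using this
  · have h1 : γ t = -(s * (δ t - γ t)) := by linear_combination h0
    have h2 : ‖γ t‖ ≤ ‖δ t - γ t‖ := by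
      conv_lhs => rw [h1, norm_neg, norm_mul]
      rw [Complex.norm_real, Real.norm_of_nonneg hs.1]
      exact mul_le_of_le_one_left (norm_nonneg _) hs.2
    exact absurd (h t) (not_lt.2 h2)

/-! ### Index along a circle -/

/-- The winding number of `f` along the circle of radius `r` about `c` is `k`. -/
def CircleIndex (f : ℂ → ℂ) (c : ℂ) (r : ℝ) (k : ℤ) : Prop :=
  HasWindingNumber (fun t => f (circleMap c r t)) k

theorem circleMap_two_pi (c : ℂ) (r : ℝ) : circleMap c r (2 * Real.pi) = circleMap c r 0 := by
  simp [circleMap]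

theorem norm_circleMap_sub {r : ℝ} (hr : 0 ≤ r) (c : ℂ) (t : ℝ) : ‖circleMap c r t - c‖ = r := by
  simp [abs_of_nonneg hr]

theorem exists_circleIndex {f : ℂ → ℂ} {c : ℂ} {r : ℝ} (hr : 0 ≤ r)
    (hf : ContinuousOn f (Metric.sphere c r)) (h0 : ∀ z ∈ Metric.sphere c r, f z ≠ 0) :
    ∃ k, CircleIndex f c r k :=
  exists_hasWindingNumber
    (hf.comp_continuous (continuous_circleMap c r) fun t => circleMap_mem_sphere c hr t)
    (fun t => h0 _ (circleMap_mem_sphere c hr t)) (by rw [circleMap_two_pi])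

theorem CircleIndex.congr {f g : ℂ → ℂ} {c : ℂ} {r : ℝ} {k : ℤ} (hr : 0 ≤ r)
    (h : CircleIndex f c r k) (hfg : ∀ z ∈ Metric.sphere c r, f z = g z) : CircleIndex g c r k := by
  have : (fun t => g (circleMap c r t)) = fun t => f (circleMap c r t) :=
    funext fun t => (hfg _ (circleMap_mem_sphere c hr t)).symm
  rw [CircleIndex, this]; exact h

/-- The homotopy runs through concentric circles; `uIcc` serves for enlarging as well as for
shrinking. -/
theorem CircleIndex.change_radius {f : ℂ → ℂ} {c : ℂ} {r s : ℝ} {k : ℤ} (hr : 0 ≤ r)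
    (hs : 0 ≤ s)
    (hf : ContinuousOn f {z | ‖z - c‖ ∈ uIcc r s}) (h0 : ∀ z, ‖z - c‖ ∈ uIcc r s → f z ≠ 0)
    (h : CircleIndex f c r k) : CircleIndex f c s k := by
  have hmem : ∀ τ ∈ Icc (0 : ℝ) 1, ∀ t : ℝ,
      ‖circleMap c ((1 - τ) * r + τ * s) t - c‖ ∈ uIcc r s := by
    intro τ hτ t
    rw [norm_circleMap_sub (add_nonneg (mul_nonneg (sub_nonneg.2 hτ.2) hr) (mul_nonneg hτ.1 hs))]
    have := (convex_uIcc r s) left_mem_uIcc right_mem_uIcc (sub_nonneg.2 hτ.2) hτ.1 (by ring)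
    simpa using this
  have := HasWindingNumber.homotopy
    (H := fun τ t => f (circleMap c ((1 - τ) * r + τ * s) t)) (k := k) ?_
    (fun τ hτ t => h0 _ (hmem τ hτ t)) (fun τ _ => by rw [circleMap_two_pi])
    (by simpa [CircleIndex] using h)
  · simpa [CircleIndex] using this
  · refine hf.comp (s := Icc 0 1 ×ˢ univ)
      (f := fun p : ℝ × ℝ => circleMap c ((1 - p.1) * r + p.1 * s) p.2) ?_ ?_
    · unfold circleMap; fun_prop
    · rintro ⟨τ, t⟩ ⟨hτ, -⟩; exact hmem τ hτ t

/-- The circle shrinks to its centre, where the loop is constant. -/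
theorem circleIndex_zero {f : ℂ → ℂ} {c : ℂ} {r : ℝ} (hr : 0 ≤ r)
    (hf : ContinuousOn f (Metric.closedBall c r)) (h0 : ∀ z ∈ Metric.closedBall c r, f z ≠ 0) :
    CircleIndex f c r 0 := by
  have hsub : ∀ z : ℂ, ‖z - c‖ ∈ uIcc 0 r → z ∈ Metric.closedBall c r := fun z hz => by
    rw [uIcc_of_le hr] at hz; simpa [dist_eq_norm] using hz.2
  refine CircleIndex.change_radius le_rfl hr (hf.mono hsub) (fun z hz => h0 z (hsub z hz)) ?_
  have := hasWindingNumber_const (h0 c (by simpa using hr))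
  simpa [CircleIndex] using this

theorem CircleIndex.mul {f g : ℂ → ℂ} {c : ℂ} {r : ℝ} {k l : ℤ} (hf : CircleIndex f c r k)
    (hg : CircleIndex g c r l) : CircleIndex (fun z => f z * g z) c r (k + l) :=
  HasWindingNumber.mul hf hg

theorem CircleIndex.unique {f : ℂ → ℂ} {c : ℂ} {r : ℝ} {k l : ℤ} (hf : CircleIndex f c r k)
    (hg : CircleIndex f c r l) : k = l := HasWindingNumber.unique hf hg

/-- The linear function `z - a` has index one about every disk that contains `a`. -/
theorem circleIndex_sub {a c : ℂ} {r : ℝ} (h : a ∈ Metric.ball c r) :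
    CircleIndex (fun z => z - a) c r 1 := by
  have hr : 0 < r := Metric.pos_of_mem_ball h
  refine HasWindingNumber.of_close (hasWindingNumber_circle hr c) (by fun_prop) (by fun_prop)
    (by rw [circleMap_two_pi]) (by rw [circleMap_two_pi]) fun t => ?_
  rw [norm_circleMap_sub hr.le, sub_sub_sub_cancel_left, ← dist_eq_norm, dist_comm]
  exact h

/-- The index of `f` on all small circles about `a` is `k`. -/
def HasLocalIndex (f : ℂ → ℂ) (a : ℂ) (k : ℤ) : Prop :=
  ∀ᶠ r in 𝓝[>] (0 : ℝ), CircleIndex f a r k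

theorem CircleIndex.hasLocalIndex {f : ℂ → ℂ} {a : ℂ} {r : ℝ} {k : ℤ} (hr : 0 < r)
    (hf : ContinuousOn f (Metric.closedBall a r))
    (h0 : ∀ z ∈ Metric.closedBall a r, z ≠ a → f z ≠ 0) (h : CircleIndex f a r k) :
    HasLocalIndex f a k := by
  filter_upwards [Ioc_mem_nhdsGT hr] with s hs
  have hsub : ∀ z : ℂ, ‖z - a‖ ∈ uIcc r s → z ∈ Metric.closedBall a r ∧ z ≠ a := fun z hz => by
    rw [uIcc_of_ge hs.2] at hz
    refine ⟨by simpa [dist_eq_norm] using hz.2, ?_⟩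
    rintro rfl
    simp at hz; exact absurd hz.1 (not_le.2 hs.1)
  exact h.change_radius hr.le hs.1.le (hf.mono fun z hz => (hsub z hz).1)
    (fun z hz => h0 z (hsub z hz).1 (hsub z hz).2)

theorem HasLocalIndex.mul {f g : ℂ → ℂ} {a : ℂ} {k l : ℤ} (hf : HasLocalIndex f a k)
    (hg : HasLocalIndex g a l) : HasLocalIndex (fun z => f z * g z) a (k + l) := by
  filter_upwards [hf, hg] with r h1 h2 using h1.mul h2

theorem eventually_forall_ball {a : ℂ} {p : ℂ → Prop} (h : ∀ᶠ z in 𝓝 a, p z) :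
    ∀ᶠ r in 𝓝[>] (0 : ℝ), ∀ z ∈ Metric.closedBall a r, p z := by
  obtain ⟨ε, hε, h⟩ := Metric.eventually_nhds_iff_ball.1 h
  filter_upwards [Ioo_mem_nhdsGT hε] with r hr z hz
  exact h z (Metric.closedBall_subset_ball hr.2 hz)

theorem HasLocalIndex.congr {f g : ℂ → ℂ} {a : ℂ} {k : ℤ} (h : HasLocalIndex f a k)
    (hfg : ∀ᶠ z in 𝓝[≠] a, f z = g z) : HasLocalIndex g a k := by
  filter_upwards [h, eventually_forall_ball (eventually_nhdsWithin_iff.1 hfg),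
    self_mem_nhdsWithin] with r h1 h2 (hr : 0 < r)
  exact h1.congr hr.le fun z hz => h2 z (Metric.sphere_subset_closedBall hz)
    (Metric.ne_of_mem_sphere hz hr.ne')

theorem hasLocalIndex_zero {f : ℂ → ℂ} {a : ℂ} (hf : ∀ᶠ z in 𝓝 a, ContinuousAt f z)
    (h0 : f a ≠ 0) : HasLocalIndex f a 0 := by
  have h1 : ∀ᶠ z in 𝓝 a, f z ≠ 0 := hf.self_of_nhds.eventually_ne h0
  filter_upwards [eventually_forall_ball (hf.and h1), self_mem_nhdsWithin] with r h (hr : 0 < r)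
  exact circleIndex_zero hr.le (fun z hz => (h z hz).1.continuousWithinAt) (fun z hz => (h z hz).2)

theorem exists_hasLocalIndex {f : ℂ → ℂ} {a : ℂ} (hf : ∀ᶠ z in 𝓝 a, ContinuousAt f z)
    (h0 : ∀ᶠ z in 𝓝[≠] a, f z ≠ 0) : ∃ k, HasLocalIndex f a k := by
  obtain ⟨r, h, hr : 0 < r⟩ := ((eventually_forall_ball
    (hf.and (eventually_nhdsWithin_iff.1 h0))).and self_mem_nhdsWithin).exists
  have hc : ContinuousOn f (Metric.closedBall a r) := fun z hz => (h z hz).1.continuousWithinAt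
  obtain ⟨k, hk⟩ := exists_circleIndex (f := f) hr.le (hc.mono Metric.sphere_subset_closedBall)
    (fun z hz => (h z (Metric.sphere_subset_closedBall hz)).2 (Metric.ne_of_mem_sphere hz hr.ne'))
  exact ⟨k, hk.hasLocalIndex hr hc fun z hz hne => (h z hz).2 hne⟩

theorem hasLocalIndex_sub (a : ℂ) : HasLocalIndex (fun z => z - a) a 1 := by
  filter_upwards [self_mem_nhdsWithin] with r hr
  exact circleIndex_sub (Metric.mem_ball_self hr)

theorem HasLocalIndex.zpow {f : ℂ → ℂ} {a : ℂ} {k : ℤ} (hf : HasLocalIndex f a k) (n : ℤ) :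
    HasLocalIndex (fun z => f z ^ n) a (n * k) := by
  filter_upwards [hf] with r h using HasWindingNumber.zpow h n

theorem exists_continuousOn_log {E : Type*} [NormedAddCommGroup E] [NormedSpace ℝ E] {U : Set E}
    (hU : Convex ℝ U) (hUo : IsOpen U) (hne : U.Nonempty) {γ : E → ℂ}
    (hγ : ContinuousOn γ U) (h0 : ∀ x ∈ U, γ x ≠ 0) :
    ∃ φ : E → ℂ, ContinuousOn φ U ∧ ∀ x ∈ U, Complex.exp (φ x) = γ x := by
  have hs : IsSimplyConnected U := by
    have : ContractibleSpace U := hU.contractibleSpace hne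
    have : SimplyConnectedSpace U := inferInstance
    exact this
  obtain ⟨f, hf, he⟩ := Complex.exists_continuousOn_eqOn_exp_comp hs hUo
    hγ (by rintro ⟨x, hxU, hx⟩; exact h0 x hxU hx)
  exact ⟨f, hf, fun x hx => he hx⟩

/-- The open annulus. -/
def annulus (a : ℂ) (r₁ r₂ : ℝ) : Set ℂ := {z | ‖z - a‖ ∈ Ioo r₁ r₂}

/-- The preimage of an annulus about the origin under the exponential function. -/
def expStrip (r₁ r₂ : ℝ) : Set ℂ := {ζ | Real.exp ζ.re ∈ Ioo r₁ r₂}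

theorem isOpen_annulus (a : ℂ) (r₁ r₂ : ℝ) : IsOpen (annulus a r₁ r₂) :=
  isOpen_Ioo.preimage (f := fun z : ℂ => ‖z - a‖) (by fun_prop)

theorem isOpen_expStrip (r₁ r₂ : ℝ) : IsOpen (expStrip r₁ r₂) :=
  isOpen_Ioo.preimage (f := fun z : ℂ => Real.exp z.re) (by fun_prop)

theorem convex_expStrip (r₁ r₂ : ℝ) : Convex ℝ (expStrip r₁ r₂) := by
  have : Convex ℝ (Real.exp ⁻¹' Ioo r₁ r₂) :=
    (ordConnected_Ioo.preimage_mono Real.exp_monotone).convex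
  exact this.linear_preimage Complex.reLm

theorem add_exp_mem_annulus {a ζ : ℂ} {r₁ r₂ : ℝ} (h : ζ ∈ expStrip r₁ r₂) :
    a + Complex.exp ζ ∈ annulus a r₁ r₂ := by
  simpa [annulus, expStrip, Complex.norm_exp] using h

theorem add_int_mem_expStrip {ζ : ℂ} {r₁ r₂ : ℝ} (n : ℤ) (h : ζ ∈ expStrip r₁ r₂) :
    ζ + n * (2 * Real.pi * Complex.I) ∈ expStrip r₁ r₂ := by
  simpa [expStrip] using h

/-- The strip covers the annulus by `ζ ↦ a + exp ζ` and is convex, so `f` has a logarithm `Φ` there;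
the deck transformation by `2πi` adds `m · 2πi` to it. Both the index of composed loops and, for `m
= 0`, a logarithm of `f` on the annulus are read off `Φ`. -/
theorem exists_annulus_lift {f : ℂ → ℂ} {a : ℂ} {r₁ r₂ r : ℝ} {m : ℤ} (h1 : 0 ≤ r₁)
    (hr : r ∈ Ioo r₁ r₂) (hf : ContinuousOn f (annulus a r₁ r₂))
    (h0 : ∀ z ∈ annulus a r₁ r₂, f z ≠ 0) (hm : CircleIndex f a r m) :
    ∃ Φ : ℂ → ℂ, ContinuousOn Φ (expStrip r₁ r₂) ∧
      (∀ ζ ∈ expStrip r₁ r₂, Complex.exp (Φ ζ) = f (a + Complex.exp ζ)) ∧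
      ∀ ζ ∈ expStrip r₁ r₂, ∀ n : ℤ, Φ (ζ + n * (2 * Real.pi * Complex.I)) =
        Φ ζ + (n * m : ℤ) * (2 * Real.pi * Complex.I) := by
  have hr0 : 0 < r := h1.trans_lt hr.1
  have hbase : ∀ t : ℝ, (Real.log r + t * Complex.I : ℂ) ∈ expStrip r₁ r₂ := fun t => by
    simpa [expStrip, Real.exp_log hr0] using hr
  obtain ⟨Φ, hΦ, he⟩ := exists_continuousOn_log (convex_expStrip r₁ r₂) (isOpen_expStrip r₁ r₂)
    ⟨_, hbase 0⟩ (γ := fun ζ => f (a + Complex.exp ζ))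
    (hf.comp (by fun_prop) fun ζ hζ => add_exp_mem_annulus hζ)
    (fun ζ hζ => h0 _ (add_exp_mem_annulus hζ))
  -- The increment under one deck transformation is a constant multiple of `2πi` by connectedness;
  -- the vertical line over the circle of radius `r` identifies the multiple as `m`.
  have key : ∀ ζ ∈ expStrip r₁ r₂,
      Φ (ζ + 2 * Real.pi * Complex.I) = Φ ζ + m * (2 * Real.pi * Complex.I) := by
    have hmem1 : ∀ ζ ∈ expStrip r₁ r₂, ζ + 2 * Real.pi * Complex.I ∈ expStrip r₁ r₂ :=
      fun ζ hζ => by simpa using add_int_mem_expStrip 1 hζ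
    have : PreconnectedSpace (expStrip r₁ r₂) :=
      Subtype.preconnectedSpace (convex_expStrip r₁ r₂).isPreconnected
    have hc := eq_of_exp_eq_one (X := expStrip r₁ r₂)
      (g := fun ζ => Φ (ζ + 2 * Real.pi * Complex.I) - Φ ζ)
      (Continuous.sub (hΦ.comp_continuous (by fun_prop) fun ζ => hmem1 _ ζ.2)
        (hΦ.comp_continuous (by fun_prop) fun ζ => ζ.2)) (fun ζ => by
          rw [Complex.exp_sub, he _ ζ.2, he _ (hmem1 _ ζ.2), Complex.exp_add,
            Complex.exp_two_pi_mul_I, mul_one, div_self (h0 _ (add_exp_mem_annulus ζ.2))])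
    obtain ⟨l, hl⟩ : ∃ l : ℤ, Φ (Real.log r + 2 * Real.pi * Complex.I) =
        Φ (Real.log r) + l * (2 * Real.pi * Complex.I) := by
      apply Complex.exp_eq_exp_iff_exists_int.1
      have h0' : (Real.log r : ℂ) ∈ expStrip r₁ r₂ := by simpa using hbase 0
      rw [he _ h0', he _ (hmem1 _ h0'), Complex.exp_add, Complex.exp_two_pi_mul_I, mul_one]
    have hw : CircleIndex f a r l := by
      refine ⟨fun t => Φ (Real.log r + t * Complex.I),
        hΦ.comp_continuous (by fun_prop) hbase, fun t => ?_, ?_⟩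
      · rw [he _ (hbase t), Complex.exp_add, ← Complex.ofReal_exp, Real.exp_log hr0]; rfl
      · push_cast; simpa using hl
    have hlm := hw.unique hm
    subst hlm
    intro ζ hζ
    have h0' : (Real.log r : ℂ) ∈ expStrip r₁ r₂ := by simpa using hbase 0
    have := hc ⟨ζ, hζ⟩ ⟨_, h0'⟩
    simp only [hl] at this
    linear_combination this
  refine ⟨Φ, hΦ, he, fun ζ hζ n => ?_⟩
  induction n using Int.induction_on with
  | zero => simp
  | succ n ih =>
    have := key _ (add_int_mem_expStrip n hζ)
    rw [ih] at this
    have e : ζ + ((n + 1 : ℤ) : ℂ) * (2 * Real.pi * Complex.I) =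
      ζ + (n : ℤ) * (2 * Real.pi * Complex.I) + 2 * Real.pi * Complex.I := by push_cast; ring
    rw [e, this]; push_cast; ring
  | pred n ih =>
    have := key _ (add_int_mem_expStrip (-n - 1) hζ)
    have e : ζ + ((-n - 1 : ℤ) : ℂ) * (2 * Real.pi * Complex.I) + 2 * Real.pi * Complex.I =
      ζ + (-n : ℤ) * (2 * Real.pi * Complex.I) := by push_cast; ring
    rw [e, ih] at this
    push_cast at this ⊢
    linear_combination -this

/-- If `f` has index `m` on an annulus, it turns loops in the annulus of winding number `k` into
loops of winding number `k * m`. -/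
theorem CircleIndex.comp {f : ℂ → ℂ} {a : ℂ} {r₁ r₂ r : ℝ} {m k : ℤ} (h1 : 0 ≤ r₁)
    (hr : r ∈ Ioo r₁ r₂) (hf : ContinuousOn f (annulus a r₁ r₂))
    (h0 : ∀ z ∈ annulus a r₁ r₂, f z ≠ 0) (hm : CircleIndex f a r m) {γ : ℝ → ℂ}
    (hγ : ∀ t, γ t ∈ annulus a r₁ r₂) (hk : HasWindingNumber (fun t => γ t - a) k) :
    HasWindingNumber (fun t => f (γ t)) (k * m) := by
  obtain ⟨Φ, hΦ, he, hp⟩ := exists_annulus_lift h1 hr hf h0 hm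
  obtain ⟨φ, hφ, he', h⟩ := hk
  have hmem : ∀ t, φ t ∈ expStrip r₁ r₂ := fun t => by
    have h2 : ‖γ t - a‖ ∈ Ioo r₁ r₂ := hγ t
    have h3 : Complex.exp (φ t) = γ t - a := he' t
    rwa [← h3, Complex.norm_exp] at h2
  refine ⟨fun t => Φ (φ t), hΦ.comp_continuous hφ hmem, fun t => ?_, ?_⟩
  · rw [he _ (hmem t), he']; congr 1; ring
  · simp only [h]; exact hp _ (hmem 0) k

/-- For index zero `Φ` is invariant under the deck transformations, so it descends to the annulus.
-/
theorem exists_log_on_annulus {f : ℂ → ℂ} {a : ℂ} {r₁ r₂ r : ℝ} (h1 : 0 ≤ r₁)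
    (hr : r ∈ Ioo r₁ r₂) (hf : ContinuousOn f (annulus a r₁ r₂))
    (h0 : ∀ z ∈ annulus a r₁ r₂, f z ≠ 0) (hm : CircleIndex f a r 0) :
    ∃ L : ℂ → ℂ, ContinuousOn L (annulus a r₁ r₂) ∧
      ∀ z ∈ annulus a r₁ r₂, Complex.exp (L z) = f z := by
  obtain ⟨Φ, hΦ, he, hp⟩ := exists_annulus_lift h1 hr hf h0 hm
  have hne : ∀ z ∈ annulus a r₁ r₂, z - a ≠ 0 := fun z hz h => by
    have := hz.1; rw [h, norm_zero] at this; linarith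
  have hS : ∀ z ∈ annulus a r₁ r₂, ∀ ζ, Complex.exp ζ = z - a → ζ ∈ expStrip r₁ r₂ := by
    intro z hz ζ hζ
    rwa [annulus, mem_ofPred_eq, ← hζ, Complex.norm_exp] at hz
  have hΦ' : ∀ ζ ∈ expStrip r₁ r₂, ∀ ξ, Complex.exp ξ = Complex.exp ζ → Φ ξ = Φ ζ := by
    intro ζ hζ ξ h
    obtain ⟨n, rfl⟩ := Complex.exp_eq_exp_iff_exists_int.1 h
    simpa using hp ζ hζ n
  refine ⟨fun z => Φ (Complex.log (z - a)), fun z hz => ContinuousAt.continuousWithinAt ?_,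
    fun z hz => ?_⟩
  · have hA : ∀ᶠ w in 𝓝 z, w ∈ annulus a r₁ r₂ := (isOpen_annulus a r₁ r₂).mem_nhds hz
    by_cases hs : z - a ∈ Complex.slitPlane
    · have hc : ContinuousAt Φ (Complex.log (z - a)) :=
        hΦ.continuousAt ((isOpen_expStrip _ _).mem_nhds (hS z hz _ (Complex.exp_log (hne z hz))))
      exact hc.comp (f := fun z => Complex.log (z - a))
        (((continuous_id.sub continuous_const).continuousAt).clog hs)
    -- On the cut of the logarithm the branch `log(-(z - a)) + πi` is continuous, and `Φ` does not
    -- see the difference of branches.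
    · have hs' : -(z - a) ∈ Complex.slitPlane := by
        rw [Complex.mem_slitPlane_iff] at hs ⊢
        push Not at hs
        rcases lt_or_eq_of_le hs.1 with h | h
        · left; simp only [Complex.neg_re]; linarith
        · exact absurd (Complex.ext h hs.2) (hne z hz)
      have hex : ∀ w ∈ annulus a r₁ r₂,
          Complex.exp (Complex.log (-(w - a)) + Real.pi * Complex.I) = w - a := fun w hw => by
        rw [Complex.exp_add, Complex.exp_log (neg_ne_zero.2 (hne w hw)), Complex.exp_pi_mul_I]; ring
      have hc : ContinuousAt Φ (Complex.log (-(z - a)) + Real.pi * Complex.I) :=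
        hΦ.continuousAt ((isOpen_expStrip _ _).mem_nhds (hS z hz _ (hex z hz)))
      have h2 := hc.comp (f := fun z => Complex.log (-(z - a)) + Real.pi * Complex.I)
        ((((continuous_id.sub continuous_const).neg.continuousAt).clog hs').add continuousAt_const)
      refine h2.congr ?_
      filter_upwards [hA] with w hw
      exact hΦ' _ (hS w hw _ (Complex.exp_log (hne w hw))) _
        ((hex w hw).trans (Complex.exp_log (hne w hw)).symm)
  · rw [he _ (hS z hz _ (Complex.exp_log (hne z hz))), Complex.exp_log (hne z hz)]; congr 1; ring

/-- A function of index zero about an isolated singularity can be replaced near it by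
a function without zeros. -/
theorem exists_fill {f : ℂ → ℂ} {a : ℂ} {ε : ℝ} (hε : 0 < ε)
    (hf : ContinuousOn f (annulus a 0 ε)) (h0 : ∀ z ∈ annulus a 0 ε, f z ≠ 0)
    (hm : CircleIndex f a (ε / 2) 0) :
    ∃ g : ℂ → ℂ, (∀ z, ε / 2 ≤ ‖z - a‖ → g z = f z) ∧ ContinuousOn g (Metric.ball a ε) ∧
      ∀ z ∈ Metric.ball a ε, g z ≠ 0 := by
  obtain ⟨L, hL, he⟩ := exists_log_on_annulus le_rfl (r := ε / 2) ⟨by linarith, by linarith⟩ hf h0 hm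
  -- The cut-off is `0` within radius `ε / 4` and `1` beyond `ε / 2`. Then `exp(χ L)` joins the
  -- constant `1` to `f` without zeros, and continuity of `L` at `a` is not needed.
  set χ : ℂ → ℝ := fun z => max 0 (min 1 ((‖z - a‖ - ε / 4) / (ε / 4))) with hχ
  have hχc : Continuous χ := by fun_prop
  have hχ1 : ∀ z, ε / 2 ≤ ‖z - a‖ → χ z = 1 := fun z hz => by
    have : 1 ≤ (‖z - a‖ - ε / 4) / (ε / 4) := by rw [le_div_iff₀ (by linarith)]; linarith
    simp [hχ, min_eq_left this]
  have hχ0 : ∀ z, ‖z - a‖ ≤ ε / 4 → χ z = 0 := fun z hz => by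
    have : (‖z - a‖ - ε / 4) / (ε / 4) ≤ 0 := div_nonpos_of_nonpos_of_nonneg (by linarith) (by linarith)
    simp [hχ, min_eq_right (this.trans zero_le_one), this]
  refine ⟨fun z => if ‖z - a‖ < ε / 2 then Complex.exp (χ z * L z) else f z,
    fun z hz => if_neg (not_lt.2 hz), fun z hz => ContinuousAt.continuousWithinAt ?_, fun z hz => ?_⟩
  · by_cases hz4 : ‖z - a‖ < ε / 4
    · have : ∀ᶠ w in 𝓝 z, ‖w - a‖ < ε / 4 :=
        (continuous_id.sub continuous_const).norm.continuousAt.eventually_lt_const hz4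
      refine (continuousAt_const (y := (1 : ℂ))).congr ?_
      filter_upwards [this] with w hw
      rw [if_pos (by linarith), hχ0 w hw.le]; simp
    · have hzA : z ∈ annulus a 0 ε := ⟨by push Not at hz4; linarith, by simpa [dist_eq_norm] using hz⟩
      have hA : ∀ᶠ w in 𝓝 z, w ∈ annulus a 0 ε := (isOpen_annulus a 0 ε).mem_nhds hzA
      have hLc : ContinuousAt L z := hL.continuousAt hA
      have : ContinuousAt (fun w => Complex.exp (χ w * L w)) z :=
        Complex.continuous_exp.continuousAt.comp
          ((Complex.continuous_ofReal.comp hχc).continuousAt.mul hLc)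
      refine this.congr ?_
      filter_upwards [hA] with w hw
      split_ifs with h
      · rfl
      · rw [hχ1 w (not_lt.1 h), Complex.ofReal_one, one_mul, he w hw]
  · dsimp only
    split_ifs with h
    · exact Complex.exp_ne_zero _
    · exact h0 z ⟨by push Not at h; linarith, by simpa [dist_eq_norm] using hz⟩

/-- The index along a circle is the sum of the local indices at the zeros inside. -/
theorem circleIndex_sum {c : ℂ} {R : ℝ} (hR : 0 ≤ R) (S : Finset ℂ) (k : ℂ → ℤ) :
    ∀ f : ℂ → ℂ, ContinuousOn f (Metric.closedBall c R) → (∀ z ∈ S, z ∈ Metric.ball c R) →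
    (∀ z ∈ Metric.closedBall c R, z ∉ S → f z ≠ 0) → (∀ z ∈ S, HasLocalIndex f z (k z)) →
    CircleIndex f c R (∑ z ∈ S, k z) := by
  classical
  induction S using Finset.induction_on with
  | empty =>
    intro f hf _ h0 _
    simpa using circleIndex_zero hR hf (fun z hz => h0 z hz (by simp))
  | insert a S haS ih =>
    intro f hf hS h0 hk
    have haR : a ∈ Metric.ball c R := hS a (Finset.mem_insert_self _ _)
    have hev : ∀ᶠ z in 𝓝 a, z ∈ Metric.ball c R ∧ z ∉ S :=
      Filter.Eventually.and (Metric.isOpen_ball.mem_nhds haR)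
        (S.finite_toSet.isClosed.isOpen_compl.mem_nhds (by simpa using haS))
    obtain ⟨r, ⟨hr1, hr2⟩, hr : 0 < r⟩ := ((((eventually_forall_ball hev).and
      (hk a (Finset.mem_insert_self _ _)))).and self_mem_nhdsWithin).exists
    have hrA : ∀ z ∈ annulus a 0 r, z ∈ Metric.ball c R ∧ z ∉ insert a S := fun z hz => by
      have h1 := hr1 z (by simpa [dist_eq_norm] using hz.2.le)
      refine ⟨h1.1, ?_⟩
      rw [Finset.mem_insert, not_or]
      exact ⟨fun h => by subst h; simpa using hz.1, h1.2⟩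
    have hkr : CircleIndex f a (r / 2) (k a) := by
      refine hr2.change_radius hr.le (by linarith) (hf.mono fun z hz => ?_) fun z hz => ?_
      all_goals rw [uIcc_of_ge (by linarith)] at hz
      · exact Metric.ball_subset_closedBall (hr1 z (by simpa [dist_eq_norm] using hz.2)).1
      · have h1 := hr1 z (by simpa [dist_eq_norm] using hz.2)
        refine h0 z (Metric.ball_subset_closedBall h1.1) ?_
        rw [Finset.mem_insert, not_or]
        exact ⟨fun h => by subst h; have := hz.1; simp at this; linarith, h1.2⟩
    -- Dividing by `(z - a) ^ k a` makes the index at `a` zero, so this singularity can be filled in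
    -- and the induction hypothesis applies to the result `g`.
    set f₀ : ℂ → ℂ := fun z => f z * (z - a) ^ (-k a) with hf₀
    have hsub : ∀ z ≠ a, z - a ≠ 0 := fun z hz => sub_ne_zero.2 hz
    have hzc : ∀ z ≠ a, ContinuousAt (fun z => (z - a) ^ (-k a)) z := fun z hz =>
      ContinuousAt.zpow₀ (by fun_prop) _ (Or.inl (hsub z hz))
    have hf₀c : ∀ s ⊆ Metric.closedBall c R, a ∉ s → ContinuousOn f₀ s := fun s hs has z hz =>
      (hf z (hs hz)).mono hs |>.mul (hzc z (fun h => has (h ▸ hz))).continuousWithinAt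
    have haA : a ∉ annulus a 0 r := by simp [annulus]
    have hz0 : ∀ z ≠ a, f z ≠ 0 → f₀ z ≠ 0 := fun z hz h => mul_ne_zero h (zpow_ne_zero _ (hsub z hz))
    have hidx : CircleIndex f₀ a (r / 2) 0 := by
      have h1 : CircleIndex (fun z => (z - a) ^ (-k a)) a (r / 2) (-k a * 1) :=
        HasWindingNumber.zpow (circleIndex_sub (Metric.mem_ball_self (x := a) (half_pos hr))) (-k a)
      have := hkr.mul h1
      rwa [mul_one, add_neg_cancel] at this
    obtain ⟨g, hgf, hgc, hg0⟩ := exists_fill hr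
      (hf₀c _ (fun z hz => Metric.ball_subset_closedBall (hrA z hz).1) haA)
      (fun z hz => hz0 z (fun h => haA (h ▸ hz))
        (h0 z (Metric.ball_subset_closedBall (hrA z hz).1) (hrA z hz).2)) hidx
    have hfar : ∀ z, z ∉ Metric.ball a r → ∀ᶠ w in 𝓝 z, g w = f₀ w := fun z hz => by
      have : r / 2 < ‖z - a‖ := by
        rw [Metric.mem_ball, dist_eq_norm, not_lt] at hz; linarith
      filter_upwards [(continuous_id.sub continuous_const).norm.continuousAt.eventually_const_lt this]
        with w hw using hgf w hw.le
    have hne : ∀ z, z ∉ Metric.ball a r → z ≠ a := fun z hz h => hz (h ▸ Metric.mem_ball_self hr)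
    have h1 := ih g (fun z hz => ?_) (fun z hz => hS z (Finset.mem_insert_of_mem hz))
      (fun z hz hzS => ?_) (fun z hz => ?_)
    -- On the outer circle `f` is `g` times the removed factor, which winds `k a` times.
    · have h2 : CircleIndex (fun z => (z - a) ^ (k a)) c R (k a * 1) :=
        HasWindingNumber.zpow (circleIndex_sub haR) (k a)
      have h3 := CircleIndex.mul h1 h2
      rw [Finset.sum_insert haS, add_comm]
      rw [mul_one] at h3
      refine h3.congr hR fun z hz => ?_
      have hza : z ∉ Metric.ball a r := fun h =>
        absurd (hr1 z (Metric.ball_subset_closedBall h)).1 (by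
          rw [Metric.mem_sphere] at hz; simp [hz])
      rw [(hfar z hza).self_of_nhds]
      simp only [hf₀]
      rw [mul_assoc, ← zpow_add₀ (hsub z (hne z hza))]; simp
    · by_cases hza : z ∈ Metric.ball a r
      · exact (hgc.continuousAt (Metric.isOpen_ball.mem_nhds hza)).continuousWithinAt
      · have : ContinuousWithinAt f₀ (Metric.closedBall c R) z :=
          (hf z hz).mul (hzc z (hne z hza)).continuousWithinAt
        exact this.congr_of_eventuallyEq (nhdsWithin_le_nhds (hfar z hza)) (hfar z hza).self_of_nhds
    · by_cases hza : z ∈ Metric.ball a r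
      · exact hg0 z hza
      · rw [(hfar z hza).self_of_nhds]
        exact hz0 z (hne z hza) (h0 z hz (by simp [hne z hza, hzS]))
    · have hza : z ∉ Metric.ball a r := fun h => (hr1 z (Metric.ball_subset_closedBall h)).2 hz
      have h2 : HasLocalIndex (fun z => (z - a) ^ (-k a)) z 0 :=
        hasLocalIndex_zero (by
          filter_upwards [isOpen_ne.mem_nhds (hne z hza)] with w hw using hzc w hw)
          (zpow_ne_zero _ (hsub z (hne z hza)))
      have h3 := (hk z (Finset.mem_insert_of_mem hz)).mul h2
      rw [add_zero] at h3
      exact h3.congr (nhdsWithin_le_nhds ((hfar z hza).mono fun w hw => hw.symm))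

/-- Move `w` in a straight line to `i` or `-i`, whichever lies in the same half-plane. The
coefficient of the sine stays nonreal, so the ellipse never passes through the origin. -/
theorem hasWindingNumber_ellipse {c w : ℂ} (hc : c ≠ 0) (hw : w.im ≠ 0) :
    HasWindingNumber (fun t => c * (Real.cos t + w * Real.sin t)) (if 0 < w.im then 1 else -1) := by
  set e : ℤ := if 0 < w.im then 1 else -1 with he
  have he1 : (e : ℝ) * w.im > 0 := by
    rw [he]; split_ifs with h
    · simpa using h
    · have := lt_of_le_of_ne (not_lt.1 h) hw; push_cast; linarith
  have hee : (e : ℝ) * e = 1 := by rw [he]; split_ifs <;> norm_num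
  have hbase : HasWindingNumber (fun t => c * (Real.cos t + (e * Complex.I) * Real.sin t)) e := by
    refine ⟨fun t => Complex.log c + e * t * Complex.I, by fun_prop, fun t => ?_, by push_cast; ring⟩
    rw [Complex.exp_add, Complex.exp_log hc, Complex.exp_mul_I]
    rw [he]; split_ifs <;> simp [Complex.ofReal_cos, Complex.ofReal_sin] <;> ring_nf <;> simp
  have := HasWindingNumber.homotopy (k := e)
    (H := fun s t => c * (Real.cos t + ((1 - s) * (e * Complex.I) + s * w) * Real.sin t))
    (by fun_prop) (fun s hs t h0 => ?_) (fun s hs => by simp) (by simpa using hbase)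
  · simpa using this
  · have h1 := (mul_eq_zero.1 h0).resolve_left hc
    have him : ((1 - s) * e + s * w.im) * Real.sin t = 0 := by
      have := congrArg Complex.im h1
      simp [-Complex.ofReal_cos, -Complex.ofReal_sin, -mul_eq_zero] at this
      simpa [-mul_eq_zero] using this
    have hpos : (e : ℝ) * ((1 - s) * e + s * w.im) > 0 := by
      have : (e : ℝ) * ((1 - s) * e + s * w.im) = (1 - s) + s * (e * w.im) := by
        linear_combination (1 - s) * hee
      rw [this]
      rcases eq_or_lt_of_le hs.1 with h | h
      · rw [← h]; norm_num
      · have := hs.2; have := mul_pos h he1; linarith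
    have hsin : Real.sin t = 0 := by
      rcases mul_eq_zero.1 him with h | h
      · rw [h, mul_zero] at hpos; exact absurd hpos (lt_irrefl _)
      · exact h
    have hcos : Real.cos t = 0 := by
      have := congrArg Complex.re h1
      simpa [hsin, ← Complex.ofReal_cos] using this
    have := Real.sin_sq_add_cos_sq t
    rw [hsin, hcos] at this; norm_num at this

/-- The local index at a nondegenerate zero is the sign of the determinant of the derivative. -/
theorem hasLocalIndex_of_hasFDerivAt {f : ℂ → ℂ} {a w : ℂ} {L : ℂ →L[ℝ] ℂ}
    (hf : HasFDerivAt f L a) (hc : ∀ᶠ z in 𝓝 a, ContinuousAt f z) (h0 : f a = 0) (h1 : L 1 ≠ 0)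
    (hL : L Complex.I = w * L 1)
    (hw : w.im ≠ 0) : HasLocalIndex f a (if 0 < w.im then 1 else -1) := by
  have hLv : ∀ v : ℂ, L v = L 1 * (v.re + w * v.im) := fun v => by
    conv_lhs => rw [← Complex.re_add_im v]
    have e1 : (v.re : ℂ) + v.im * Complex.I = v.re • (1 : ℂ) + v.im • Complex.I := by simp
    rw [e1, map_add, map_smul, map_smul, hL]; simp; ring
  have hinj : LinearMap.ker (L : ℂ →ₗ[ℝ] ℂ) = ⊥ := by
    rw [LinearMap.ker_eq_bot']
    intro v hv
    have h2 : (v.re : ℂ) + w * v.im = 0 := by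
      have : L v = 0 := hv
      rw [hLv] at this; exact (mul_eq_zero.1 this).resolve_left h1
    have him : w.im * v.im = 0 := by simpa using congrArg Complex.im h2
    have hv2 : v.im = 0 := (mul_eq_zero.1 him).resolve_left hw
    have hre : v.re = 0 := by simpa [hv2] using congrArg Complex.re h2
    exact Complex.ext hre hv2
  obtain ⟨K, hK, hanti⟩ := (L : ℂ →ₗ[ℝ] ℂ).exists_antilipschitzWith hinj
  have hlow : ∀ v, ‖v‖ ≤ K * ‖L v‖ := fun v => by simpa using hanti.le_mul_dist v 0
  have hK' : (0 : ℝ) < K := hK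
  -- `L` is at least `r / K` in norm on the circle of radius `r`, and this constant makes the
  -- remainder at most half of that, so the loops of `f` and `L` are close in the sense of
  -- `of_close`.
  have hlit := hf.isLittleO.def (c := 1 / (2 * K)) (by positivity)
  filter_upwards [eventually_forall_ball (hlit.and hc), self_mem_nhdsWithin] with r h2 (hr : 0 < r)
  have hell : HasWindingNumber (fun t => L (circleMap a r t - a)) (if 0 < w.im then 1 else -1) := by
    have := hasWindingNumber_ellipse (c := r * L 1) (mul_ne_zero (by exact_mod_cast hr.ne') h1) hw
    refine (congrArg (fun γ => HasWindingNumber γ _) (funext fun t => ?_)).mp this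
    have e2 : circleMap a r t - a = (r * Real.cos t : ℝ) + (r * Real.sin t : ℝ) * Complex.I := by
      simp only [circleMap, Complex.exp_mul_I]; push_cast; ring
    have e3 : (circleMap a r t - a).re = r * Real.cos t := by rw [e2]; simp [-Complex.ofReal_cos, -Complex.ofReal_sin]
    have e4 : (circleMap a r t - a).im = r * Real.sin t := by rw [e2]; simp [-Complex.ofReal_cos, -Complex.ofReal_sin]
    rw [hLv (circleMap a r t - a), e3, e4]; push_cast; ring
  refine hell.of_close (by fun_prop) ?_ (by rw [circleMap_two_pi]) (by rw [circleMap_two_pi])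
    fun t => ?_
  · exact continuous_iff_continuousAt.2 fun t =>
      (h2 _ (circleMap_mem_closedBall a hr.le t)).2.comp (continuous_circleMap a r).continuousAt
  · have h3 := (h2 _ (circleMap_mem_closedBall a hr.le t)).1
    rw [h0, sub_zero, norm_circleMap_sub hr.le] at h3
    have h4 := hlow (circleMap a r t - a)
    rw [norm_circleMap_sub hr.le] at h4
    have h5 : 1 / (2 * (K : ℝ)) * r < 1 / K * r := by
      apply mul_lt_mul_of_pos_right _ hr
      apply one_div_lt_one_div_of_lt hK'; linarith
    have h6 : 1 / (K : ℝ) * r ≤ ‖L (circleMap a r t - a)‖ := by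
      rw [div_mul_eq_mul_div, one_mul, div_le_iff₀ hK']; linarith
    linarith

/-! ### Generic perturbations -/

theorem exists_pos_le_norm {X : Type*} [TopologicalSpace X] {F : Type*} [NormedAddCommGroup F]
    {K : Set X} (hK : IsCompact K) {f : X → F}
    (hf : ContinuousOn f K) (h0 : ∀ z ∈ K, f z ≠ 0) : ∃ m > 0, ∀ z ∈ K, m ≤ ‖f z‖ := by
  rcases K.eq_empty_or_nonempty with rfl | hne
  · exact ⟨1, one_pos, by simp⟩
  · obtain ⟨x, hx, hmin⟩ := hK.exists_isMinOn hne hf.norm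
    exact ⟨‖f x‖, norm_pos_iff.2 (h0 x hx), fun z hz => hmin hz⟩

theorem _root_.IsCompact.finite_of_isolated {X : Type*} [TopologicalSpace X] [T1Space X]
    {K : Set X} (hK : IsCompact K)
    (h : ∀ z ∈ K, ∀ᶠ w in 𝓝[≠] z, w ∉ K) : K.Finite := by
  by_contra hinf
  obtain ⟨x, hx, hacc⟩ := Set.Infinite.exists_accPt_of_subset_isCompact hinf hK subset_rfl
  have := accPt_iff_frequently_nhdsNE.1 hacc
  exact this (h x hx)

/-- Sard in equal dimensions: the critical values have measure zero and cannot fill a ball. -/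
theorem exists_not_mem_criticalValues {h : ℂ → ℂ} (hh : ContDiff ℝ ∞ h) {δ : ℝ} (hδ : 0 < δ) :
    ∃ c : ℂ, ‖c‖ < δ ∧ ∀ z, h z = c → (fderiv ℝ h z).det ≠ 0 := by
  by_contra hcon
  push Not at hcon
  have hd : Differentiable ℝ h := hh.differentiable (by simp)
  have h0 := MeasureTheory.addHaar_image_eq_zero_of_det_fderivWithin_eq_zero
    (MeasureTheory.volume : MeasureTheory.Measure ℂ) (f := h) (f' := fderiv ℝ h)
    (s := {z | (fderiv ℝ h z).det = 0})
    (fun z _ => (hd z).hasFDerivAt.hasFDerivWithinAt) (fun z hz => hz)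
  have hsub : Metric.ball (0 : ℂ) δ ⊆ h '' {z | (fderiv ℝ h z).det = 0} := fun c hc => by
    obtain ⟨z, hz, hz'⟩ := hcon c (by simpa using hc)
    exact ⟨z, hz', hz⟩
  exact (Metric.measure_ball_pos MeasureTheory.volume (0 : ℂ) hδ).ne'
    (MeasureTheory.measure_mono_null hsub h0)

theorem eventually_ne_of_det_ne_zero {g : ℂ → ℂ} {z : ℂ} {L : ℂ →L[ℝ] ℂ}
    (hg : HasFDerivAt g L z) (hL : L.det ≠ 0) : ∀ᶠ w in 𝓝[≠] z, g w ≠ g z := by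
  refine hg.eventually_ne ⟨_, (L.toContinuousLinearEquivOfDetNeZero hL).antilipschitz⟩

/-- A continuous function on the plane can be perturbed near its zeros so that
there are finitely many of them, all nondegenerate. -/
theorem exists_generic_perturbation {f : ℂ → ℂ} (hf : Continuous f) {U : Set ℂ} (hU : IsOpen U)
    (hb : Bornology.IsBounded U) (h0 : ∀ z ∉ U, f z ≠ 0) {ε : ℝ} (hε : 0 < ε) :
    ∃ g : ℂ → ℂ, Continuous g ∧ (∃ K ⊆ U, IsCompact K ∧ ∀ z ∉ K, g z = f z) ∧
      (∀ z, ‖g z - f z‖ < ε) ∧ ∃ S : Finset ℂ, (∀ z, g z = 0 ↔ z ∈ S) ∧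
        ∀ z ∈ S, z ∈ U ∧ (∀ᶠ w in 𝓝 z, ContDiffAt ℝ ∞ g w) ∧ (fderiv ℝ g z).det ≠ 0 := by
  have hK : IsCompact (f ⁻¹' {0}) := by
    refine Metric.isCompact_of_isClosed_isBounded (isClosed_singleton.preimage hf)
      (hb.subset fun z hz => ?_)
    by_contra h; exact h0 z h hz
  have hKU : f ⁻¹' {0} ⊆ U := fun z hz => by by_contra h; exact h0 z h hz
  -- Nested neighbourhoods of the zeros: the new function will be smooth on `V` and equal to `f` off
  -- `W`, with `f` bounded below by `m` in between.
  obtain ⟨V, hV, hKV, hVU, hVc⟩ := exists_open_between_and_isCompact_closure hK hU hKU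
  obtain ⟨W, hW, hVW, hWU, hWc⟩ := exists_open_between_and_isCompact_closure hVc hU hVU
  obtain ⟨χ, hχ0, hχ1, hχm⟩ := exists_continuous_zero_one_of_isClosed hW.isClosed_compl
    isClosed_closure (s := Wᶜ) (t := closure V)
    (disjoint_left.2 fun z hz hz' => hz (hVW hz'))
  obtain ⟨m, hm, hmf⟩ := exists_pos_le_norm (K := closure W \ V) (hWc.diff hV) hf.continuousOn
    (fun z hz h => hz.2 (hKV h))
  -- The function moves by at most `2δ`: `δ` for the smoothing and `δ` for the regular value `c`.
  -- This is less than `ε` and less than `m`, so no zeros arise in `W \ V`.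
  set δ := min ε m / 4 with hδ
  have hδ0 : 0 < δ := by positivity
  have hδε : 4 * δ ≤ ε := by rw [hδ]; linarith [min_le_left ε m]
  have hδm : 4 * δ ≤ m := by rw [hδ]; linarith [min_le_right ε m]
  obtain ⟨h, hh, hhf, -⟩ := hf.exists_contDiff_approx ⊤ (ε := fun _ => δ) continuous_const
    (fun _ => hδ0)
  obtain ⟨c, hc, hcrit⟩ := exists_not_mem_criticalValues hh hδ0
  set g : ℂ → ℂ := fun z => f z + χ z * (h z - c - f z) with hg
  have hgc : Continuous g := by
    have := hh.continuous; have := χ.continuous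
    fun_prop
  have hgf : ∀ z, ‖g z - f z‖ ≤ 2 * δ := fun z => by
    have e : g z - f z = χ z * ((h z - f z) - c) := by simp only [hg]; ring
    have h1 := hhf z
    rw [dist_eq_norm] at h1
    rw [e, norm_mul, Complex.norm_real, Real.norm_of_nonneg (hχm z).1]
    calc χ z * ‖h z - f z - c‖ ≤ 1 * (δ + δ) := by
          apply mul_le_mul (hχm z).2 ((norm_sub_le _ _).trans (by linarith)) (norm_nonneg _) zero_le_one
      _ = 2 * δ := by ring
  have hgW : ∀ z ∉ W, g z = f z := fun z hz => by simp [hg, hχ0 (show z ∈ Wᶜ from hz)]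
  have hgV : ∀ z ∈ V, ∀ᶠ w in 𝓝 z, g w = h w - c := fun z hz => by
    filter_upwards [hV.mem_nhds hz] with w hw
    simp [hg, hχ1 (subset_closure hw)]
  have hzero : ∀ z, g z = 0 → z ∈ V := fun z hz => by
    by_contra hzV
    by_cases hzW : z ∈ W
    · have h1 := hmf z ⟨subset_closure hzW, hzV⟩
      have h2 := hgf z
      rw [hz, zero_sub, norm_neg] at h2
      linarith
    · rw [hgW z hzW] at hz; exact hzV (hKV hz)
  have hsm : ∀ z ∈ V, ContDiffAt ℝ ∞ g z := fun z hz =>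
    ((hh.contDiffAt (x := z)).sub contDiffAt_const).congr_of_eventuallyEq (hgV z hz)
  have hdet : ∀ z, g z = 0 → (fderiv ℝ g z).det ≠ 0 := fun z hz => by
    have hV' : g =ᶠ[𝓝 z] fun w => h w - c := hgV z (hzero z hz)
    rw [hV'.fderiv_eq, fderiv_sub_const]
    refine hcrit z ?_
    have := hV'.self_of_nhds
    rw [hz] at this; exact (sub_eq_zero.1 this.symm)
  have hcomp : IsCompact (g ⁻¹' {0}) :=
    hVc.of_isClosed_subset (isClosed_singleton.preimage hgc) fun z hz => subset_closure (hzero z hz)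
  have hfin : (g ⁻¹' {0}).Finite := hcomp.finite_of_isolated fun z hz => by
    have hz' : g z = 0 := hz
    have h1 := eventually_ne_of_det_ne_zero
      (((hsm z (hzero z hz)).differentiableAt (by simp)).hasFDerivAt) (hdet z hz)
    filter_upwards [h1] with w hw hw'
    exact hw (by rw [hz']; exact hw')
  refine ⟨g, hgc, ⟨closure W, hWU, hWc, fun z hz => hgW z fun h => hz (subset_closure h)⟩,
    fun z => (hgf z).trans_lt (by linarith), hfin.toFinset, fun z => by simp, fun z hz => ?_⟩
  have hz' : g z = 0 := by simpa using hz
  have hzV := hzero z hz'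
  exact ⟨hVU (subset_closure hzV), by
    filter_upwards [hV.mem_nhds hzV] with w hw using hsm w hw, hdet z hz'⟩

/-! ### Oriented embeddings of disks in the plane -/

/-- Small circles about `w` go to loops of winding number `k` in a punctured neighbourhood of `Θ w`,
to which `CircleIndex.comp` applies. -/
theorem HasLocalIndex.comp {g Θ : ℂ → ℂ} {w : ℂ} {m k : ℤ} (hg : HasLocalIndex g (Θ w) m)
    (hgc : ∀ᶠ z in 𝓝 (Θ w), ContinuousAt g z) (hg0 : ∀ᶠ z in 𝓝[≠] (Θ w), g z ≠ 0)
    (hΘ : HasLocalIndex (fun z => Θ z - Θ w) w k) (hΘc : ContinuousAt Θ w)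
    (hinj : ∀ᶠ z in 𝓝[≠] w, Θ z ≠ Θ w) : HasLocalIndex (fun z => g (Θ z)) w (k * m) := by
  obtain ⟨ε, ⟨hε, hgε⟩, hε0 : 0 < ε⟩ := (((eventually_forall_ball
    (hgc.and (eventually_nhdsWithin_iff.1 hg0))).and hg).and self_mem_nhdsWithin).exists
  have hA : ∀ z ∈ annulus (Θ w) 0 ε, ContinuousAt g z ∧ g z ≠ 0 := fun z hz => by
    have := hε z (by simpa [dist_eq_norm] using hz.2.le)
    exact ⟨this.1, this.2 fun h => by simp at h; simpa [h] using hz.1⟩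
  obtain ⟨r, ⟨hgr, hr⟩⟩ := (hg.and (Ioo_mem_nhdsGT hε0)).exists
  have h1 : ∀ᶠ z in 𝓝 w, Θ z ∈ Metric.ball (Θ w) ε ∧ (z ∈ ({w}ᶜ : Set ℂ) → Θ z ≠ Θ w) :=
    Filter.Eventually.and (hΘc (Metric.ball_mem_nhds _ hε0)) (eventually_nhdsWithin_iff.1 hinj)
  filter_upwards [hΘ, eventually_forall_ball h1, self_mem_nhdsWithin] with s hs hs1 (hs0 : 0 < s)
  refine CircleIndex.comp le_rfl hr (fun z hz => (hA z hz).1.continuousWithinAt)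
    (fun z hz => (hA z hz).2) hgr (γ := fun t => Θ (circleMap w s t)) (fun t => ?_) hs
  have h2 := hs1 _ (circleMap_mem_closedBall w hs0.le t)
  refine ⟨norm_pos_iff.2 (sub_ne_zero.2 (h2.2 fun h => ?_)), by simpa [dist_eq_norm] using h2.1⟩
  have := norm_circleMap_sub hs0.le w t
  rw [mem_singleton_iff.1 h] at this; simp at this; exact hs0.ne this

/-- A continuous injective map of an open set in the plane whose local degrees are
equal to one. -/
structure OrientedEmbedding (Θ : ℂ → ℂ) (Ω : Set ℂ) : Prop where
  isOpen : IsOpen Ω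
  continuousOn : ContinuousOn Θ Ω
  injOn : InjOn Θ Ω
  localIndex : ∀ z ∈ Ω, HasLocalIndex (fun w => Θ w - Θ z) z 1

theorem OrientedEmbedding.eventually_ne {Θ : ℂ → ℂ} {Ω : Set ℂ} (h : OrientedEmbedding Θ Ω) {z : ℂ}
    (hz : z ∈ Ω) : ∀ᶠ w in 𝓝[≠] z, Θ w ≠ Θ z := by
  filter_upwards [nhdsWithin_le_nhds (h.isOpen.mem_nhds hz), self_mem_nhdsWithin] with w hw hne h'
  exact hne (h.injOn hw hz h')

/-- Invariance of domain by degree: the index of `Θ - y` on a small circle is one for `y` near `Θ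
z`, but it would be zero if `y` were omitted. -/
theorem OrientedEmbedding.isOpen_image {Θ : ℂ → ℂ} {Ω : Set ℂ} (h : OrientedEmbedding Θ Ω)
    {V : Set ℂ} (hV : IsOpen V) (hVΩ : V ⊆ Ω) : IsOpen (Θ '' V) := by
  refine isOpen_iff_mem_nhds.2 ?_
  rintro _ ⟨z, hz, rfl⟩
  obtain ⟨r, ⟨hr1, hr2⟩, hr : 0 < r⟩ := (((eventually_forall_ball (hV.mem_nhds hz)).and
    (h.localIndex z (hVΩ hz))).and self_mem_nhdsWithin).exists
  have hcont : ContinuousOn Θ (Metric.closedBall z r) :=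
    h.continuousOn.mono fun w hw => hVΩ (hr1 w hw)
  obtain ⟨m, hm, hmin⟩ := exists_pos_le_norm (K := Metric.sphere z r) (isCompact_sphere z r)
    (f := fun w => Θ w - Θ z)
    ((hcont.mono Metric.sphere_subset_closedBall).sub continuousOn_const)
    (fun w hw h' => Metric.ne_of_mem_sphere hw hr.ne'
      (h.injOn (hVΩ (hr1 w (Metric.sphere_subset_closedBall hw))) (hVΩ hz) (sub_eq_zero.1 h')))
  have hcirc : Continuous fun t => Θ (circleMap z r t) :=
    hcont.comp_continuous (continuous_circleMap z r) fun t => circleMap_mem_closedBall z hr.le t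
  filter_upwards [Metric.ball_mem_nhds (Θ z) hm] with y hy
  by_contra hny
  have h1 : CircleIndex (fun w => Θ w - y) z r 0 :=
    circleIndex_zero hr.le (hcont.sub continuousOn_const) fun w hw h' =>
      hny ⟨w, hr1 w hw, sub_eq_zero.1 h'⟩
  have h2 : CircleIndex (fun w => Θ w - y) z r 1 := by
    refine HasWindingNumber.of_close hr2 (hcirc.sub continuous_const)
      (hcirc.sub continuous_const) (by rw [circleMap_two_pi])
      (by rw [circleMap_two_pi]) fun t => ?_
    refine lt_of_lt_of_le ?_ (hmin _ (circleMap_mem_sphere z hr.le t))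
    rw [sub_sub_sub_cancel_left, ← dist_eq_norm, dist_comm]; exact hy
  exact absurd (h1.unique h2) (by norm_num)

/-- Additivity of the index over disjoint embedded disks that contain all the zeros. -/
theorem circleIndex_additive {f : ℂ → ℂ} {R : ℝ} (hR : 0 ≤ R) (hf : Continuous f) {ι : Type*}
    (I : Finset ι) (Θ : ι → ℂ → ℂ) (ρ : ι → ℝ) (k : ι → ℤ)
    (hρ : ∀ i ∈ I, 0 ≤ ρ i)
    (hΘ : ∀ i ∈ I, OrientedEmbedding (Θ i) (Metric.ball 0 1))
    (hρ1 : ∀ i ∈ I, ρ i < 1)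
    (hdis : ∀ i ∈ I, ∀ j ∈ I, i ≠ j → Disjoint (Θ i '' Metric.ball 0 1) (Θ j '' Metric.ball 0 1))
    (hball : ∀ i ∈ I, Θ i '' Metric.ball 0 (ρ i) ⊆ Metric.ball 0 R)
    (hzero : ∀ z, f z = 0 → ∃ i ∈ I, z ∈ Θ i '' Metric.ball 0 (ρ i))
    (hk : ∀ i ∈ I, CircleIndex (fun z => f (Θ i z)) 0 (ρ i) (k i)) :
    CircleIndex f 0 R (∑ i ∈ I, k i) := by
  classical
  have hsub : ∀ i ∈ I, Metric.closedBall (0 : ℂ) (ρ i) ⊆ Metric.ball 0 1 := fun i hi =>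
    Metric.closedBall_subset_ball (hρ1 i hi)
  have hsub' : ∀ i ∈ I, Metric.ball (0 : ℂ) (ρ i) ⊆ Metric.ball 0 1 := fun i hi =>
    Metric.ball_subset_closedBall.trans (hsub i hi)
  set U : Set ℂ := ⋃ i ∈ I, Θ i '' Metric.ball 0 (ρ i) with hUdef
  have hU : IsOpen U := isOpen_biUnion fun i hi =>
    (hΘ i hi).isOpen_image Metric.isOpen_ball (hsub' i hi)
  have hUR : U ⊆ Metric.ball 0 R := iUnion₂_subset hball
  -- The perturbation is confined to the images of the small disks, so it changes no value on the
  -- circles concerned. Afterwards both sides are finite sums of local indices.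
  obtain ⟨g, hgc, ⟨K, hKU, -, hgK⟩, -, S, hS, hS'⟩ := exists_generic_perturbation hf hU
    (Metric.isBounded_ball.subset hUR) (fun z hz h => hz (by
      obtain ⟨i, hi, h⟩ := hzero z h; exact mem_biUnion hi h)) one_pos
  have hgU : ∀ z ∉ U, g z = f z := fun z hz => hgK z fun h => hz (hKU h)
  have hgiso : ∀ z ∈ S, ∀ᶠ w in 𝓝[≠] z, g w ≠ 0 := fun z hz => by
    filter_upwards [nhdsWithin_le_nhds ((S.erase z).finite_toSet.isClosed.isOpen_compl.mem_nhds
      (by simp : z ∈ (↑(S.erase z) : Set ℂ)ᶜ)), self_mem_nhdsWithin] with w hw hwz h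
    exact hw (Finset.mem_coe.2 (Finset.mem_erase.2 ⟨hwz, (hS w).1 h⟩))
  have hgc' : ∀ z, ∀ᶠ w in 𝓝 z, ContinuousAt g w := fun z => .of_forall fun w => hgc.continuousAt
  have hex : ∀ z, ∃ m, z ∈ S → HasLocalIndex g z m := fun z => by
    by_cases hz : z ∈ S
    · obtain ⟨m, hm⟩ := exists_hasLocalIndex (hgc' z) (hgiso z hz); exact ⟨m, fun _ => hm⟩
    · exact ⟨0, fun h => absurd h hz⟩
  choose κ hκ using hex
  have hg : CircleIndex g 0 R (∑ z ∈ S, κ z) :=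
    circleIndex_sum hR S κ g hgc.continuousOn (fun z hz => hUR (hS' z hz).1)
      (fun z _ hz h => hz ((hS z).1 h)) hκ
  have hsphere : ∀ z ∈ Metric.sphere (0 : ℂ) R, g z = f z := fun z hz => hgU z fun h => by
    have := hUR h; rw [Metric.mem_ball] at this; rw [Metric.mem_sphere] at hz; linarith
  have hki : ∀ i ∈ I, k i = ∑ z ∈ S with z ∈ Θ i '' Metric.ball 0 (ρ i), κ z := fun i hi => by
    have h1 : CircleIndex (fun z => g (Θ i z)) 0 (ρ i) (k i) := by
      refine (hk i hi).congr (hρ i hi) fun w hw => (hgU _ fun h => ?_).symm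
      have hw1 : w ∈ Metric.ball (0 : ℂ) 1 := hsub i hi (Metric.sphere_subset_closedBall hw)
      obtain ⟨j, hj, v, hv, hvw⟩ := mem_iUnion₂.1 h
      by_cases hij : i = j
      · subst hij
        rw [(hΘ i hi).injOn (hsub' i hi hv) hw1 hvw] at hv
        rw [Metric.mem_ball] at hv; rw [Metric.mem_sphere] at hw; linarith
      · exact disjoint_left.1 (hdis i hi j hj hij) ⟨w, hw1, rfl⟩ ⟨v, hsub' j hj hv, hvw⟩
    -- The zeros of `g ∘ Θ i`. Their local indices are those of `g` because `Θ i` has local degree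
    -- one.
    set T : Finset ℂ := (S.filter (· ∈ Θ i '' Metric.ball 0 (ρ i))).image
      (Function.invFunOn (Θ i) (Metric.ball 0 (ρ i))) with hT
    have hinv : ∀ z ∈ S.filter (· ∈ Θ i '' Metric.ball 0 (ρ i)),
        Function.invFunOn (Θ i) (Metric.ball 0 (ρ i)) z ∈ Metric.ball 0 (ρ i) ∧
        Θ i (Function.invFunOn (Θ i) (Metric.ball 0 (ρ i)) z) = z := fun z hz =>
      ⟨Function.invFunOn_mem (Finset.mem_filter.1 hz).2, Function.invFunOn_eq (Finset.mem_filter.1 hz).2⟩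
    have hTmem : ∀ w ∈ T, w ∈ Metric.ball 0 (ρ i) ∧ Θ i w ∈ S := fun w hw => by
      obtain ⟨z, hz, rfl⟩ := Finset.mem_image.1 hw
      refine ⟨(hinv z hz).1, ?_⟩
      rw [(hinv z hz).2]; exact (Finset.mem_filter.1 hz).1
    have h2 : CircleIndex (fun z => g (Θ i z)) 0 (ρ i) (∑ w ∈ T, κ (Θ i w)) := by
      refine circleIndex_sum (hρ i hi) T _ _ ?_ (fun w hw => (hTmem w hw).1) ?_ ?_
      · exact hgc.comp_continuousOn ((hΘ i hi).continuousOn.mono (hsub i hi))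
      · intro w hw hwT hgw
        have hwS : Θ i w ∈ S := (hS _).1 hgw
        have hwU := (hS' _ hwS).1
        obtain ⟨j, hj, v, hv, hvw⟩ := mem_iUnion₂.1 hwU
        have hw1 := hsub i hi hw
        by_cases hij : i = j
        · subst hij
          have := (hΘ i hi).injOn (hsub' i hi hv) hw1 hvw
          subst this
          apply hwT
          have hm : Θ i v ∈ S.filter (· ∈ Θ i '' Metric.ball 0 (ρ i)) :=
            Finset.mem_filter.2 ⟨hwS, v, hv, rfl⟩
          refine Finset.mem_image.2 ⟨Θ i v, hm, ?_⟩
          exact (hΘ i hi).injOn (hsub' i hi (hinv _ hm).1) hw1 (hinv _ hm).2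
        · exact disjoint_left.1 (hdis i hi j hj hij) ⟨w, hw1, rfl⟩ ⟨v, hsub' j hj hv, hvw⟩
      · intro w hw
        have hw1 := hsub' i hi (hTmem w hw).1
        have := (hκ _ (hTmem w hw).2).comp (hgc' _) (hgiso _ (hTmem w hw).2)
          ((hΘ i hi).localIndex w hw1)
          ((hΘ i hi).continuousOn.continuousAt (Metric.isOpen_ball.mem_nhds hw1))
          ((hΘ i hi).eventually_ne hw1)
        rwa [one_mul] at this
    rw [h1.unique h2, hT, Finset.sum_image]
    · exact Finset.sum_congr rfl fun z hz => by rw [(hinv z hz).2]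
    · intro z hz z' hz' h
      rw [← (hinv z hz).2, ← (hinv z' hz').2, h]
  have hsum : ∑ i ∈ I, k i = ∑ z ∈ S, κ z := by
    rw [Finset.sum_congr rfl hki, ← Finset.sum_biUnion]
    · refine Finset.sum_congr (Finset.ext fun z => ?_) fun _ _ => rfl
      rw [Finset.mem_biUnion]
      constructor
      · rintro ⟨i, -, h⟩; exact (Finset.mem_filter.1 h).1
      · intro hz
        obtain ⟨i, hi, h⟩ := mem_iUnion₂.1 (hS' z hz).1
        exact ⟨i, hi, Finset.mem_filter.2 ⟨hz, h⟩⟩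
    · intro i hi j hj hij
      refine Finset.disjoint_left.2 fun z hz hz' => ?_
      exact disjoint_left.1 (hdis i hi j hj hij)
        (image_mono (hsub' i hi) (Finset.mem_filter.1 hz).2)
        (image_mono (hsub' j hj) (Finset.mem_filter.1 hz').2)
  rw [hsum]
  exact hg.congr hR hsphere

/-! ### Maps of the disk as functions on the plane -/

theorem mem_unitDisk {z : ℂ} : z ∈ unitDisk ↔ ‖z‖ < 1 := by
  change z ∈ Metric.ball (0 : ℂ) 1 ↔ _
  simp

open Classical in
/-- The retraction of the plane onto the open disk that maps its complement to the origin. -/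
noncomputable def toDisk (z : ℂ) : Disk :=
  if h : z ∈ unitDisk then ⟨z, h⟩ else ⟨0, mem_unitDisk.2 (by simp)⟩

theorem toDisk_of_mem {z : ℂ} (h : z ∈ unitDisk) : toDisk z = ⟨z, h⟩ := dif_pos h

theorem coe_toDisk {z : ℂ} (h : ‖z‖ < 1) : (toDisk z : ℂ) = z := by
  rw [toDisk_of_mem (mem_unitDisk.2 h)]

@[simp] theorem toDisk_coe (z : Disk) : toDisk (z : ℂ) = z := toDisk_of_mem z.2

theorem norm_coe_lt (z : Disk) : ‖(z : ℂ)‖ < 1 := mem_unitDisk.1 z.2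

theorem continuousOn_toDisk : ContinuousOn toDisk (Metric.ball 0 1) := by
  rw [Topology.IsInducing.subtypeVal.continuousOn_iff]
  refine continuousOn_id.congr fun z hz => coe_toDisk (by simpa using hz)

theorem diskExtend_of_norm_lt (θ : C(Disk, Disk)) {z : ℂ} (h : ‖z‖ < 1) :
    diskExtend θ z = (θ (toDisk z) : ℂ) := by
  rw [diskExtend, dif_pos (mem_unitDisk.2 h), toDisk_of_mem]

theorem continuousOn_diskExtend (θ : C(Disk, Disk)) :
    ContinuousOn (diskExtend θ) (Metric.ball 0 1) :=
  ((continuous_subtype_val.comp θ.continuous).comp_continuousOn continuousOn_toDisk).congr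
    fun _ hz => diskExtend_of_norm_lt θ (by simpa using hz)

theorem orientedEmbedding_diskExtend {θ : C(Disk, Disk)} (hinj : Function.Injective θ)
    (ho : PreservesOrientation θ) : OrientedEmbedding (diskExtend θ) (Metric.ball 0 1) where
  isOpen := Metric.isOpen_ball
  continuousOn := continuousOn_diskExtend θ
  injOn := fun z hz w hw h => by
    rw [Metric.mem_ball, dist_zero_right] at hz hw
    rw [diskExtend_of_norm_lt θ hz, diskExtend_of_norm_lt θ hw] at h
    rw [← coe_toDisk hz, ← coe_toDisk hw, hinj (Subtype.ext h)]
  localIndex := fun z hz => by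
    have hz' : ‖z‖ < 1 := by simpa using hz
    have hs := eventually_forall_ball (Metric.isOpen_ball.mem_nhds hz)
    filter_upwards [hs, self_mem_nhdsWithin] with r h1 h2
    have := ho (toDisk z) r h2 (by rw [coe_toDisk hz']; exact h1)
    rwa [coe_toDisk hz', ← diskExtend_of_norm_lt θ hz'] at this

theorem isOpen_range_of_preservesOrientation {θ : C(Disk, Disk)} (hinj : Function.Injective θ)
    (ho : PreservesOrientation θ) : IsOpen (range θ) := by
  have h := (orientedEmbedding_diskExtend hinj ho).isOpen_image Metric.isOpen_ball subset_rfl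
  have : range θ = Subtype.val ⁻¹' (diskExtend θ '' Metric.ball 0 1) := by
    ext w
    constructor
    · rintro ⟨z, rfl⟩
      exact ⟨z, by simpa using norm_coe_lt z, by rw [diskExtend_of_norm_lt θ (norm_coe_lt z), toDisk_coe]⟩
    · rintro ⟨z, hz, h⟩
      rw [diskExtend_of_norm_lt θ (by simpa using hz)] at h
      exact ⟨_, Subtype.ext h⟩
  rw [this]
  exact h.preimage continuous_subtype_val

/-! ### Fields of complex lines -/

section LineFields

variable {V : Type*} [NormedAddCommGroup V] [NormedSpace ℂ V]

/-- `p` is a projection onto a complex line. -/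
def IsLineProj (p : V →L[ℂ] V) : Prop := ∃ v ≠ 0, p v = v ∧ ∀ w, ∃ c : ℂ, p w = c • v

/-- The functional `ψ` is injective on the image of the projection `p`. -/
def IsFrame (p : V →L[ℂ] V) (ψ : V →L[ℂ] ℂ) : Prop := ∀ w, p w = w → ψ w = 0 → w = 0

theorem IsLineProj.idem {p : V →L[ℂ] V} (hp : IsLineProj p) (w : V) : p (p w) = p w := by
  obtain ⟨v, -, hv, h⟩ := hp
  obtain ⟨c, hc⟩ := h w
  rw [hc, map_smul, hv]

theorem IsLineProj.exists_frame {p : V →L[ℂ] V} (hp : IsLineProj p) : ∃ ψ, IsFrame p ψ := by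
  obtain ⟨v, hv0, hv, h⟩ := hp
  obtain ⟨ψ, hψ⟩ := SeparatingDual.exists_ne_zero (R := ℂ) hv0
  refine ⟨ψ, fun w hw hw0 => ?_⟩
  obtain ⟨c, hc⟩ := h w
  rw [hw] at hc
  rw [hc, map_smul, smul_eq_mul] at hw0
  rw [hc, (mul_eq_zero.1 hw0).resolve_right hψ, zero_smul]

theorem IsLineProj.isFrame_of_ne_zero {p : V →L[ℂ] V} (hp : IsLineProj p) {ψ : V →L[ℂ] ℂ} {u : V}
    (hu : ψ (p u) ≠ 0) : IsFrame p ψ := by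
  obtain ⟨v, hv0, hv, h⟩ := hp
  obtain ⟨b, hb⟩ := h u
  intro w hw hw0
  obtain ⟨c, hc⟩ := h w
  rw [hw] at hc
  rw [hb, map_smul, smul_eq_mul] at hu
  rw [hc, map_smul, smul_eq_mul] at hw0
  rw [hc, (mul_eq_zero.1 hw0).resolve_right (right_ne_zero_of_mul hu), zero_smul]

/-- A field of complex lines over a compact star-shaped set is trivial. -/
theorem exists_frame {E : Type*} [NormedAddCommGroup E] [NormedSpace ℝ E] {B : Set E}
    (hB : IsCompact B) (hstar : StarConvex ℝ 0 B) {p : E → V →L[ℂ] V} (hp : ContinuousOn p B)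
    (hline : ∀ q ∈ B, IsLineProj (p q)) :
    ∃ ψ : E → V →L[ℂ] ℂ, ContinuousOn ψ B ∧ ∀ q ∈ B, IsFrame (p q) (ψ q) := by
  rcases B.eq_empty_or_nonempty with rfl | hne
  · exact ⟨0, continuousOn_const, by simp⟩
  have h0B : (0 : E) ∈ B := hstar.mem hne
  obtain ⟨lam, hlam⟩ := (hline 0 h0B).exists_frame
  -- Uniform continuity: `N` is so large that `p` changes by less than `1` in operator norm during
  -- one step of length `‖q‖ / N` along the ray to `q`.
  obtain ⟨δ, hδ, hun⟩ := Metric.uniformContinuousOn_iff.1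
    (hB.uniformContinuousOn_of_continuous hp) 1 one_pos
  obtain ⟨R, hR⟩ := hB.isBounded.exists_norm_le
  obtain ⟨N, hN⟩ := exists_nat_gt (max (R / δ) 0)
  have hN0 : (0 : ℝ) < N := (le_max_right _ _).trans_lt hN
  have hRN : R / N < δ := by
    rw [div_lt_iff₀ hN0, mul_comm, ← div_lt_iff₀ hδ]; exact (le_max_left _ _).trans_lt hN
  have hmem : ∀ q ∈ B, ∀ k ≤ N, ((k : ℝ) / N) • q ∈ B := fun q hq k hk =>
    hstar.smul_mem hq (by positivity) ((div_le_one hN0).2 (by exact_mod_cast hk))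
  -- A functional at the centre is transported outwards along each ray by composing with the
  -- projections met on the way.
  let ψ : ℕ → E → V →L[ℂ] ℂ := fun k =>
    Nat.rec (fun _ => lam) (fun j φ q => (φ q).comp (p (((j : ℝ) / N) • q))) k
  have hψs : ∀ k q, ψ (k + 1) q = (ψ k q).comp (p (((k : ℝ) / N) • q)) := fun k q => rfl
  have hmain : ∀ k ≤ N, ContinuousOn (ψ k) B ∧
      ∀ q ∈ B, IsFrame (p (((k : ℝ) / N) • q)) (ψ k q) := by
    intro k
    induction k with
    | zero => exact fun _ => ⟨continuousOn_const, fun q _ => by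
        have : ψ 0 q = lam := rfl
        simpa [this] using hlam⟩
    | succ k ih =>
      intro hk
      obtain ⟨ih1, ih2⟩ := ih (by omega)
      refine ⟨?_, fun q hq w hw hw0 => ?_⟩
      · exact ih1.clm_comp (hp.comp (by fun_prop) fun q hq => hmem q hq k (by omega))
      · rw [hψs, ContinuousLinearMap.comp_apply] at hw0
        -- If the new functional kills `w` in the new line, then the old projection kills `w`, so
        -- `w` is its own image under the difference of the two projections. That difference has
        -- norm less than `1`.
        have h1 := ih2 q hq _ ((hline _ (hmem q hq k (by omega))).idem w) hw0
        have hd : dist (p ((((k + 1 : ℕ) : ℝ) / N) • q)) (p (((k : ℝ) / N) • q)) < 1 := by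
          refine hun _ (hmem q hq _ hk) _ (hmem q hq k (by omega)) ?_
          rw [dist_eq_norm, ← sub_smul, norm_smul]
          have : (((k + 1 : ℕ) : ℝ) / N - k / N) = 1 / N := by push_cast; ring
          rw [this, Real.norm_of_nonneg (by positivity)]
          calc 1 / (N : ℝ) * ‖q‖ ≤ 1 / N * R := by gcongr; exact hR q hq
            _ = R / N := by ring
            _ < δ := hRN
        rw [dist_eq_norm] at hd
        by_contra hne
        have h2 : w = (p ((((k + 1 : ℕ) : ℝ) / N) • q) - p (((k : ℝ) / N) • q)) w := by
          rw [sub_apply, hw, h1, sub_zero]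
        have h3 := (p ((((k + 1 : ℕ) : ℝ) / N) • q) - p (((k : ℝ) / N) • q)).le_opNorm w
        rw [← h2] at h3
        have := norm_pos_iff.2 hne
        nlinarith
  refine ⟨ψ N, (hmain N le_rfl).1, fun q hq => ?_⟩
  have := (hmain N le_rfl).2 q hq
  rwa [div_self hN0.ne', one_smul] at this

theorem eventually_isFrame {X : Type*} [TopologicalSpace X] {p : X → V →L[ℂ] V} {z : X}
    (hp : ContinuousAt p z) (hline : ∀ᶠ w in 𝓝 z, IsLineProj (p w)) {ψ : V →L[ℂ] ℂ}
    (hψ : IsFrame (p z) ψ) : ∀ᶠ w in 𝓝 z, IsFrame (p w) ψ := by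
  obtain ⟨v, hv0, hv, -⟩ := hline.self_of_nhds
  have h1 : ψ (p z v) ≠ 0 := fun h => hv0 (hψ v hv (by rwa [hv] at h))
  have h2 : ContinuousAt (fun w => ψ (p w v)) z := by fun_prop
  filter_upwards [h2.eventually_ne h1, hline] with w hw hl using hl.isFrame_of_ne_zero hw

/-- Two frames of a field of lines differ by a continuous function without zeros. -/
theorem exists_frame_ratio {X : Type*} [TopologicalSpace X] {A : Set X} {p : X → V →L[ℂ] V}
    (hp : ContinuousOn p A) (hline : ∀ z ∈ A, IsLineProj (p z)) {ψ ψ' : X → V →L[ℂ] ℂ}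
    (hψ : ContinuousOn ψ A) (hψ' : ContinuousOn ψ' A) (hf : ∀ z ∈ A, IsFrame (p z) (ψ z))
    (hf' : ∀ z ∈ A, IsFrame (p z) (ψ' z)) :
    ∃ c : X → ℂ, ContinuousOn c A ∧ (∀ z ∈ A, c z ≠ 0) ∧
      ∀ z ∈ A, ∀ w, p z w = w → ψ z w = c z * ψ' z w := by
  have hex : ∀ z, ∃ v : V, z ∈ A → v ≠ 0 ∧ p z v = v ∧ ∀ w, ∃ c : ℂ, p z w = c • v := fun z => by
    by_cases hz : z ∈ A
    · obtain ⟨v, h1, h2, h3⟩ := hline z hz; exact ⟨v, fun _ => ⟨h1, h2, h3⟩⟩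
    · exact ⟨0, fun h => absurd h hz⟩
  choose v hv using hex
  have hne : ∀ z ∈ A, ψ z (v z) ≠ 0 := fun z hz h => (hv z hz).1 (hf z hz _ (hv z hz).2.1 h)
  have hne' : ∀ z ∈ A, ψ' z (v z) ≠ 0 := fun z hz h => (hv z hz).1 (hf' z hz _ (hv z hz).2.1 h)
  set c : X → ℂ := fun z => ψ z (v z) / ψ' z (v z) with hc
  have hrat : ∀ z ∈ A, ∀ w, p z w = w → ψ z w = c z * ψ' z w := fun z hz w hw => by
    obtain ⟨b, hb⟩ := (hv z hz).2.2 w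
    rw [hw] at hb
    rw [hb, map_smul, map_smul, smul_eq_mul, smul_eq_mul]
    simp only [hc]; field_simp [hne' z hz]
  refine ⟨c, fun z hz => ?_, fun z hz => div_ne_zero (hne z hz) (hne' z hz), hrat⟩
  -- The vectors `v` are chosen pointwise and need not be continuous. Near `z` the ratio is
  -- evaluated instead on the projections of the one vector `v z`.
  have h1 : ContinuousWithinAt (fun w => ψ w (p w (v z)) / ψ' w (p w (v z))) A z := by
    have h2 := (hp z hz).clm_apply (continuousWithinAt_const (b := v z))
    refine ((hψ z hz).clm_apply h2).div ((hψ' z hz).clm_apply h2) ?_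
    rw [(hv z hz).2.1]; exact hne' z hz
  have h2 : ∀ᶠ w in 𝓝[A] z, ψ' w (p w (v z)) ≠ 0 := by
    have : ContinuousWithinAt (fun w => ψ' w (p w (v z))) A z :=
      (hψ' z hz).clm_apply ((hp z hz).clm_apply continuousWithinAt_const)
    refine this.eventually_ne ?_
    simp only [(hv z hz).2.1]; exact hne' z hz
  have h3 : c =ᶠ[𝓝[A] z] fun w => ψ w (p w (v z)) / ψ' w (p w (v z)) := by
    filter_upwards [h2, self_mem_nhdsWithin] with w hw hwA
    rw [eq_div_iff hw, ← hrat w hwA _ ((hline w hwA).idem _)]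
  exact h1.congr_of_eventuallyEq h3 (h3.self_of_nhdsWithin hz)

/-- The index along the circle of radius `r` of a section `v` of a field of lines over the disk,
computed in a frame. -/
def LineIndex (p : ℂ → V →L[ℂ] V) (v : ℂ → V) (r : ℝ) (k : ℤ) : Prop :=
  ∃ ψ : ℂ → V →L[ℂ] ℂ, ContinuousOn ψ (Metric.closedBall 0 r) ∧
    (∀ z ∈ Metric.closedBall 0 r, IsFrame (p z) (ψ z)) ∧ CircleIndex (fun z => ψ z (v z)) 0 r k

/-- Any other frame gives the same index: the ratio of two frames has no zeros on the closed disk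
and hence index zero on its boundary. -/
theorem LineIndex.circleIndex {p : ℂ → V →L[ℂ] V} {v : ℂ → V} {r : ℝ} {k : ℤ} (hr : 0 ≤ r)
    (h : LineIndex p v r k) (hp : ContinuousOn p (Metric.closedBall 0 r))
    (hline : ∀ z ∈ Metric.closedBall 0 r, IsLineProj (p z))
    (hv : ∀ z ∈ Metric.sphere 0 r, p z (v z) = v z)
    {ψ : ℂ → V →L[ℂ] ℂ} (hψ : ContinuousOn ψ (Metric.closedBall 0 r))
    (hf : ∀ z ∈ Metric.closedBall 0 r, IsFrame (p z) (ψ z)) :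
    CircleIndex (fun z => ψ z (v z)) 0 r k := by
  obtain ⟨ψ', hψ', hf', hk⟩ := h
  obtain ⟨c, hc, hc0, hrat⟩ := exists_frame_ratio hp hline hψ hψ' hf hf'
  have := (circleIndex_zero hr hc hc0).mul hk
  rw [zero_add] at this
  exact this.congr hr fun z hz => (hrat z (Metric.sphere_subset_closedBall hz) _ (hv z hz)).symm

theorem LineIndex.unique {p : ℂ → V →L[ℂ] V} {v : ℂ → V} {r : ℝ} {k l : ℤ} (hr : 0 ≤ r)
    (h : LineIndex p v r k) (h' : LineIndex p v r l) (hp : ContinuousOn p (Metric.closedBall 0 r))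
    (hline : ∀ z ∈ Metric.closedBall 0 r, IsLineProj (p z))
    (hv : ∀ z ∈ Metric.sphere 0 r, p z (v z) = v z) : k = l := by
  obtain ⟨ψ', hψ', hf', hk⟩ := h'
  exact (h.circleIndex hr hp hline hv hψ' hf').unique hk

end LineFields

/-! ### Spaces over which a complex line and a vector on it are given -/

/-- A continuous field of complex lines `P y ⊆ V` on the space `Y`, with a continuous section. -/
structure LineSection (Y V : Type*) [TopologicalSpace Y] [NormedAddCommGroup V]
    [NormedSpace ℂ V] where
  /-- The projections onto the lines. -/
  P : Y → V →L[ℂ] V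
  /-- The section. -/
  E : Y → V
  continuous_P : Continuous P
  continuous_E : Continuous E
  isLineProj : ∀ y, IsLineProj (P y)
  P_E : ∀ y, P y (E y) = E y

namespace LineSection

variable {Y V : Type*} [TopologicalSpace Y] [NormedAddCommGroup V] [NormedSpace ℂ V]
  (Λ : LineSection Y V)

/-- The lines along a map of the disk. -/
noncomputable def lines (s : Disk → Y) (z : ℂ) : V →L[ℂ] V := Λ.P (s (toDisk z))

/-- The section along a map of the disk. -/
noncomputable def vec (s : Disk → Y) (z : ℂ) : V := Λ.E (s (toDisk z))

variable {Λ}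

theorem continuousOn_lines {s : Disk → Y} (hs : Continuous s) :
    ContinuousOn (Λ.lines s) (Metric.ball 0 1) :=
  (Λ.continuous_P.comp hs).comp_continuousOn continuousOn_toDisk

theorem continuousOn_vec {s : Disk → Y} (hs : Continuous s) :
    ContinuousOn (Λ.vec s) (Metric.ball 0 1) :=
  (Λ.continuous_E.comp hs).comp_continuousOn continuousOn_toDisk

theorem closedBall_subset {r : ℝ} (hr : r < 1) :
    Metric.closedBall (0 : ℂ) r ⊆ Metric.ball 0 1 := Metric.closedBall_subset_ball hr

/-- All zeros of the section along `s` lie in the disk of radius `r₀`. -/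
def ZerosIn (Λ : LineSection Y V) (s : Disk → Y) (r₀ : ℝ) : Prop :=
  ∀ z : Disk, Λ.E (s z) = 0 → ‖(z : ℂ)‖ ≤ r₀

theorem ZerosIn.vec_ne_zero {s : Disk → Y} {r₀ : ℝ} (h : Λ.ZerosIn s r₀) {z : ℂ} (hz : r₀ < ‖z‖)
    (hz1 : ‖z‖ < 1) : Λ.vec s z ≠ 0 := fun h0 => by
  have := h _ h0
  rw [coe_toDisk hz1] at this; linarith

theorem exists_frame_lines {s : Disk → Y} (hs : Continuous s) {r : ℝ} (hr : r < 1) :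
    ∃ ψ : ℂ → V →L[ℂ] ℂ, ContinuousOn ψ (Metric.closedBall 0 r) ∧
      ∀ z ∈ Metric.closedBall 0 r, IsFrame (Λ.lines s z) (ψ z) := by
  rcases le_or_gt 0 r with h0 | h0
  · exact exists_frame (isCompact_closedBall 0 r)
      ((convex_closedBall (0 : ℂ) r).starConvex (by simpa using h0))
      ((continuousOn_lines hs).mono (closedBall_subset hr)) fun z _ => Λ.isLineProj _
  · exact ⟨0, continuousOn_const, by simp [Metric.closedBall_eq_empty.2 h0]⟩

theorem frame_vec_ne_zero {s : Disk → Y} {z : ℂ} {ψ : V →L[ℂ] ℂ} (hψ : IsFrame (Λ.lines s z) ψ)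
    (h : Λ.vec s z ≠ 0) : ψ (Λ.vec s z) ≠ 0 := fun h0 => h (hψ _ (Λ.P_E _) h0)

/-- The index of a map of the disk, along all circles near the boundary. -/
def MapIndex (Λ : LineSection Y V) (s : Disk → Y) (k : ℤ) : Prop :=
  ∃ r₀ < 1, ∀ r, r₀ < r → r < 1 → LineIndex (Λ.lines s) (Λ.vec s) r k

/-- The index passes inwards to every circle that still encloses all zeros, since the annulus in
between has none. -/
theorem MapIndex.lineIndex {s : Disk → Y} (hs : Continuous s) {k : ℤ} (h : Λ.MapIndex s k) {r₀ : ℝ}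
    (h0 : 0 ≤ r₀) (hz : Λ.ZerosIn s r₀) {r : ℝ} (hr : r₀ < r) (hr1 : r < 1) :
    LineIndex (Λ.lines s) (Λ.vec s) r k := by
  obtain ⟨r₁, hr₁, h⟩ := h
  -- A radius large enough for the hypothesis to apply and at least `r`; one frame on its disk
  -- serves both circles.
  set ρ := max r ((r₁ + 1) / 2) with hρ
  have hρr : r ≤ ρ := le_max_left _ _
  have hρ1 : ρ < 1 := max_lt hr1 (by linarith)
  obtain ⟨ψ, hψ, hf⟩ := exists_frame_lines (Λ := Λ) hs hρ1
  have hsub : Metric.closedBall (0 : ℂ) ρ ⊆ Metric.ball 0 1 := closedBall_subset hρ1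
  have h1 := (h ρ (lt_of_lt_of_le (by linarith) (le_max_right _ _)) hρ1).circleIndex (by linarith)
    ((continuousOn_lines hs).mono hsub) (fun z _ => Λ.isLineProj _) (fun z _ => Λ.P_E _) hψ hf
  have hsubr := Metric.closedBall_subset_closedBall (x := (0 : ℂ)) hρr
  refine ⟨ψ, hψ.mono hsubr, fun z hz => hf z (hsubr hz), ?_⟩
  have hmem : ∀ z : ℂ, ‖z - 0‖ ∈ uIcc ρ r → z ∈ Metric.closedBall 0 ρ ∧ r₀ < ‖z‖ := fun z hz => by
    rw [uIcc_of_ge hρr, sub_zero] at hz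
    exact ⟨by simpa using hz.2, by linarith [hz.1]⟩
  refine h1.change_radius (by linarith) (by linarith) (fun z hz' => ?_) fun z hz' => ?_
  · have hzm := (hmem z hz').1
    exact ((hψ z hzm).clm_apply (((continuousOn_vec hs) z (hsub hzm)).mono hsub)).mono
      fun w hw => (hmem w hw).1
  · have hzm := hmem z hz'
    exact frame_vec_ne_zero (hf z hzm.1) (hz.vec_ne_zero hzm.2 (by simpa using hsub hzm.1))

/-- The converse passage: one circle around all the zeros determines the index. -/
theorem LineIndex.mapIndex {s : Disk → Y} (hs : Continuous s) {k : ℤ} {r₀ : ℝ}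
    (h0 : 0 ≤ r₀) (hz : Λ.ZerosIn s r₀) {r : ℝ} (hr : r₀ < r) (hr1 : r < 1)
    (h : LineIndex (Λ.lines s) (Λ.vec s) r k) : Λ.MapIndex s k := by
  refine ⟨r, hr1, fun ρ hρr hρ1 => ?_⟩
  obtain ⟨ψ, hψ, hf⟩ := exists_frame_lines (Λ := Λ) hs hρ1
  have hsub : Metric.closedBall (0 : ℂ) ρ ⊆ Metric.ball 0 1 := closedBall_subset hρ1
  have hsubr := Metric.closedBall_subset_closedBall (x := (0 : ℂ)) hρr.le
  have h1 := h.circleIndex (by linarith) ((continuousOn_lines hs).mono (hsubr.trans hsub))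
    (fun z _ => Λ.isLineProj _) (fun z _ => Λ.P_E _) (hψ.mono hsubr) fun z hz => hf z (hsubr hz)
  refine ⟨ψ, hψ, hf, ?_⟩
  have hmem : ∀ z : ℂ, ‖z - 0‖ ∈ uIcc r ρ → z ∈ Metric.closedBall 0 ρ ∧ r₀ < ‖z‖ := fun z hz => by
    rw [uIcc_of_le hρr.le, sub_zero] at hz
    exact ⟨by simpa using hz.2, by linarith [hz.1]⟩
  refine h1.change_radius (by linarith) (by linarith) (fun z hz' => ?_) fun z hz' => ?_
  · have hzm := (hmem z hz').1
    exact ((hψ z hzm).clm_apply (((continuousOn_vec hs) z (hsub hzm)).mono hsub)).mono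
      fun w hw => (hmem w hw).1
  · have hzm := hmem z hz'
    exact frame_vec_ne_zero (hf z hzm.1) (hz.vec_ne_zero hzm.2 (by simpa using hsub hzm.1))

theorem MapIndex.unique {s : Disk → Y} (hs : Continuous s) {k l : ℤ} (h : Λ.MapIndex s k)
    (h' : Λ.MapIndex s l) : k = l := by
  obtain ⟨r₁, hr₁, h⟩ := h
  obtain ⟨r₂, hr₂, h'⟩ := h'
  obtain ⟨r, hr, hr1⟩ := exists_between (max_lt (max_lt hr₁ hr₂) one_pos)
  have := (le_max_right _ _).trans_lt hr
  have hm := (le_max_left _ _).trans_lt hr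
  refine LineIndex.unique this.le (h r ((le_max_left _ _).trans_lt hm) hr1)
    (h' r ((le_max_right _ _).trans_lt hm) hr1)
    ((continuousOn_lines hs).mono (closedBall_subset hr1)) (fun z _ => Λ.isLineProj _)
    (fun z _ => Λ.P_E _)

theorem _root_.DiskIndex.exists_norm_le_of_isCompact {K : Set Disk} (hK : IsCompact K) :
    ∃ r₀ : ℝ, 0 ≤ r₀ ∧ r₀ < 1 ∧ ∀ z ∈ K, ‖(z : ℂ)‖ ≤ r₀ := by
  rcases K.eq_empty_or_nonempty with rfl | hne
  · exact ⟨0, le_rfl, one_pos, by simp⟩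
  · obtain ⟨x, hx, hmax⟩ := hK.exists_isMaxOn hne (f := fun z : Disk => ‖(z : ℂ)‖)
      (by fun_prop)
    exact ⟨‖(x : ℂ)‖, norm_nonneg _, norm_coe_lt x, fun z hz => hmax hz⟩

/-- Invariance of the index under homotopies without zeros near the boundary. -/
theorem MapIndex.homotopy {s₀ s₁ : C(Disk, Y)} (h : s₀.Homotopy s₁) {K : Set Disk}
    (hK : IsCompact K) (hz : ∀ t, ∀ z ∉ K, Λ.E (h (t, z)) ≠ 0) {k : ℤ} (hk : Λ.MapIndex s₀ k) :
    Λ.MapIndex s₁ k := by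
  obtain ⟨r₀, h0, h1, hr₀⟩ := exists_norm_le_of_isCompact hK
  have hzero : ∀ t, ∀ z : Disk, Λ.E (h (t, z)) = 0 → ‖(z : ℂ)‖ ≤ r₀ := fun t z hz0 => by
    by_contra hc; exact hz t z (fun hzK => hc (hr₀ z hzK)) hz0
  have hz₀ : Λ.ZerosIn s₀ r₀ := fun z hz => hzero 0 z (by simpa using hz)
  have hz₁ : Λ.ZerosIn s₁ r₀ := fun z hz => hzero 1 z (by simpa using hz)
  obtain ⟨r, hr, hr1⟩ := exists_between h1
  have hrpos : 0 ≤ r := by linarith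
  have hsub : Metric.closedBall (0 : ℂ) r ⊆ Metric.ball 0 1 := closedBall_subset hr1
  set B : Set (ℝ × ℂ) := Icc 0 1 ×ˢ Metric.closedBall 0 r with hB
  let H : ℝ × ℂ → Y := fun q => h (projIcc 0 1 zero_le_one q.1, toDisk q.2)
  have hH : ContinuousOn H B := by
    refine h.continuous.comp_continuousOn ?_
    refine (continuous_projIcc.comp continuous_fst).continuousOn.prodMk ?_
    exact continuousOn_toDisk.comp continuousOn_snd fun q hq => hsub hq.2
  -- A single frame over `[0, 1]` times the closed disk, which is compact and star-shaped about `(0,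
  -- 0)`, restricts to frames for both ends and turns the homotopy into one of loops in `ℂ \ {0}`.
  obtain ⟨ψ, hψ, hf⟩ := exists_frame (E := ℝ × ℂ) (B := B)
    (isCompact_Icc.prod (isCompact_closedBall 0 r))
    (((convex_Icc (0 : ℝ) 1).prod (convex_closedBall (0 : ℂ) r)).starConvex
      ⟨by simp, by simpa using hrpos⟩)
    (p := fun q => Λ.P (H q)) (Λ.continuous_P.comp_continuousOn hH) (fun q _ => Λ.isLineProj _)
  have hH0 : ∀ z, H (0, z) = s₀ (toDisk z) := fun z => by simp [H]
  have hH1 : ∀ z, H (1, z) = s₁ (toDisk z) := fun z => by simp [H]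
  have hslice : ∀ t ∈ Icc (0 : ℝ) 1,
      ContinuousOn (fun z : ℂ => ψ (t, z)) (Metric.closedBall 0 r) := fun t ht =>
    hψ.comp (by fun_prop) fun z hz => ⟨ht, hz⟩
  have hk0 : CircleIndex (fun z => ψ (0, z) (Λ.vec s₀ z)) 0 r k :=
    (hk.lineIndex s₀.continuous h0 hz₀ hr hr1).circleIndex hrpos
      ((continuousOn_lines s₀.continuous).mono hsub) (fun z _ => Λ.isLineProj _)
      (fun z _ => Λ.P_E _) (hslice 0 (by simp))
      (fun z hz => by have := hf (0, z) ⟨by simp, hz⟩; rwa [hH0] at this)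
  refine LineIndex.mapIndex s₁.continuous h0 hz₁ hr hr1 ⟨fun z => ψ (1, z), hslice 1 (by simp),
    fun z hz => by have := hf (1, z) ⟨by simp, hz⟩; rwa [hH1] at this, ?_⟩
  have := HasWindingNumber.homotopy (k := k)
    (H := fun t θ => ψ (t, circleMap 0 r θ) (Λ.E (H (t, circleMap 0 r θ)))) ?_ ?_ ?_ ?_
  · simp only [hH1] at this; exact this
  · have hc : ContinuousOn (fun q : ℝ × ℝ => ((q.1, circleMap 0 r q.2) : ℝ × ℂ)) (Icc 0 1 ×ˢ univ) := by
      unfold circleMap; fun_prop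
    have hm : MapsTo (fun q : ℝ × ℝ => ((q.1, circleMap 0 r q.2) : ℝ × ℂ)) (Icc 0 1 ×ˢ univ) B :=
      fun q hq => ⟨hq.1, circleMap_mem_closedBall 0 hrpos _⟩
    exact (hψ.comp hc hm).clm_apply ((Λ.continuous_E.comp_continuousOn hH).comp hc hm)
  · intro t ht θ h0'
    have := hf (t, circleMap 0 r θ) ⟨ht, circleMap_mem_closedBall 0 hrpos _⟩ _ (Λ.P_E _) h0'
    have h2 := hzero _ _ this
    have h3 : ‖circleMap 0 r θ‖ = r := by simp [abs_of_nonneg hrpos]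
    rw [coe_toDisk (by rw [h3]; exact hr1), h3] at h2
    linarith
  · intro t _; rw [circleMap_two_pi]
  · simp only [hH0]; exact hk0

/-- A map without zeros has index zero. -/
theorem mapIndex_zero {s : Disk → Y} (hs : Continuous s) (h : ∀ z, Λ.E (s z) ≠ 0) :
    Λ.MapIndex s 0 := by
  refine ⟨0, one_pos, fun r hr hr1 => ?_⟩
  obtain ⟨ψ, hψ, hf⟩ := exists_frame_lines (Λ := Λ) hs hr1
  exact ⟨ψ, hψ, hf, circleIndex_zero hr.le
    (hψ.clm_apply ((continuousOn_vec hs).mono (closedBall_subset hr1)))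
    fun z hz => frame_vec_ne_zero (hf z hz) (h _)⟩

/-- The index of a map with finitely many zeros is the sum of the local indices. -/
theorem mapIndex_sum {s : Disk → Y} (hs : Continuous s) (S : Finset Disk) (κ : Disk → ℤ)
    (lam : Disk → V →L[ℂ] ℂ) (hS : ∀ z, Λ.E (s z) = 0 → z ∈ S)
    (hframe : ∀ z ∈ S, IsFrame (Λ.P (s z)) (lam z))
    (hloc : ∀ z ∈ S, HasLocalIndex (fun w => lam z (Λ.vec s w)) z (κ z)) :
    Λ.MapIndex s (∑ z ∈ S, κ z) := by
  classical
  obtain ⟨r₀, h0, h1, hr₀⟩ := exists_norm_le_of_isCompact S.finite_toSet.isCompact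
  have hz : Λ.ZerosIn s r₀ := fun z hz => hr₀ z (hS z hz)
  obtain ⟨r, hr, hr1⟩ := exists_between h1
  have hrpos : 0 ≤ r := by linarith
  have hsub : Metric.closedBall (0 : ℂ) r ⊆ Metric.ball 0 1 := closedBall_subset hr1
  obtain ⟨ψ, hψ, hf⟩ := exists_frame_lines (Λ := Λ) hs hr1
  refine LineIndex.mapIndex hs h0 hz hr hr1 ⟨ψ, hψ, hf, ?_⟩
  have himg : ∑ z ∈ S, κ z = ∑ w ∈ S.image (fun z : Disk => (z : ℂ)), κ (toDisk w) := by
    rw [Finset.sum_image (fun z _ w _ h => Subtype.ext h)]; simp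
  rw [himg]
  refine circleIndex_sum hrpos _ _ _ (hψ.clm_apply ((continuousOn_vec hs).mono hsub)) ?_ ?_ ?_
  · intro w hw
    obtain ⟨z, hzS, rfl⟩ := Finset.mem_image.1 hw
    simpa using (hr₀ z hzS).trans_lt hr
  · intro w hw hwS
    refine frame_vec_ne_zero (hf w hw) fun h => hwS ?_
    refine Finset.mem_image.2 ⟨toDisk w, hS _ h, coe_toDisk (by simpa using hsub hw)⟩
  · intro w hw
    obtain ⟨z, hzS, rfl⟩ := Finset.mem_image.1 hw
    rw [toDisk_coe]
    have hzball : (z : ℂ) ∈ Metric.ball (0 : ℂ) r := by simpa using (hr₀ z hzS).trans_lt hr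
    have hnhds : Metric.closedBall (0 : ℂ) r ∈ 𝓝 (z : ℂ) :=
      mem_of_superset (Metric.isOpen_ball.mem_nhds hzball) Metric.ball_subset_closedBall
    have hl : ContinuousOn (Λ.lines s) (Metric.closedBall 0 r) := (continuousOn_lines hs).mono hsub
    have hev := eventually_isFrame (hl.continuousAt hnhds)
      (.of_forall fun w => Λ.isLineProj _) (ψ := lam z) (by
        simpa [lines] using hframe z hzS)
    obtain ⟨A, hA, hAo, hzA⟩ := mem_nhds_iff.1 (inter_mem hnhds hev)
    -- Near `z` the frame of the disk and the constant frame `lam z` differ by a function without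
    -- zeros, which has local index zero.
    obtain ⟨c, hc, hc0, hrat⟩ := exists_frame_ratio (hl.mono fun w hw => (hA hw).1)
      (fun w _ => Λ.isLineProj _) (hψ.mono fun w hw => (hA hw).1) (ψ' := fun _ => lam z)
      continuousOn_const (fun w hw => hf w (hA hw).1) (fun w hw => (hA hw).2)
    have hcz : HasLocalIndex c z 0 := hasLocalIndex_zero (by
      filter_upwards [hAo.mem_nhds hzA] with w hw using hc.continuousAt (hAo.mem_nhds hw)) (hc0 _ hzA)
    have := hcz.mul (hloc z hzS)
    rw [zero_add] at this
    refine this.congr (nhdsWithin_le_nhds ?_)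
    filter_upwards [hAo.mem_nhds hzA] with w hw
    exact (hrat w hw _ (Λ.P_E _)).symm

end LineSection

/-- The radial retraction of the plane onto the disk of radius `R`. -/
noncomputable def radialRetract (R : ℝ) (z : ℂ) : ℂ := ((R / max R ‖z‖ : ℝ) : ℂ) * z

theorem continuous_radialRetract {R : ℝ} (hR : 0 < R) : Continuous (radialRetract R) := by
  unfold radialRetract
  refine (Complex.continuous_ofReal.comp (continuous_const.div (by fun_prop) fun z => ?_)).mul
    continuous_id
  exact (hR.trans_le (le_max_left _ _)).ne'

theorem norm_radialRetract {R : ℝ} (hR : 0 < R) (z : ℂ) :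
    ‖radialRetract R z‖ = R / max R ‖z‖ * ‖z‖ := by
  have : 0 ≤ R / max R ‖z‖ := div_nonneg hR.le (hR.le.trans (le_max_left _ _))
  rw [radialRetract, norm_mul, Complex.norm_real, Real.norm_of_nonneg this]

theorem norm_radialRetract_le {R : ℝ} (hR : 0 < R) (z : ℂ) : ‖radialRetract R z‖ ≤ R := by
  rw [norm_radialRetract hR, div_mul_eq_mul_div, div_le_iff₀ (hR.trans_le (le_max_left _ _))]
  exact mul_le_mul_of_nonneg_left (le_max_right _ _) hR.le

theorem radialRetract_of_le {R : ℝ} (hR : 0 < R) {z : ℂ} (hz : ‖z‖ ≤ R) : radialRetract R z = z := by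
  rw [radialRetract, max_eq_left hz, div_self hR.ne']; simp

theorem radialRetract_of_norm_lt {R : ℝ} (hR : 0 < R) {z : ℂ} (hz : ‖radialRetract R z‖ < R) :
    radialRetract R z = z := by
  refine radialRetract_of_le hR (le_of_not_gt fun h => ?_)
  rw [norm_radialRetract hR, max_eq_right h.le, div_mul_cancel₀ _ (hR.trans h).ne'] at hz
  exact lt_irrefl _ hz

theorem toDisk_diskExtend (θ : C(Disk, Disk)) {z : ℂ} (hz : ‖z‖ < 1) :
    toDisk (diskExtend θ z) = θ (toDisk z) := by
  rw [diskExtend_of_norm_lt θ hz, toDisk_coe]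

theorem isCompact_setOf_norm_le {r : ℝ} (hr : r < 1) : IsCompact {z : Disk | ‖(z : ℂ)‖ ≤ r} := by
  refine Topology.IsInducing.subtypeVal.isCompact_preimage' (K := Metric.closedBall (0 : ℂ) r)
    (isCompact_closedBall 0 r) (fun z hz => ?_) |>.of_isClosed_subset
    (isClosed_le (by fun_prop) continuous_const) fun z hz => by simpa using hz
  have : ‖z‖ < 1 := (by simpa using hz : ‖z‖ ≤ r).trans_lt hr
  exact ⟨toDisk z, coe_toDisk this⟩

/-! ### The index under composition with self-maps of the disk. -/

namespace LineSection

variable {Y V : Type*} [TopologicalSpace Y] [NormedAddCommGroup V] [NormedSpace ℂ V]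
  {Λ : LineSection Y V}

theorem lines_comp (s : Disk → Y) (θ : C(Disk, Disk)) {z : ℂ} (hz : ‖z‖ < 1) :
    Λ.lines (s ∘ θ) z = Λ.lines s (diskExtend θ z) := by
  simp [lines, toDisk_diskExtend θ hz]

theorem vec_comp (s : Disk → Y) (θ : C(Disk, Disk)) {z : ℂ} (hz : ‖z‖ < 1) :
    Λ.vec (s ∘ θ) z = Λ.vec s (diskExtend θ z) := by
  simp [vec, toDisk_diskExtend θ hz]

theorem frame_comp {s : Disk → Y} {θ : C(Disk, Disk)} {ψ : ℂ → V →L[ℂ] ℂ}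
    {R ρ : ℝ} (hψ : ContinuousOn ψ (Metric.closedBall 0 R))
    (hf : ∀ z ∈ Metric.closedBall 0 R, IsFrame (Λ.lines s z) (ψ z)) (hρ : ρ < 1)
    (hθ : ∀ z ∈ Metric.closedBall 0 ρ, diskExtend θ z ∈ Metric.closedBall 0 R) :
    ContinuousOn (fun z => ψ (diskExtend θ z)) (Metric.closedBall 0 ρ) ∧
      ∀ z ∈ Metric.closedBall 0 ρ, IsFrame (Λ.lines (s ∘ θ) z) (ψ (diskExtend θ z)) := by
  have hsub : Metric.closedBall (0 : ℂ) ρ ⊆ Metric.ball 0 1 := closedBall_subset hρ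
  refine ⟨hψ.comp ((continuousOn_diskExtend θ).mono hsub) hθ, fun z hz => ?_⟩
  rw [lines_comp s θ (by simpa using hsub hz)]
  exact hf _ (hθ z hz)

/-- The index of the composition with a proper map of degree `d`. -/
theorem MapIndex.comp_degree {s : C(Disk, Y)} {k d : ℤ} (hk : Λ.MapIndex s k) {K : Set Disk}
    (hK : IsCompact K) (hz : ∀ z ∉ K, Λ.E (s z) ≠ 0) {θ : C(Disk, Disk)} (hθ : IsProperMap θ)
    (hd : HasDegree θ d) : Λ.MapIndex (s ∘ θ) (d * k) := by
  obtain ⟨r₀, h0, h01, hr₀⟩ := exists_norm_le_of_isCompact hK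
  have hs : Λ.ZerosIn s r₀ := fun z hz0 => by
    by_contra hc; exact hz z (fun hzK => hc (hr₀ z hzK)) hz0
  obtain ⟨r₁, hr₁, hr₁1⟩ := exists_between h01
  -- By properness `θ` maps everything beyond radius `ρ₁` beyond radius `r₁`. So the zeros of `s ∘
  -- θ` stay within `ρ₁`, and the circle of radius `ρ > ρ₁` goes to a loop outside the zeros of `s`.
  obtain ⟨ρ₁, hρ0, hρ1, hρ⟩ := exists_norm_le_of_isCompact
    (hθ.isCompact_preimage (isCompact_setOf_norm_le hr₁1))
  have hρ' : ∀ z : Disk, ‖(θ z : ℂ)‖ ≤ r₁ → ‖(z : ℂ)‖ ≤ ρ₁ := fun z h => hρ z h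
  obtain ⟨rθ, hrθ, hdeg⟩ := hd
  obtain ⟨ρ, hmax, hρlt⟩ := exists_between (max_lt hρ1 hrθ)
  have hρρ₁ : ρ₁ < ρ := (le_max_left _ _).trans_lt hmax
  -- An outer bound for the image of that circle: the loop lies in the annulus between `r₀` and
  -- `R₁`, where `CircleIndex.comp` applies.
  obtain ⟨R, hR0, hR1, hR⟩ := exists_norm_le_of_isCompact
    ((isCompact_setOf_norm_le hρlt).image θ.continuous)
  obtain ⟨R₁, hmaxR, hR₁⟩ := exists_between (max_lt hR1 hr₁1)
  have hRR₁ : R < R₁ := (le_max_left _ _).trans_lt hmaxR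
  have hr₁R₁ : r₁ < R₁ := (le_max_right _ _).trans_lt hmaxR
  obtain ⟨ψ, hψ, hf⟩ := exists_frame_lines (Λ := Λ) s.continuous hR₁
  have hsubR : Metric.closedBall (0 : ℂ) R₁ ⊆ Metric.ball 0 1 := closedBall_subset hR₁
  have hsub1 : Metric.closedBall (0 : ℂ) r₁ ⊆ Metric.closedBall 0 R₁ :=
    Metric.closedBall_subset_closedBall hr₁R₁.le
  have hext : ∀ z ∈ Metric.closedBall (0 : ℂ) ρ, ‖diskExtend θ z‖ ≤ R := fun z hz => by
    have hz' : ‖z‖ ≤ ρ := by simpa using hz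
    rw [diskExtend_of_norm_lt θ (hz'.trans_lt hρlt)]
    exact hR _ ⟨toDisk z, by simpa [coe_toDisk (hz'.trans_lt hρlt)] using hz', rfl⟩
  have hc := (hk.lineIndex s.continuous h0 hs hr₁ hr₁1).circleIndex (by linarith)
    ((continuousOn_lines s.continuous).mono (hsub1.trans hsubR)) (fun z _ => Λ.isLineProj _)
    (fun z _ => Λ.P_E _) (hψ.mono hsub1) fun z hz => hf z (hsub1 hz)
  have hAsub : annulus (0 : ℂ) r₀ R₁ ⊆ Metric.closedBall 0 R₁ := fun z hz => by
    simpa using (by simpa using hz.2 : ‖z‖ < R₁).le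
  have hcomp := hc.comp h0 ⟨hr₁, hr₁R₁⟩
    ((hψ.clm_apply ((continuousOn_vec s.continuous).mono hsubR)).mono hAsub)
    (fun z hz => frame_vec_ne_zero (hf z (hAsub hz))
      (hs.vec_ne_zero (by simpa using hz.1) (by simpa using hsubR (hAsub hz))))
    (γ := fun t => diskExtend θ (circleMap 0 ρ t)) (fun t => ?_)
    (by simpa using hdeg ρ ((le_max_right _ _).trans_lt hmax) hρlt)
  · have hfr := frame_comp (Λ := Λ) hψ hf hρlt (θ := θ) fun z hz => by
      simpa using (hext z hz).trans hRR₁.le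
    refine LineIndex.mapIndex (s.continuous.comp θ.continuous) hρ0
      (fun z hz0 => hρ' z ((hs _ hz0).trans hr₁.le)) hρρ₁ hρlt
      ⟨_, hfr.1, hfr.2, ?_⟩
    refine CircleIndex.congr (by linarith) (f := fun z => ψ (diskExtend θ z) (Λ.vec s (diskExtend θ z)))
      hcomp fun z hz => ?_
    rw [vec_comp s θ (by rw [mem_sphere_zero_iff_norm.1 hz]; exact hρlt)]
  · have hm : circleMap 0 ρ t ∈ Metric.closedBall (0 : ℂ) ρ :=
      circleMap_mem_closedBall 0 (by linarith) t
    have hn : ‖circleMap 0 ρ t‖ = ρ := by simp [abs_of_nonneg (show 0 ≤ ρ by linarith)]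
    refine ⟨?_, ?_⟩
    · rw [sub_zero]
      by_contra hcon
      have hlt : ‖circleMap 0 ρ t‖ < 1 := by rw [hn]; exact hρlt
      rw [diskExtend_of_norm_lt θ hlt] at hcon
      have := hρ' (toDisk (circleMap 0 ρ t)) ((not_lt.1 hcon).trans hr₁.le)
      rw [coe_toDisk hlt, hn] at this
      linarith
    · rw [sub_zero]; exact (hext _ hm).trans_lt hRR₁

/-- Removing all the other ranges, which are open, from `Z` leaves a compact set inside `range (θ
i)`. -/
theorem isCompact_preimage_of_disjoint_cover {X : Type*} [TopologicalSpace X] {ι : Type*}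
    {θ : ι → C(X, X)} (hemb : ∀ i, IsEmbedding (θ i)) (hopen : ∀ i, IsOpen (range (θ i)))
    (hdis : Pairwise fun i j => Disjoint (range (θ i)) (range (θ j))) {Z : Set X}
    (hZ : IsCompact Z) (hcov : Z ⊆ ⋃ i, range (θ i)) (i : ι) : IsCompact (θ i ⁻¹' Z) := by
  have h1 : IsCompact (Z \ ⋃ j ∈ {j | j ≠ i}, range (θ j)) :=
    hZ.diff (isOpen_biUnion fun j _ => hopen j)
  have h2 : Z \ ⋃ j ∈ {j | j ≠ i}, range (θ j) ⊆ range (θ i) := fun z hz => by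
    obtain ⟨j, hj⟩ := mem_iUnion.1 (hcov hz.1)
    by_cases hji : j = i
    · rwa [hji] at hj
    · exact absurd (mem_biUnion (show j ∈ {j | j ≠ i} from hji) hj) hz.2
  convert (hemb i).isInducing.isCompact_preimage' h1 h2 using 1
  ext z
  refine ⟨fun hz => ⟨hz, fun h => ?_⟩, fun hz => hz.1⟩
  obtain ⟨j, hj, hzj⟩ := mem_iUnion₂.1 h
  exact disjoint_left.1 (hdis hj) hzj ⟨z, rfl⟩

/-- Additivity of the index over disjoint embedded disks that contain all the zeros. -/
theorem MapIndex.additive {s : C(Disk, Y)} {k : ℤ} (hk : Λ.MapIndex s k)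
    (hZ : IsCompact {z | Λ.E (s z) = 0}) {ι : Type*} {θ : ι → C(Disk, Disk)}
    (hemb : ∀ i, IsEmbedding (θ i)) (ho : ∀ i, PreservesOrientation (θ i))
    (hdis : Pairwise fun i j => Disjoint (range (θ i)) (range (θ j)))
    (hcov : {z | Λ.E (s z) = 0} ⊆ ⋃ i, range (θ i)) {κ : ι → ℤ}
    (hκ : ∀ i, Λ.MapIndex (s ∘ θ i) (κ i)) :
    {i | κ i ≠ 0}.Finite ∧ k = ∑ᶠ i, κ i := by
  have hopen : ∀ i, IsOpen (range (θ i)) := fun i =>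
    isOpen_range_of_preservesOrientation (hemb i).injective (ho i)
  -- Finitely many disks contain all the zeros; on the others the index is zero.
  obtain ⟨I, hI⟩ := hZ.elim_finite_subcover _ hopen hcov
  have hKc := isCompact_preimage_of_disjoint_cover hemb hopen hdis hZ hcov
  have hκ0 : ∀ i ∉ I, κ i = 0 := fun i hi => by
    refine (hκ i).unique (s.continuous.comp (θ i).continuous) (mapIndex_zero
      (s.continuous.comp (θ i).continuous) fun z hz => ?_)
    obtain ⟨j, hj, hzj⟩ := mem_iUnion₂.1 (hI (show θ i z ∈ {z | Λ.E (s z) = 0} from hz))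
    exact disjoint_left.1 (hdis (fun h => hi (h ▸ hj) : i ≠ j)) ⟨z, rfl⟩ hzj
  have hsupp : Function.support κ ⊆ I := fun i hi => by
    by_contra h; exact hi (hκ0 i h)
  refine ⟨I.finite_toSet.subset hsupp, ?_⟩
  rw [finsum_eq_sum_of_support_subset κ hsupp]
  choose ρ₀ hρ₀0 hρ₀1 hρ₀ using fun i => exists_norm_le_of_isCompact (hKc i)
  choose ρ hρ hρ1 using fun i => exists_between (hρ₀1 i)
  have hρpos : ∀ i, 0 ≤ ρ i := fun i => (hρ₀0 i).trans (hρ i).le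
  -- The radius `R` must enclose the zeros and the images of the smaller closed disks of radii `ρ
  -- i`.
  have hcomp : IsCompact ((⋃ i ∈ I, θ i '' {z : Disk | ‖(z : ℂ)‖ ≤ ρ i}) ∪ {z | Λ.E (s z) = 0}) :=
    (I.finite_toSet.isCompact_biUnion fun i _ =>
      (isCompact_setOf_norm_le (hρ1 i)).image (θ i).continuous).union hZ
  obtain ⟨R₀, hR₀0, hR₀1, hR₀⟩ := exists_norm_le_of_isCompact hcomp
  obtain ⟨R, hR, hR1⟩ := exists_between hR₀1
  have hRpos : 0 < R := hR₀0.trans_lt hR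
  have hzs : Λ.ZerosIn s R₀ := fun z hz => hR₀ z (Or.inr hz)
  obtain ⟨ψ, hψ, hf⟩ := exists_frame_lines (Λ := Λ) s.continuous hR1
  have hsubR : Metric.closedBall (0 : ℂ) R ⊆ Metric.ball 0 1 := closedBall_subset hR1
  have hfc := hψ.clm_apply ((continuousOn_vec (Λ := Λ) s.continuous).mono hsubR)
  -- `circleIndex_additive` asks for a function continuous on the plane, so the coordinate function
  -- is extended radially beyond `R`.
  set F : ℂ → ℂ := fun z => ψ (radialRetract R z) (Λ.vec s (radialRetract R z)) with hF
  have hret : ∀ z, radialRetract R z ∈ Metric.closedBall (0 : ℂ) R := fun z => by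
    simpa using norm_radialRetract_le hRpos z
  have hFc : Continuous F := hfc.comp_continuous (continuous_radialRetract hRpos) hret
  have hFeq : ∀ z ∈ Metric.closedBall (0 : ℂ) R, F z = ψ z (Λ.vec s z) := fun z hz => by
    simp only [hF]; rw [radialRetract_of_le hRpos (by simpa using hz)]
  have hext : ∀ i ∈ I, ∀ z ∈ Metric.closedBall (0 : ℂ) (ρ i), ‖diskExtend (θ i) z‖ ≤ R₀ := by
    intro i hi z hz
    have hz' : ‖z‖ ≤ ρ i := by simpa using hz
    rw [diskExtend_of_norm_lt _ (hz'.trans_lt (hρ1 i))]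
    refine hR₀ _ (Or.inl (mem_biUnion hi ⟨toDisk z, ?_, rfl⟩))
    simpa [coe_toDisk (hz'.trans_lt (hρ1 i))] using hz'
  have hFk : CircleIndex F 0 R k := by
    have := (hk.lineIndex s.continuous hR₀0 hzs hR hR1).circleIndex hRpos.le
      ((continuousOn_lines s.continuous).mono hsubR) (fun z _ => Λ.isLineProj _)
      (fun z _ => Λ.P_E _) hψ hf
    exact this.congr hRpos.le fun z hz => (hFeq z (Metric.sphere_subset_closedBall hz)).symm
  refine hFk.unique (circleIndex_additive hRpos.le hFc I (fun i => diskExtend (θ i)) ρ κ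
    (fun i _ => hρpos i) (fun i _ => orientedEmbedding_diskExtend (hemb i).injective (ho i))
    (fun i _ => hρ1 i) ?_ ?_ ?_ ?_)
  · intro i hi j hj hij
    rw [disjoint_left]
    rintro _ ⟨z, hz, rfl⟩ ⟨w, hw, hzw⟩
    have hz' : ‖z‖ < 1 := by simpa using hz
    have hw' : ‖w‖ < 1 := by simpa using hw
    simp only [diskExtend_of_norm_lt _ hz', diskExtend_of_norm_lt _ hw'] at hzw
    exact disjoint_left.1 (hdis hij) ⟨_, rfl⟩ ⟨_, Subtype.ext hzw⟩
  · rintro i hi _ ⟨z, hz, rfl⟩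
    have := hext i hi z (Metric.ball_subset_closedBall hz)
    simpa using this.trans_lt hR
  -- The extension has no new zeros: the retracted point is a zero of `s`, hence strictly inside the
  -- disk of radius `R`, where the retraction is the identity.
  · intro z hz
    have h1 : Λ.vec s (radialRetract R z) = 0 := by
      by_contra hne; exact frame_vec_ne_zero (hf _ (hret z)) hne hz
    have h2 := hsubR (hret z)
    have h3 : ‖radialRetract R z‖ ≤ R₀ := by
      have := hzs _ h1
      rwa [coe_toDisk (by simpa using h2)] at this
    rw [radialRetract_of_norm_lt hRpos (h3.trans_lt hR)] at h1 h2 h3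
    have hz1 : ‖z‖ < 1 := by simpa using h2
    obtain ⟨i, hi, w, hw⟩ := mem_iUnion₂.1 (hI (show toDisk z ∈ {z | Λ.E (s z) = 0} from h1))
    have hw0 : w ∈ θ i ⁻¹' {z | Λ.E (s z) = 0} := by
      change Λ.E (s (θ i w)) = 0
      rw [hw]; exact h1
    refine ⟨i, hi, w, ?_, ?_⟩
    · simpa using (hρ₀ i w hw0).trans_lt (hρ i)
    · rw [diskExtend_of_norm_lt _ (norm_coe_lt w), toDisk_coe, hw, coe_toDisk hz1]
  · intro i hi
    have hfr := frame_comp (Λ := Λ) hψ hf (hρ1 i) (θ := θ i) fun z hz => by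
      simpa using (hext i hi z hz).trans hR.le
    have := ((hκ i).lineIndex (s.continuous.comp (θ i).continuous) (hρ₀0 i)
      (fun z hz => hρ₀ i z hz) (hρ i) (hρ1 i)).circleIndex (hρpos i)
      ((continuousOn_lines (s.continuous.comp (θ i).continuous)).mono (closedBall_subset (hρ1 i)))
      (fun z _ => Λ.isLineProj _) (fun z _ => Λ.P_E _) hfr.1 hfr.2
    refine this.congr (hρpos i) fun z hz => ?_
    have hzb := Metric.sphere_subset_closedBall hz
    rw [hFeq _ (by simpa using (hext i hi z hzb).trans hR.le)]
    rw [vec_comp _ _ (by rw [mem_sphere_zero_iff_norm.1 hz]; exact hρ1 i)]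

end LineSection

/-! ### Anti-invariant forms on a four-dimensional complex vector space -/

/-- The bilinear forms on `ℝ⁴`. -/
abbrev Bil : Type := R4 →L[ℝ] R4 →L[ℝ] ℝ

noncomputable instance : NormedAddCommGroup Bil := ContinuousLinearMap.toNormedAddCommGroup

noncomputable instance : NormedSpace ℝ Bil := ContinuousLinearMap.toNormedSpace

noncomputable instance : AddCommGroup Bil := ContinuousLinearMap.addCommGroup

noncomputable instance : AddZeroClass Bil := AddMonoid.toAddZeroClass

/-- `B` is alternating and anti-invariant under `𝒥`. -/
def AntiInv (𝒥 : R4 →L[ℝ] R4) (B : Bil) : Prop :=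
  (∀ u v, B u v = -B v u) ∧ ∀ u v, B (𝒥 u) (𝒥 v) = -B u v

/-- The functional `B ↦ B(e, f) - i B(𝒥e, f)`. -/
noncomputable def evalPair (𝒥 : R4 →L[ℝ] R4) (e f : R4) (B : Bil) : ℂ :=
  (B e f : ℂ) - (B (𝒥 e) f : ℂ) * Complex.I

/-- The projection of bilinear forms onto the alternating anti-invariant ones. -/
noncomputable def antiInvProj (𝒥 : R4 →L[ℝ] R4) (B : Bil) : Bil :=
  (1 / 4 : ℝ) • (B - B.flip - B.bilinearComp 𝒥 𝒥 + (B.bilinearComp 𝒥 𝒥).flip)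

theorem antiInvProj_apply (𝒥 : R4 →L[ℝ] R4) (B : Bil) (u v : R4) :
    antiInvProj 𝒥 B u v = (B u v - B v u - B (𝒥 u) (𝒥 v) + B (𝒥 v) (𝒥 u)) / 4 := by
  simp [antiInvProj]; ring

section LinearAlgebra

variable {𝒥 : R4 →L[ℝ] R4}

theorem antiInv_antiInvProj (h𝒥 : ∀ v, 𝒥 (𝒥 v) = -v) (B : Bil) : AntiInv 𝒥 (antiInvProj 𝒥 B) := by
  refine ⟨fun u v => ?_, fun u v => ?_⟩
  · simp only [antiInvProj_apply]; ring
  · simp only [antiInvProj_apply, h𝒥, map_neg, neg_apply]; ring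

theorem AntiInv.swap (h𝒥 : ∀ v, 𝒥 (𝒥 v) = -v) {B : Bil} (h : AntiInv 𝒥 B) (u v : R4) : B u (𝒥 v) = B (𝒥 u) v := by
  have := h.2 u (𝒥 v)
  rw [h𝒥, map_neg] at this; linarith

theorem AntiInv.self {B : Bil} (h : AntiInv 𝒥 B) (u : R4) : B u u = 0 := by
  have := h.1 u u; linarith

theorem AntiInv.self_J (h𝒥 : ∀ v, 𝒥 (𝒥 v) = -v) {B : Bil} (h : AntiInv 𝒥 B) (u : R4) : B u (𝒥 u) = 0 := by
  have h1 := h.swap h𝒥 u u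
  have h2 := h.1 u (𝒥 u); linarith

theorem AntiInv.comp_J (h𝒥 : ∀ v, 𝒥 (𝒥 v) = -v) {B : Bil} (h : AntiInv 𝒥 B) : AntiInv 𝒥 (B.comp 𝒥) := by
  refine ⟨fun u v => ?_, fun u v => ?_⟩
  · simp only [ContinuousLinearMap.comp_apply]
    rw [← h.swap h𝒥, h.1]
  · simp only [ContinuousLinearMap.comp_apply]; exact h.2 _ _

theorem AntiInv.add_smul {B : Bil} {B' : Bil} (h : AntiInv 𝒥 B) (h' : AntiInv 𝒥 B') (a b : ℝ) :
    AntiInv 𝒥 (a • B + b • B') := by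
  refine ⟨fun u v => ?_, fun u v => ?_⟩
  · simp only [add_apply, smul_apply, smul_eq_mul]; rw [h.1, h'.1]; ring
  · simp only [add_apply, smul_apply, smul_eq_mul]; rw [h.2, h'.2]; ring

/-- The minus sign in `evalPair` is chosen for this complex linearity. -/
theorem evalPair_comp_J (h𝒥 : ∀ v, 𝒥 (𝒥 v) = -v) (e f : R4) (B : Bil) :
    evalPair 𝒥 e f (B.comp 𝒥) = Complex.I * evalPair 𝒥 e f B := by
  simp only [evalPair, ContinuousLinearMap.comp_apply, h𝒥, map_neg, neg_apply]
  push_cast; linear_combination (B (𝒥 e) f : ℂ) * Complex.I_sq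

theorem evalPair_add_smul (e f : R4) (B B' : Bil) (a b : ℝ) :
    evalPair 𝒥 e f (a • B + b • B') = a * evalPair 𝒥 e f B + b * evalPair 𝒥 e f B' := by
  simp only [evalPair, add_apply, smul_apply, smul_eq_mul]; push_cast; ring

/-- Under `𝒥` the space `ℝ⁴` is a complex plane, and `e`, `f` are independent over `ℂ`. -/
theorem linearIndependent_of_pair (h𝒥 : ∀ v, 𝒥 (𝒥 v) = -v) {e f : R4} (he : e ≠ 0)
    (hf : ∀ a b : ℝ, f ≠ a • e + b • 𝒥 e) : LinearIndependent ℝ ![e, 𝒥 e, f, 𝒥 f] := by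
  rw [Fintype.linearIndependent_iff]
  intro g hg
  simp [Fin.sum_univ_four] at hg
  have hg2 := congrArg 𝒥 hg
  simp only [map_add, map_smul, h𝒥, map_zero] at hg2
  -- Applying `g 2 - g 3 𝒥`, the conjugate of the coefficient of `f`, to the relation makes that
  -- coefficient real.
  have hcomb : (g 2 ^ 2 + g 3 ^ 2) • f =
      (-(g 2 * g 0 + g 3 * g 1)) • e + (-(g 2 * g 1 - g 3 * g 0)) • 𝒥 e := by
    have h1 : g 2 • (g 0 • e + g 1 • 𝒥 e + g 2 • f + g 3 • 𝒥 f) -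
      g 3 • (g 0 • 𝒥 e + g 1 • -e + g 2 • 𝒥 f + g 3 • -f) = 0 := by rw [hg, hg2]; simp
    rw [← sub_eq_zero, ← h1]; module
  have hcd : g 2 ^ 2 + g 3 ^ 2 = 0 := by
    by_contra hne
    apply hf (-(g 2 * g 0 + g 3 * g 1) / (g 2 ^ 2 + g 3 ^ 2))
      (-(g 2 * g 1 - g 3 * g 0) / (g 2 ^ 2 + g 3 ^ 2))
    rw [← smul_right_injective R4 hne |>.eq_iff, hcomb, smul_add, smul_smul, smul_smul,
      mul_div_cancel₀ _ hne, mul_div_cancel₀ _ hne]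
  have h2 : g 2 = 0 := by nlinarith [sq_nonneg (g 2), sq_nonneg (g 3)]
  have h3 : g 3 = 0 := by nlinarith [sq_nonneg (g 2), sq_nonneg (g 3)]
  rw [h2, h3] at hg hg2
  simp only [zero_smul, add_zero] at hg hg2
  have hab : (g 0 ^ 2 + g 1 ^ 2) • e = 0 := by
    have h1 : g 0 • (g 0 • e + g 1 • 𝒥 e) - g 1 • (g 0 • 𝒥 e + g 1 • -e) = 0 := by
      rw [hg, hg2]; simp
    rw [← h1]; module
  have hab' := (smul_eq_zero.1 hab).resolve_right he
  have h0 : g 0 = 0 := by nlinarith [sq_nonneg (g 0), sq_nonneg (g 1)]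
  have h1 : g 1 = 0 := by nlinarith [sq_nonneg (g 0), sq_nonneg (g 1)]
  intro i; fin_cases i <;> assumption

theorem exists_combination (h𝒥 : ∀ v, 𝒥 (𝒥 v) = -v) {e f : R4} (he : e ≠ 0)
    (hf : ∀ a b : ℝ, f ≠ a • e + b • 𝒥 e) (u : R4) :
    ∃ a b c d : ℝ, u = a • e + b • 𝒥 e + c • f + d • 𝒥 f := by
  have hli := linearIndependent_of_pair h𝒥 he hf
  have hspan := hli.span_eq_top_of_card_eq_finrank (by simp)
  have hu : u ∈ Submodule.span ℝ (range ![e, 𝒥 e, f, 𝒥 f]) := by rw [hspan]; trivial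
  obtain ⟨c, hc⟩ := (Submodule.mem_span_range_iff_exists_fun ℝ).1 hu
  exact ⟨c 0, c 1, c 2, c 3, by rw [← hc]; simp [Fin.sum_univ_four]⟩

/-- On the basis `e, 𝒥e, f, 𝒥f` every value of an anti-invariant form vanishes or is, up to sign,
one of the two given ones. -/
theorem AntiInv.eq_zero (h𝒥 : ∀ v, 𝒥 (𝒥 v) = -v) {B : Bil} (h : AntiInv 𝒥 B) {e f : R4} (he : e ≠ 0)
    (hf : ∀ a b : ℝ, f ≠ a • e + b • 𝒥 e) (h1 : B e f = 0) (h2 : B (𝒥 e) f = 0) : B = 0 := by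
  have t1 := h.swap h𝒥 e f
  have t2 := h.2 e f
  rw [h2] at t1
  rw [h1] at t2
  have t3 := h.self e
  have t4 := h.self f
  have t5 := h.self_J h𝒥 e
  have t6 := h.self_J h𝒥 f
  have t7 := h.self (𝒥 e)
  have t8 := h.self (𝒥 f)
  have s1 := h.1 f e
  have s2 := h.1 f (𝒥 e)
  have s3 := h.1 (𝒥 f) e
  have s4 := h.1 (𝒥 f) (𝒥 e)
  have s5 := h.1 (𝒥 e) e
  have s6 := h.1 (𝒥 f) f
  rw [h1] at s1; rw [h2] at s2; rw [t1] at s3; rw [t2] at s4; rw [t5] at s5; rw [t6] at s6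
  ext u v
  obtain ⟨a, b, c, d, rfl⟩ := exists_combination h𝒥 he hf u
  obtain ⟨a', b', c', d', rfl⟩ := exists_combination h𝒥 he hf v
  simp only [map_add, map_smul, add_apply, smul_apply, smul_eq_mul]
  simp [t1, t2, t3, t4, t5, t6, t7, t8, s1, s2, s3, s4, s5, s6, h1, h2]

theorem AntiInv.independent (h𝒥 : ∀ v, 𝒥 (𝒥 v) = -v) {B : Bil} (h : AntiInv 𝒥 B) {e f : R4} (hB : evalPair 𝒥 e f B ≠ 0) :
    e ≠ 0 ∧ ∀ a b : ℝ, f ≠ a • e + b • 𝒥 e := by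
  refine ⟨fun h0 => hB (by simp [evalPair, h0]), fun a b hf => hB ?_⟩
  have s5 := h.1 (𝒥 e) e
  rw [h.self_J h𝒥] at s5
  simp [evalPair, hf, h.self, h.self_J h𝒥, s5]

theorem AntiInv.evalPair_ne_zero (h𝒥 : ∀ v, 𝒥 (𝒥 v) = -v) {B B₀ : Bil} (h₀ : AntiInv 𝒥 B₀) {e f : R4}
    (hB₀ : evalPair 𝒥 e f B₀ ≠ 0) (h : AntiInv 𝒥 B) (hB : B ≠ 0) : evalPair 𝒥 e f B ≠ 0 := by
  obtain ⟨he, hf⟩ := h₀.independent h𝒥 hB₀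
  intro h0
  have hre := congrArg Complex.re h0
  have him := congrArg Complex.im h0
  simp [evalPair] at hre him
  exact hB (h.eq_zero h𝒥 he hf hre him)

/-- The anti-invariant forms are a complex line. -/
theorem AntiInv.exists_eq (h𝒥 : ∀ v, 𝒥 (𝒥 v) = -v) {B B' : Bil} (h : AntiInv 𝒥 B) (hB : B ≠ 0) (h' : AntiInv 𝒥 B') :
    ∃ a b : ℝ, B' = a • B + b • B.comp 𝒥 := by
  obtain ⟨e, f, hef⟩ : ∃ e f, B e f ≠ 0 := by
    by_contra hcon; push Not at hcon
    exact hB (by ext u v; simpa using hcon u v)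
  have hne : evalPair 𝒥 e f B ≠ 0 := fun h0 => hef (by
    have := congrArg Complex.re h0; simpa [evalPair] using this)
  -- `evalPair` is complex linear and vanishes on no nonzero anti-invariant form, so the quotient of
  -- its values is the only possible coefficient.
  set c : ℂ := evalPair 𝒥 e f B' / evalPair 𝒥 e f B with hc
  refine ⟨c.re, c.im, ?_⟩
  by_contra hcon
  have h1 : AntiInv 𝒥 ((1 : ℝ) • B' + (-1 : ℝ) • (c.re • B + c.im • B.comp 𝒥)) :=
    h'.add_smul (h.add_smul (h.comp_J h𝒥) _ _) _ _
  refine h.evalPair_ne_zero h𝒥 hne h1 (fun h0 => hcon ?_) ?_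
  · rw [one_smul, neg_smul, one_smul, ← sub_eq_add_neg] at h0; exact sub_eq_zero.1 h0
  · rw [evalPair_add_smul, evalPair_add_smul, evalPair_comp_J h𝒥]
    have h3 : (c.re : ℂ) + c.im * Complex.I = c := Complex.re_add_im c
    have h4 : c * evalPair 𝒥 e f B = evalPair 𝒥 e f B' := div_mul_cancel₀ _ hne
    push_cast
    linear_combination (-evalPair 𝒥 e f B) * h3 - h4

/-- Take the product of the coordinates dual to `e` and `f` in the basis `e, 𝒥e, f, 𝒥f`; its
anti-invariant part has the value `1 / 4` on `(e, f)`. -/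
theorem exists_evalPair_ne_zero (h𝒥 : ∀ v, 𝒥 (𝒥 v) = -v) :
    ∃ (e f : R4) (B : Bil), evalPair 𝒥 e f (antiInvProj 𝒥 B) ≠ 0 := by
  obtain ⟨e, he⟩ := exists_ne (0 : R4)
  obtain ⟨f, hf⟩ : ∃ f : R4, ∀ a b : ℝ, f ≠ a • e + b • 𝒥 e := by
    by_contra hcon
    push Not at hcon
    have hspan : Submodule.span ℝ (range ![e, 𝒥 e]) = ⊤ := by
      refine eq_top_iff.2 fun f _ => ?_
      obtain ⟨a, b, rfl⟩ := hcon f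
      exact (Submodule.mem_span_range_iff_exists_fun ℝ).2 ⟨![a, b], by simp⟩
    have := finrank_le_of_span_eq_top hspan
    simp at this
  have hli := linearIndependent_of_pair h𝒥 he hf
  set b := basisOfLinearIndependentOfCardEqFinrank hli (by simp) with hb
  have hbv : ∀ i, b i = ![e, 𝒥 e, f, 𝒥 f] i := fun i => by simp [hb]
  set lam : R4 →L[ℝ] ℝ := LinearMap.toContinuousLinearMap (b.coord 0) with hlam
  set mu : R4 →L[ℝ] ℝ := LinearMap.toContinuousLinearMap (b.coord 2) with hmu
  have e0 : b 0 = e := by simp [hbv]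
  have e1 : b 1 = 𝒥 e := by simp [hbv]
  have e2 : b 2 = f := by simp [hbv]
  have e3 : b 3 = 𝒥 f := by simp [hbv]
  refine ⟨e, f, lam.smulRight mu, fun h0 => ?_⟩
  have hre := congrArg Complex.re h0
  simp only [evalPair, antiInvProj_apply] at hre
  rw [← e1, ← e3, ← e0, ← e2] at hre
  simp [hlam, hmu] at hre

end LinearAlgebra

/-! ### Coordinates on the bundle of anti-invariant forms -/

section Coordinates

variable {M : Type*} [TopologicalSpace M] [ChartedSpace R4 M] [IsManifold (𝓡 4) ∞ M]

/-- The trivialization of the bundle of bilinear forms given by the chart at `x₀`. -/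
noncomputable abbrev bilTriv (x₀ : M) : Trivialization Bil (π Bil (BilinFiber M)) :=
  trivializationAt Bil (BilinFiber M) x₀

/-- The trivialization of the tangent bundle given by the chart at `x₀`. -/
noncomputable abbrev tanTriv (x₀ : M) :
    Trivialization R4 (π R4 (TangentSpace (𝓡 4) : M → Type)) :=
  trivializationAt R4 (TangentSpace (𝓡 4)) x₀

/-- A bilinear form in the chart at `x₀`. -/
noncomputable def bc (x₀ : M) (p : BilinBundle M) : Bil := (bilTriv x₀ p).2

theorem tanTriv_baseSet (x₀ : M) : (tanTriv x₀).baseSet = (chartAt R4 x₀).source := rfl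

theorem bilTriv_baseSet (x₀ : M) : (bilTriv x₀).baseSet = (chartAt R4 x₀).source := by
  simp [bilTriv, hom_trivializationAt_baseSet, TangentBundle.trivializationAt_baseSet]

theorem bc_apply {x₀ x : M} (hx : x ∈ (chartAt R4 x₀).source) (β : BilinFiber M x) (u v : R4) :
    bc x₀ ⟨x, β⟩ u v = β ((tanTriv x₀).symm x u) ((tanTriv x₀).symm x v) := by
  rw [bc, bilTriv, hom_trivializationAt_apply]
  rw [inCoordinates_apply_eq₂ (by simpa [TangentBundle.trivializationAt_baseSet] using hx)
    (by simpa [TangentBundle.trivializationAt_baseSet] using hx) (by simp)]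
  simp

end Coordinates

section Coordinates

variable {M : Type*} [TopologicalSpace M] [ChartedSpace R4 M] [IsManifold (𝓡 4) ∞ M]

theorem bc_add_smul {x₀ x : M} (hx : x ∈ (chartAt R4 x₀).source) (β β' : BilinFiber M x) (a b : ℝ) :
    bc x₀ ⟨x, a • β + b • β'⟩ = a • bc x₀ ⟨x, β⟩ + b • bc x₀ ⟨x, β'⟩ := by
  ext u v
  simp only [bc_apply hx, add_apply, smul_apply]

/-- The bilinear form on `T_x M` with given coordinates. -/
noncomputable def bcInv (x₀ x : M) (B : Bil) : BilinFiber M x := (bilTriv x₀).symm x B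

theorem bc_bcInv {x₀ x : M} (hx : x ∈ (chartAt R4 x₀).source) (B : Bil) :
    bc x₀ ⟨x, bcInv x₀ x B⟩ = B := by
  rw [bc, bcInv, (bilTriv x₀).apply_mk_symm (by rwa [bilTriv_baseSet])]

theorem bcInv_bc {x₀ x : M} (hx : x ∈ (chartAt R4 x₀).source) (β : BilinFiber M x) :
    bcInv x₀ x (bc x₀ ⟨x, β⟩) = β :=
  (bilTriv x₀).symm_apply_apply_mk (by rwa [bilTriv_baseSet]) β

theorem bc_zero {x₀ x : M} (hx : x ∈ (chartAt R4 x₀).source) :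
    bc x₀ ⟨x, (0 : BilinFiber M x)⟩ = 0 := by
  ext u v
  simp [bc_apply hx]

theorem bc_eq_zero_iff {x₀ x : M} (hx : x ∈ (chartAt R4 x₀).source) (β : BilinFiber M x) :
    bc x₀ ⟨x, β⟩ = 0 ↔ β = 0 := by
  refine ⟨fun h => ?_, fun h => h ▸ bc_zero hx⟩
  rw [← bcInv_bc hx β, h, ← bc_zero hx, bcInv_bc hx]

theorem continuousOn_bc (x₀ : M) :
    ContinuousOn (bc x₀) {p : BilinBundle M | p.proj ∈ (chartAt R4 x₀).source} := by
  refine continuous_snd.comp_continuousOn ((bilTriv x₀).continuousOn.mono fun p hp => ?_)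
  rw [(bilTriv x₀).mem_source, bilTriv_baseSet]; exact hp

theorem continuousOn_mk_bcInv (x₀ : M) :
    ContinuousOn (fun q : M × Bil => (⟨q.1, bcInv x₀ q.1 q.2⟩ : BilinBundle M))
      ((chartAt R4 x₀).source ×ˢ univ) := by
  have := (bilTriv x₀).continuousOn_symm
  rwa [bilTriv_baseSet] at this

theorem tanTriv_symm_map (x₀ : M) {x : M} (hx : x ∈ (chartAt R4 x₀).source)
    (v : TangentSpace (𝓡 4) x) :
    (tanTriv x₀).symm x ((tanTriv x₀).continuousLinearMapAt ℝ x v) = v := by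
  have hb : x ∈ (tanTriv x₀).baseSet := by rwa [tanTriv_baseSet]
  rw [← (tanTriv x₀).symmL_apply (R := ℝ) hb]
  exact (tanTriv x₀).symmL_continuousLinearMapAt (R := ℝ) hb v

variable (J : AlmostComplexStructure M)

/-- The almost complex structure in the chart at `x₀`. -/
noncomputable def jc (x₀ x : M) : R4 →L[ℝ] R4 :=
  (trivializationAt (R4 →L[ℝ] R4)
    (fun x : M => TangentSpace (𝓡 4) x →L[ℝ] TangentSpace (𝓡 4) x) x₀ ⟨x, J.toFun x⟩).2

theorem jc_apply {x₀ x : M} (hx : x ∈ (chartAt R4 x₀).source) (u : R4) :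
    jc J x₀ x u = (tanTriv x₀).continuousLinearMapAt ℝ x (J.toFun x ((tanTriv x₀).symm x u)) := by
  rw [jc, hom_trivializationAt_apply]
  have hb : x ∈ (tanTriv x₀).baseSet := by rwa [tanTriv_baseSet]
  rw [ContinuousLinearMap.inCoordinates_eq hb hb]
  simp only [ContinuousLinearMap.comp_apply, ContinuousLinearEquiv.coe_coe]
  have h1 : ((tanTriv x₀).continuousLinearEquivAt ℝ x hb).symm u = (tanTriv x₀).symm x u := rfl
  have h2 : ∀ v, (tanTriv x₀).continuousLinearEquivAt ℝ x hb v =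
      (tanTriv x₀).continuousLinearMapAt ℝ x v := fun v => by
    rw [Trivialization.continuousLinearMapAt_apply, Trivialization.coe_linearMapAt_of_mem _ hb]; rfl
  rw [h1, h2]

theorem tanTriv_symm_jc {x₀ x : M} (hx : x ∈ (chartAt R4 x₀).source) (u : R4) :
    (tanTriv x₀).symm x (jc J x₀ x u) = J.toFun x ((tanTriv x₀).symm x u) := by
  rw [jc_apply J hx, tanTriv_symm_map x₀ hx]

theorem jc_sq {x₀ x : M} (hx : x ∈ (chartAt R4 x₀).source) (u : R4) :
    jc J x₀ x (jc J x₀ x u) = -u := by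
  rw [jc_apply J hx, tanTriv_symm_jc J hx, J.sq_eq_neg, map_neg]
  have hb : x ∈ (tanTriv x₀).baseSet := by rwa [tanTriv_baseSet]
  rw [← (tanTriv x₀).symmL_apply (R := ℝ) hb, (tanTriv x₀).continuousLinearMapAt_symmL (R := ℝ) hb]

theorem continuousOn_jc (x₀ : M) : ContinuousOn (jc J x₀) (chartAt R4 x₀).source := by
  refine continuous_snd.comp_continuousOn ((trivializationAt (R4 →L[ℝ] R4)
    (fun x : M => TangentSpace (𝓡 4) x →L[ℝ] TangentSpace (𝓡 4) x) x₀).continuousOn.comp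
    J.smooth.continuous.continuousOn fun x hx => ?_)
  rw [Trivialization.mem_source, hom_trivializationAt_baseSet]
  exact ⟨hx, hx⟩

theorem bc_comp_J {x₀ x : M} (hx : x ∈ (chartAt R4 x₀).source) (β : BilinFiber M x) :
    bc x₀ ⟨x, β.comp (J.toFun x)⟩ = (bc x₀ ⟨x, β⟩).comp (jc J x₀ x) := by
  ext u v
  simp only [bc_apply hx, ContinuousLinearMap.comp_apply, tanTriv_symm_jc J hx]

theorem isAntiInvariant_iff {x₀ x : M} (hx : x ∈ (chartAt R4 x₀).source) (β : BilinFiber M x) :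
    J.IsAntiInvariant x β ↔ AntiInv (jc J x₀ x) (bc x₀ ⟨x, β⟩) := by
  have h : ∀ v : TangentSpace (𝓡 4) x, ∃ u : R4, (tanTriv x₀).symm x u = v := fun v =>
    ⟨_, tanTriv_symm_map x₀ hx v⟩
  simp only [AlmostComplexStructure.IsAntiInvariant, AntiInv, bc_apply hx, tanTriv_symm_jc J hx]
  constructor
  · exact fun hh => ⟨fun u v => hh.1 _ _, fun u v => hh.2 _ _⟩
  · refine fun hh => ⟨fun u v => ?_, fun u v => ?_⟩ <;> obtain ⟨u, rfl⟩ := h u <;>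
      obtain ⟨v, rfl⟩ := h v
    · exact hh.1 u v
    · exact hh.2 u v

theorem isAntiInvariant_bcInv {x₀ x : M} (hx : x ∈ (chartAt R4 x₀).source) {B : Bil}
    (hB : AntiInv (jc J x₀ x) B) : J.IsAntiInvariant x (bcInv x₀ x B) := by
  rwa [isAntiInvariant_iff J hx, bc_bcInv hx]

theorem IsAntiInvariant.comp_J {x : M} {β : BilinFiber M x} (h : J.IsAntiInvariant x β) :
    J.IsAntiInvariant x (β.comp (J.toFun x)) := by
  have hx := mem_chart_source R4 x
  rw [isAntiInvariant_iff J hx] at h ⊢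
  rw [bc_comp_J J hx]
  exact h.comp_J (jc_sq J hx)

theorem IsAntiInvariant.add_smul {x : M} {β β' : BilinFiber M x} (h : J.IsAntiInvariant x β)
    (h' : J.IsAntiInvariant x β') (a b : ℝ) : J.IsAntiInvariant x (a • β + b • β') := by
  have hx := mem_chart_source R4 x
  rw [isAntiInvariant_iff J hx] at h h' ⊢
  rw [bc_add_smul hx]
  exact h.add_smul h' a b

theorem IsAntiInvariant.exists_eq {x : M} {β β' : BilinFiber M x} (h : J.IsAntiInvariant x β)
    (h0 : β ≠ 0) (h' : J.IsAntiInvariant x β') :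
    ∃ a b : ℝ, β' = a • β + b • β.comp (J.toFun x) := by
  have hx := mem_chart_source R4 x
  rw [isAntiInvariant_iff J hx] at h h'
  obtain ⟨a, b, hab⟩ := h.exists_eq (jc_sq J hx) (fun h => h0 ((bc_eq_zero_iff hx β).1 h)) h'
  refine ⟨a, b, ?_⟩
  rw [← bcInv_bc hx β', hab, ← bc_comp_J J hx, ← bc_add_smul hx, bcInv_bc hx]

theorem exists_isAntiInvariant_ne_zero (x : M) :
    ∃ β : BilinFiber M x, J.IsAntiInvariant x β ∧ β ≠ 0 := by
  have hx := mem_chart_source R4 x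
  obtain ⟨e, f, B, hB⟩ := exists_evalPair_ne_zero (jc_sq J hx)
  refine ⟨bcInv x x (antiInvProj (jc J x x) B),
    isAntiInvariant_bcInv J hx (antiInv_antiInvProj (jc_sq J hx) B), fun h => hB ?_⟩
  rw [← bc_eq_zero_iff hx, bc_bcInv hx] at h
  simp [h, evalPair]

/-- The component of the embedding of `Λ_J⁻` into a trivial bundle given by a chart and a pair
of constant vectors in it. -/
noncomputable def chartComponent (x₀ : M) (e f : R4) (p : BilinBundle M) : ℂ :=
  evalPair (jc J x₀ p.proj) e f (bc x₀ p)

theorem continuousOn_chartComponent (x₀ : M) (e f : R4) :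
    ContinuousOn (chartComponent J x₀ e f) {p | p.proj ∈ (chartAt R4 x₀).source} := by
  have h1 := continuousOn_bc x₀
  have h2 : ContinuousOn (fun p : BilinBundle M => jc J x₀ p.proj)
      {p | p.proj ∈ (chartAt R4 x₀).source} :=
    (continuousOn_jc J x₀).comp (FiberBundle.continuous_proj _ _).continuousOn fun p hp => hp
  unfold chartComponent evalPair
  refine ContinuousOn.sub ?_ (ContinuousOn.mul ?_ continuousOn_const)
  · exact Complex.continuous_ofReal.comp_continuousOn
      ((h1.clm_apply continuousOn_const).clm_apply continuousOn_const)
  · exact Complex.continuous_ofReal.comp_continuousOn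
      ((h1.clm_apply (h2.clm_apply continuousOn_const)).clm_apply continuousOn_const)

theorem continuousOn_antiInvProj {X : Type*} [TopologicalSpace X] {s : Set X}
    {𝒥 : X → R4 →L[ℝ] R4} (h : ContinuousOn 𝒥 s) (B : Bil) :
    ContinuousOn (fun x => antiInvProj (𝒥 x) B) s := by
  rw [continuousOn_clm_apply]
  intro u
  rw [continuousOn_clm_apply]
  intro v
  simp only [antiInvProj_apply]
  have hu : ContinuousOn (fun x => 𝒥 x u) s := h.clm_apply continuousOn_const
  have hv : ContinuousOn (fun x => 𝒥 x v) s := h.clm_apply continuousOn_const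
  have h1 : ContinuousOn (fun x => B (𝒥 x u) (𝒥 x v)) s :=
    (B.continuous.comp_continuousOn hu).clm_apply hv
  have h2 : ContinuousOn (fun x => B (𝒥 x v) (𝒥 x u)) s :=
    (B.continuous.comp_continuousOn hv).clm_apply hu
  exact ((continuousOn_const.sub h1).add h2).div_const 4

end Coordinates

/-! ### Orthogonal projections onto complex lines. -/

section LineProj

variable {V : Type*} [NormedAddCommGroup V] [InnerProductSpace ℂ V]

/-- The orthogonal projection onto the line spanned by `v`. -/
noncomputable def lineProj (v : V) : V →L[ℂ] V :=
  ((‖v‖ ^ 2 : ℝ) : ℂ)⁻¹ • (innerSL ℂ v).smulRight v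

theorem lineProj_apply (v w : V) : lineProj v w = (((‖v‖ ^ 2 : ℝ) : ℂ)⁻¹ * inner ℂ v w) • v := by
  simp [lineProj, smul_smul]

theorem lineProj_self {v : V} (hv : v ≠ 0) : lineProj v v = v := by
  have h : inner ℂ v v = ((‖v‖ ^ 2 : ℝ) : ℂ) := by rw [inner_self_eq_norm_sq_to_K]; push_cast; rfl
  rw [lineProj_apply, h, inv_mul_cancel₀, one_smul]
  simpa using hv

theorem isLineProj_lineProj {v : V} (hv : v ≠ 0) : IsLineProj (lineProj v) :=
  ⟨v, hv, lineProj_self hv, fun w => ⟨_, lineProj_apply v w⟩⟩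

/-- Since only the line matters, the projections of `exists_bundleEmbedding` can be defined from an
arbitrary choice of vectors and are still continuous. -/
theorem lineProj_smul {c : ℂ} (hc : c ≠ 0) (v : V) : lineProj (c • v) = lineProj v := by
  ext w
  rw [lineProj_apply, lineProj_apply, inner_smul_left, norm_smul, smul_smul]
  congr 1
  rcases eq_or_ne v 0 with rfl | hv
  · simp
  · have h1 : ((‖v‖ : ℝ) : ℂ) ≠ 0 := by simpa using hv
    have h2 : ((‖c‖ : ℝ) : ℂ) ≠ 0 := by simpa using hc
    have h3 : (starRingEnd ℂ) c * c = ((‖c‖ : ℝ) : ℂ) ^ 2 := by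
      rw [mul_comm, Complex.mul_conj, Complex.normSq_eq_norm_sq]; push_cast; ring
    push_cast
    rw [mul_pow, mul_inv]
    calc _ = ((‖c‖ : ℂ) ^ 2)⁻¹ * ((starRingEnd ℂ) c * c) * (((‖v‖ : ℂ) ^ 2)⁻¹ * inner ℂ v w) := by ring
      _ = _ := by rw [h3, inv_mul_cancel₀ (pow_ne_zero 2 h2), one_mul]

theorem continuousAt_lineProj {v : V} (hv : v ≠ 0) : ContinuousAt (lineProj : V → V →L[ℂ] V) v := by
  change ContinuousAt (fun v : V => ((‖v‖ ^ 2 : ℝ) : ℂ)⁻¹ • (innerSL ℂ v).smulRight v) v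
  refine ContinuousAt.smul (ContinuousAt.inv₀ (f := fun v : V => ((‖v‖ ^ 2 : ℝ) : ℂ)) ?_ ?_) ?_
  · exact (Complex.continuous_ofReal.comp (continuous_norm.pow 2)).continuousAt
  · simpa using hv
  · have h1 : Continuous fun v : V => (innerSL ℂ v : V →L[ℂ] ℂ) := (innerSL ℂ).continuous
    have h2 : Continuous fun v : V => ContinuousLinearMap.smulRightL ℂ V V (innerSL ℂ v) v :=
      ((ContinuousLinearMap.smulRightL ℂ V V).continuous.comp h1).clm_apply continuous_id
    exact h2.continuousAt

end LineProj

/-! ### The embedding of `Λ_J⁻` into a trivial bundle. -/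

section BundleEmbedding

variable {M : Type*} [TopologicalSpace M] [ChartedSpace R4 M] [IsManifold (𝓡 4) ∞ M]

/-- A continuous embedding of the complex line bundle `Λ_J⁻` into a trivial bundle,
together with the projections onto the fibres. -/
structure BundleEmbedding (J : AlmostComplexStructure M) (V : Type*) [NormedAddCommGroup V]
    [NormedSpace ℂ V] where
  /-- The embedding. -/
  E : BilinBundle M → V
  /-- The projections. -/
  P : M → V →L[ℂ] V
  continuous_E : Continuous E
  continuous_P : Continuous P
  isLineProj : ∀ x, IsLineProj (P x)
  map_add_smul : ∀ (x : M) (β β' : BilinFiber M x) (a b : ℝ),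
    E ⟨x, a • β + b • β'⟩ = (a : ℂ) • E ⟨x, β⟩ + (b : ℂ) • E ⟨x, β'⟩
  map_J : ∀ (x : M) (β : BilinFiber M x), E ⟨x, β.comp (J.toFun x)⟩ = Complex.I • E ⟨x, β⟩
  P_E : ∀ (x : M) (β : BilinFiber M x), J.IsAntiInvariant x β → P x (E ⟨x, β⟩) = E ⟨x, β⟩
  eq_zero : ∀ (x : M) (β : BilinFiber M x), J.IsAntiInvariant x β → E ⟨x, β⟩ = 0 → β = 0

variable (J : AlmostComplexStructure M)

/-- A constant bilinear form in the chart is projected onto the anti-invariant forms of the varying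
structure. The result depends continuously on the point, so it stays nonzero near `x₀`. -/
theorem exists_local_section (x₀ : M) :
    ∃ (U : Set M) (β : ∀ x : M, BilinFiber M x), IsOpen U ∧ x₀ ∈ U ∧ U ⊆ (chartAt R4 x₀).source ∧
      ContinuousOn (fun x => (⟨x, β x⟩ : BilinBundle M)) U ∧
      ∀ x ∈ U, J.IsAntiInvariant x (β x) ∧ β x ≠ 0 := by
  have hx := mem_chart_source R4 x₀
  obtain ⟨e, f, B, hB⟩ := exists_evalPair_ne_zero (jc_sq J hx)
  have hc := continuousOn_antiInvProj (continuousOn_jc J x₀) B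
  have hne : antiInvProj (jc J x₀ x₀) B ≠ 0 := fun h => hB (by simp [h, evalPair])
  refine ⟨(chartAt R4 x₀).source ∩ (fun x => antiInvProj (jc J x₀ x) B) ⁻¹' {0}ᶜ,
    fun x => bcInv x₀ x (antiInvProj (jc J x₀ x) B),
    hc.isOpen_inter_preimage (chartAt R4 x₀).open_source isOpen_compl_singleton, ⟨hx, hne⟩,
    inter_subset_left, ?_, fun x hx => ⟨isAntiInvariant_bcInv J hx.1
      (antiInv_antiInvProj (jc_sq J hx.1) B), fun h => hx.2 ?_⟩⟩
  · exact (continuousOn_mk_bcInv x₀).comp (continuousOn_id.prodMk (hc.mono inter_subset_left))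
      fun x hx => ⟨hx.1, trivial⟩
  · rwa [← bc_eq_zero_iff hx.1, bc_bcInv hx.1] at h

theorem chartComponent_ne_zero {x₀ x : M} (hx : x ∈ (chartAt R4 x₀).source) {e f : R4} {B : Bil}
    (hB : evalPair (jc J x₀ x) e f (antiInvProj (jc J x₀ x) B) ≠ 0) {β : BilinFiber M x}
    (hβ : J.IsAntiInvariant x β) (h0 : β ≠ 0) : chartComponent J x₀ e f ⟨x, β⟩ ≠ 0 :=
  AntiInv.evalPair_ne_zero (jc_sq J hx) (antiInv_antiInvProj (jc_sq J hx) B) hB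
    ((isAntiInvariant_iff J hx β).1 hβ) fun h => h0 ((bc_eq_zero_iff hx β).1 h)

theorem chartComponent_add_smul {x₀ x : M} (hx : x ∈ (chartAt R4 x₀).source) (e f : R4)
    (β β' : BilinFiber M x) (a b : ℝ) : chartComponent J x₀ e f ⟨x, a • β + b • β'⟩ =
      a * chartComponent J x₀ e f ⟨x, β⟩ + b * chartComponent J x₀ e f ⟨x, β'⟩ := by
  simp only [chartComponent]
  rw [bc_add_smul hx, evalPair_add_smul]

theorem chartComponent_comp_J {x₀ x : M} (hx : x ∈ (chartAt R4 x₀).source) (e f : R4)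
    (β : BilinFiber M x) : chartComponent J x₀ e f ⟨x, β.comp (J.toFun x)⟩ =
      Complex.I * chartComponent J x₀ e f ⟨x, β⟩ := by
  simp only [chartComponent]
  rw [bc_comp_J J hx, evalPair_comp_J (jc_sq J hx)]

/-- Finitely many functionals `evalPair` in charts, multiplied by bump functions, are the components
of the embedding. They are complex linear on the fibres, and at every point one of them is injective
on the anti-invariant forms. -/
theorem exists_bundleEmbedding [T2Space M] [CompactSpace M] :
    ∃ n : ℕ, Nonempty (BundleEmbedding J (EuclideanSpace ℂ (Fin n))) := by
  classical
  choose e f B hB using fun x₀ : M => exists_evalPair_ne_zero (jc_sq J (mem_chart_source R4 x₀))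
  let ρ : ∀ x₀ : M, SmoothBumpFunction (𝓡 4) x₀ := fun x₀ => Classical.arbitrary _
  have hρsupp : ∀ x₀ x, ρ x₀ x ≠ 0 → x ∈ (chartAt R4 x₀).source := fun x₀ x hx =>
    (ρ x₀).tsupport_subset_chartAt_source (subset_closure hx)
  -- Where the bump function is nonzero and the pair `e x₀`, `f x₀` still detects anti-invariant
  -- forms.
  let N : M → Set M := fun x₀ => {x | ρ x₀ x ≠ 0 ∧
    evalPair (jc J x₀ x) (e x₀) (f x₀) (antiInvProj (jc J x₀ x) (B x₀)) ≠ 0}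
  have hN : ∀ x₀, N x₀ ∈ 𝓝 x₀ := fun x₀ => by
    have hs : (chartAt R4 x₀).source ∈ 𝓝 x₀ := chart_source_mem_nhds R4 x₀
    have h1 : ContinuousAt (ρ x₀) x₀ := (ρ x₀).continuous.continuousAt
    have hj := (continuousOn_jc J x₀).continuousAt hs
    have hp := (continuousOn_antiInvProj (continuousOn_jc J x₀) (B x₀)).continuousAt hs
    have h2 : ContinuousAt (fun x =>
        evalPair (jc J x₀ x) (e x₀) (f x₀) (antiInvProj (jc J x₀ x) (B x₀))) x₀ := by
      unfold evalPair
      exact (Complex.continuous_ofReal.continuousAt.comp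
        ((hp.clm_apply continuousAt_const).clm_apply continuousAt_const)).sub
        ((Complex.continuous_ofReal.continuousAt.comp
        ((hp.clm_apply (hj.clm_apply continuousAt_const)).clm_apply continuousAt_const)).mul
          continuousAt_const)
    exact (h1.eventually_ne (by rw [(ρ x₀).eq_one]; exact one_ne_zero)).and (h2.eventually_ne (hB x₀))
  obtain ⟨t, -, ht⟩ := isCompact_univ.elim_nhds_subcover N fun x _ => hN x
  let c : Fin t.card → M := fun i => (t.equivFin.symm i : M)
  have hcov : ∀ x, ∃ i, x ∈ N (c i) := fun x => by
    obtain ⟨x₀, hx₀, hx⟩ := mem_iUnion₂.1 (ht (mem_univ x))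
    exact ⟨t.equivFin ⟨x₀, hx₀⟩, by simpa [c] using hx⟩
  let g : Fin t.card → BilinBundle M → ℂ := fun i p =>
    (ρ (c i) p.proj : ℂ) * chartComponent J (c i) (e (c i)) (f (c i)) p
  have hg : ∀ i, Continuous (g i) := fun i => by
    refine continuous_iff_continuousAt.2 fun p => ?_
    have hπ : Continuous fun p : BilinBundle M => p.proj := FiberBundle.continuous_proj _ _
    by_cases hp : p.proj ∈ (chartAt R4 (c i)).source
    · refine ContinuousAt.mul ?_ ?_
      · exact (Complex.continuous_ofReal.comp ((ρ (c i)).continuous.comp hπ)).continuousAt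
      · exact (continuousOn_chartComponent J _ _ _).continuousAt
          (((chartAt R4 (c i)).open_source.preimage hπ).mem_nhds hp)
    · have h1 : p.proj ∉ tsupport (ρ (c i)) := fun h =>
        hp ((ρ (c i)).tsupport_subset_chartAt_source h)
      have h2 : ∀ᶠ q : BilinBundle M in 𝓝 p, g i q = 0 := by
        filter_upwards [hπ.continuousAt ((isClosed_tsupport _).isOpen_compl.mem_nhds h1)] with q hq
        have : ρ (c i) q.proj = 0 := image_eq_zero_of_notMem_tsupport hq
        simp [g, this]
      exact (continuousAt_const (y := (0 : ℂ))).congr (h2.mono fun q hq => hq.symm)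
  let E : BilinBundle M → EuclideanSpace ℂ (Fin t.card) := fun p => WithLp.toLp 2 fun i => g i p
  have hE : Continuous E := (PiLp.continuous_toLp 2 _).comp (continuous_pi hg)
  have hadd : ∀ (x : M) (β β' : BilinFiber M x) (a b : ℝ),
      E ⟨x, a • β + b • β'⟩ = (a : ℂ) • E ⟨x, β⟩ + (b : ℂ) • E ⟨x, β'⟩ := fun x β β' a b => by
    ext i
    change g i _ = a * g i _ + b * g i _
    by_cases h : ρ (c i) x = 0
    · simp [g, h]
    · simp only [g]; rw [chartComponent_add_smul J (hρsupp _ _ h)]; ring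
  have hJ : ∀ (x : M) (β : BilinFiber M x),
      E ⟨x, β.comp (J.toFun x)⟩ = Complex.I • E ⟨x, β⟩ := fun x β => by
    ext i
    change g i _ = Complex.I * g i _
    by_cases h : ρ (c i) x = 0
    · simp [g, h]
    · simp only [g]; rw [chartComponent_comp_J J (hρsupp _ _ h)]; ring
  have hzero : ∀ (x : M) (β : BilinFiber M x), J.IsAntiInvariant x β → E ⟨x, β⟩ = 0 → β = 0 := by
    intro x β hβ h0
    by_contra hne
    obtain ⟨i, hi⟩ := hcov x
    have h1 : g i ⟨x, β⟩ = 0 := congrArg (fun v : EuclideanSpace ℂ (Fin t.card) => v i) h0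
    exact mul_ne_zero (by exact_mod_cast hi.1)
      (chartComponent_ne_zero J (hρsupp _ _ hi.1) hi.2 hβ hne) h1
  -- An arbitrary, possibly discontinuous, nonzero form in each fibre; it only serves to name the
  -- image line.
  choose b hb hb0 using exists_isAntiInvariant_ne_zero J
  have hbE : ∀ x, E ⟨x, b x⟩ ≠ 0 := fun x h => hb0 x (hzero x _ (hb x) h)
  have hline : ∀ (x : M) (β β' : BilinFiber M x), J.IsAntiInvariant x β → β ≠ 0 →
      J.IsAntiInvariant x β' → ∃ z : ℂ, E ⟨x, β'⟩ = z • E ⟨x, β⟩ := by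
    intro x β β' hβ h0 hβ'
    obtain ⟨r, s, rfl⟩ := IsAntiInvariant.exists_eq J hβ h0 hβ'
    refine ⟨r + s * Complex.I, ?_⟩
    rw [hadd, hJ, smul_smul, ← add_smul]
  have hP : ∀ (x : M) (β : BilinFiber M x), J.IsAntiInvariant x β → β ≠ 0 →
      lineProj (E ⟨x, b x⟩) = lineProj (E ⟨x, β⟩) := by
    intro x β hβ h0
    obtain ⟨z, hz⟩ := hline x _ _ hβ h0 (hb x)
    rw [hz, lineProj_smul]
    rintro rfl
    exact hbE x (by simpa using hz)
  refine ⟨t.card, ⟨{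
    E := E
    P := fun x => lineProj (E ⟨x, b x⟩)
    continuous_E := hE
    continuous_P := continuous_iff_continuousAt.2 fun x₀ => ?_
    isLineProj := fun x => isLineProj_lineProj (hbE x)
    map_add_smul := hadd
    map_J := hJ
    P_E := fun x β hβ => ?_
    eq_zero := hzero }⟩⟩
  -- Near `x₀` the line is also spanned by the image of a continuous local section, which shows
  -- continuity of the projection.
  · obtain ⟨U, β, hU, hx₀, -, hc, hβ⟩ := exists_local_section J x₀
    have h1 : ContinuousAt (fun x => lineProj (E ⟨x, β x⟩)) x₀ := by
      refine ContinuousAt.comp (g := lineProj) (continuousAt_lineProj fun h =>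
        (hβ x₀ hx₀).2 (hzero x₀ _ (hβ x₀ hx₀).1 h)) ?_
      exact hE.continuousAt.comp (hc.continuousAt (hU.mem_nhds hx₀))
    refine h1.congr ?_
    filter_upwards [hU.mem_nhds hx₀] with x hx
    exact (hP x _ (hβ x hx).1 (hβ x hx).2).symm
  · rcases eq_or_ne β 0 with rfl | h0
    · have : E ⟨x, (0 : BilinFiber M x)⟩ = 0 := by
        ext i
        change g i _ = 0
        by_cases h : ρ (c i) x = 0
        · simp [g, h]
        · simp [g, chartComponent, bc_zero (hρsupp _ _ h), evalPair]
      rw [this, map_zero]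
    · rw [hP x β hβ h0, lineProj_self fun h => h0 (hzero x β hβ h)]

end BundleEmbedding

/-! ### Derivatives of maps of the disk -/

theorem eventually_coe_toDisk (z : Disk) : ∀ᶠ w in 𝓝 (z : ℂ), ((toDisk w : Disk) : ℂ) = w := by
  have : Metric.ball (0 : ℂ) 1 ∈ 𝓝 (z : ℂ) :=
    Metric.isOpen_ball.mem_nhds (by simpa using norm_coe_lt z)
  filter_upwards [this] with w hw using coe_toDisk (by simpa using hw)

theorem continuousAt_toDisk (z : Disk) : ContinuousAt toDisk (z : ℂ) :=
  continuousOn_toDisk.continuousAt (Metric.isOpen_ball.mem_nhds (by simpa using norm_coe_lt z))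

theorem extChartAt_symm_eventuallyEq_toDisk (z : Disk) :
    ((extChartAt 𝓘(ℝ, ℂ) z).symm : ℂ → Disk) =ᶠ[𝓝 (z : ℂ)] toDisk := by
  have h := TopologicalSpace.Opens.chartAt_subtype_val_symm_eventuallyEq (H := ℂ) unitDisk (x := z)
  simp only [chartAt_self_eq, OpenPartialHomeomorph.refl_symm] at h
  have h' : ∀ᶠ w in 𝓝 (z : ℂ), w = (((chartAt ℂ z).symm w : Disk) : ℂ) := h
  filter_upwards [h'] with w hw
  have e : (extChartAt 𝓘(ℝ, ℂ) z).symm w = (chartAt ℂ z).symm w := by simp [extChartAt]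
  rw [e]
  conv_rhs => rw [hw]
  rw [toDisk_coe]

section

variable {F : Type*} [NormedAddCommGroup F] [NormedSpace ℝ F]

theorem contMDiffAt_iff_toDisk {g : Disk → F} {z : Disk} :
    ContMDiffAt 𝓘(ℝ, ℂ) 𝓘(ℝ, F) ∞ g z ↔ ContDiffAt ℝ ∞ (fun w => g (toDisk w)) (z : ℂ) := by
  rw [← contMDiffAt_iff_contDiffAt]
  have := contMDiffAt_subtype_iff (I := 𝓘(ℝ, ℂ)) (I' := 𝓘(ℝ, F)) (n := ∞) (U := unitDisk)
    (f := fun w => g (toDisk w)) (x := z)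
  simpa using this

theorem mfderiv_eq_fderiv_toDisk {g : Disk → F} {z : Disk}
    (hg : MDifferentiableAt 𝓘(ℝ, ℂ) 𝓘(ℝ, F) g z) :
    mfderiv 𝓘(ℝ, ℂ) 𝓘(ℝ, F) g z = fderiv ℝ (fun w => g (toDisk w)) (z : ℂ) := by
  refine hg.mfderiv.trans ?_
  simp only [writtenInExtChartAt, modelWithCornersSelf_coe, range_id, fderivWithin_univ,
    extChartAt_model_space_eq_id, PartialEquiv.refl_coe, Function.id_comp]
  have : (extChartAt 𝓘(ℝ, ℂ) z) z = (z : ℂ) := by simp [extChartAt]; rfl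
  rw [this]
  exact ((extChartAt_symm_eventuallyEq_toDisk z).fun_comp g).fderiv_eq

end

/-- Continuity of `Φ` suffices because `B` vanishes at `z`: the variation of `Φ` contributes `o(1) ·
O(w - z)`. The coordinates given by the embedding are only known to be continuous. -/
theorem hasFDerivAt_clm_apply_of_eq_zero {E F G : Type*} [NormedAddCommGroup E] [NormedSpace ℝ E]
    [NormedAddCommGroup F] [NormedSpace ℝ F] [NormedAddCommGroup G] [NormedSpace ℝ G]
    {Φ : E → F →L[ℝ] G} {B : E → F} {L : E →L[ℝ] F} {z : E} (hΦ : ContinuousAt Φ z)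
    (hB : HasFDerivAt B L z) (h0 : B z = 0) :
    HasFDerivAt (fun w => Φ w (B w)) ((Φ z).comp L) z := by
  have h1 : HasFDerivAt (fun w => Φ z (B w)) ((Φ z).comp L) z := (Φ z).hasFDerivAt.comp z hB
  have h2 : HasFDerivAt (fun w => (Φ w - Φ z) (B w)) (0 : E →L[ℝ] G) z := by
    refine .of_isLittleO ?_
    simp only [h0, map_zero, sub_zero, zero_apply]
    have hO : B =O[𝓝 z] fun w => w - z := by
      have := hB.isBigO_sub
      simpa [h0] using this
    have ho : (fun w => Φ w - Φ z) =o[𝓝 z] fun _ => (1 : ℝ) := by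
      rw [Asymptotics.isLittleO_one_iff]
      exact tendsto_sub_nhds_zero_iff.2 hΦ
    have h3 : (fun w => (Φ w - Φ z) (B w)) =O[𝓝 z] fun w => ‖Φ w - Φ z‖ * ‖B w‖ :=
      Asymptotics.IsBigO.of_bound 1 (.of_forall fun w => by
        rw [one_mul, Real.norm_of_nonneg (by positivity)]; exact (Φ w - Φ z).le_opNorm _)
    have h4 := ho.norm_left.mul_isBigO hO.norm_left.norm_right
    simp only [one_mul] at h4
    exact (h3.trans_isLittleO h4).of_norm_right
  have := h1.add h2
  simp only [add_zero] at this
  refine this.congr_of_eventuallyEq (.of_forall fun w => ?_)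
  simp

/-! ### Transverse intersections as zeros of complex functions. -/

section Transverse

variable {M : Type*} [TopologicalSpace M] [ChartedSpace R4 M] [IsManifold (𝓡 4) ∞ M]
  {J : AlmostComplexStructure M} {V : Type*} [NormedAddCommGroup V] [NormedSpace ℂ V]

namespace BundleEmbedding

variable (𝓔 : BundleEmbedding J V)

theorem map_zero (x : M) : 𝓔.E ⟨x, (0 : BilinFiber M x)⟩ = 0 := by
  have h := 𝓔.map_J x 0
  rw [ContinuousLinearMap.zero_comp] at h
  have h1 : (1 - Complex.I) • 𝓔.E ⟨x, (0 : BilinFiber M x)⟩ = 0 := by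
    rw [sub_smul, one_smul, ← h, sub_self]
  refine (smul_eq_zero.1 h1).resolve_left fun h => ?_
  have := congrArg Complex.re h
  simp at this

/-- The complex line field and the section on the total space of `Λ_J⁻`. -/
noncomputable def lineSection : LineSection J.AntiInvBundle V where
  P y := 𝓔.P y.1.proj
  E y := 𝓔.E y.1
  continuous_P := 𝓔.continuous_P.comp
    ((FiberBundle.continuous_proj Bil (BilinFiber M)).comp continuous_subtype_val)
  continuous_E := 𝓔.continuous_E.comp continuous_subtype_val
  isLineProj _ := 𝓔.isLineProj _
  P_E y := 𝓔.P_E _ _ y.2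

theorem lineSection_E_eq_zero_iff (y : J.AntiInvBundle) :
    𝓔.lineSection.E y = 0 ↔ y ∈ J.zeroSection := by
  constructor
  · exact fun h => 𝓔.eq_zero _ _ y.2 h
  · intro h
    have h' : y.1.snd = 0 := h
    change 𝓔.E ⟨y.1.proj, y.1.snd⟩ = 0
    rw [h']; exact 𝓔.map_zero _

theorem bcInv_add_smul {x₀ x : M} (hx : x ∈ (chartAt R4 x₀).source) (B B' : Bil) (a b : ℝ) :
    bcInv x₀ x (a • B + b • B') = a • bcInv x₀ x B + b • bcInv x₀ x B' := by
  rw [← bcInv_bc hx (a • bcInv x₀ x B + b • bcInv x₀ x B'), bc_add_smul hx, bc_bcInv hx, bc_bcInv hx]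

/-- A functional on the ambient space, as a functional on bilinear forms in a chart. -/
noncomputable def coordFunctional (lam : V →L[ℂ] ℂ) (x₀ x : M) : Bil →L[ℝ] ℂ := by
  classical
  exact if hx : x ∈ (chartAt R4 x₀).source then LinearMap.toContinuousLinearMap
    { toFun := fun B => lam (𝓔.E ⟨x, bcInv x₀ x B⟩)
      map_add' := fun B B' => by
        have := bcInv_add_smul hx B B' 1 1
        rw [one_smul, one_smul] at this
        rw [this, 𝓔.map_add_smul]; simp
      map_smul' := fun a B => by
        have := bcInv_add_smul hx B 0 a 0
        rw [zero_smul, add_zero] at this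
        rw [this, 𝓔.map_add_smul]; simp }
  else 0

theorem coordFunctional_apply (lam : V →L[ℂ] ℂ) {x₀ x : M} (hx : x ∈ (chartAt R4 x₀).source)
    (B : Bil) : 𝓔.coordFunctional lam x₀ x B = lam (𝓔.E ⟨x, bcInv x₀ x B⟩) := by
  rw [coordFunctional, dif_pos hx]; rfl

theorem continuousOn_coordFunctional (lam : V →L[ℂ] ℂ) (x₀ : M) :
    ContinuousOn (𝓔.coordFunctional lam x₀) (chartAt R4 x₀).source := by
  rw [continuousOn_clm_apply]
  intro B
  have h : ContinuousOn (fun x => lam (𝓔.E ⟨x, bcInv x₀ x B⟩)) (chartAt R4 x₀).source :=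
    (lam.continuous.comp 𝓔.continuous_E).comp_continuousOn ((continuousOn_mk_bcInv x₀).comp
      (continuousOn_id.prodMk continuousOn_const) fun x hx => ⟨hx, trivial⟩)
  exact h.congr fun x hx => 𝓔.coordFunctional_apply lam hx B

theorem verticalDeriv_eq (s : C(Disk, J.AntiInvBundle)) (z : Disk)
    (h : MDifferentiableAt 𝓘(ℝ, ℂ) 𝓘(ℝ, Bil) (fun w : Disk => bc (s z).1.proj (s w).1) z) (v : ℂ) :
    J.verticalDeriv s z v = bcInv (s z).1.proj (s z).1.proj
      (fderiv ℝ (fun w => bc (s z).1.proj (s (toDisk w)).1) z v) := by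
  have e := congrArg (fun L : ℂ →L[ℝ] Bil => L v) (mfderiv_eq_fderiv_toDisk h)
  exact congrArg ((bilTriv (s z).1.proj).symm (s z).1.proj) e

/-- A real linear isomorphism onto the fibre of `Λ_J⁻`, read in a complex coordinate. -/
theorem exists_eq_mul_of_surjective {x : M} {T : ℂ → BilinFiber M x}
    (hT : ∀ (v w : ℂ) (a b : ℝ), T (a • v + b • w) = a • T v + b • T w)
    (hsurj : ∀ β, J.IsAntiInvariant x β → ∃ v, T v = β) {lam : V →L[ℂ] ℂ}
    (hlam : IsFrame (𝓔.P x) lam) {L : ℂ →L[ℝ] ℂ} (hL : ∀ v, L v = lam (𝓔.E ⟨x, T v⟩)) :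
    (∀ v, L v = 0 → v = 0) ∧ ∃ a b : ℝ, b ≠ 0 ∧ L Complex.I = (a + b * Complex.I) * L 1 ∧
      ((∃ a b : ℝ, 0 < b ∧ T Complex.I = a • T 1 + b • (T 1).comp (J.toFun x)) ↔ 0 < b) := by
  have hne : ∀ β : BilinFiber M x, J.IsAntiInvariant x β → lam (𝓔.E ⟨x, β⟩) = 0 → β = 0 :=
    fun β hβ h => 𝓔.eq_zero _ _ hβ (hlam _ (𝓔.P_E _ _ hβ) h)
  have hlamJ : ∀ (β : BilinFiber M x) (a b : ℝ),
      lam (𝓔.E ⟨x, a • β + b • β.comp (J.toFun x)⟩) = (a + b * Complex.I) * lam (𝓔.E ⟨x, β⟩) :=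
    fun β a b => by
      rw [𝓔.map_add_smul, 𝓔.map_J, map_add, map_smul, map_smul, map_smul]
      simp only [smul_eq_mul]; ring
  obtain ⟨β₀, hβ₀, hβ0⟩ := exists_isAntiInvariant_ne_zero J x
  have hβJ := IsAntiInvariant.comp_J J hβ₀
  obtain ⟨v₁, hv₁⟩ := hsurj β₀ hβ₀
  obtain ⟨v₂, hv₂⟩ := hsurj _ hβJ
  set c := lam (𝓔.E ⟨x, β₀⟩) with hc
  have hc0 : c ≠ 0 := fun h => hβ0 (hne _ hβ₀ h)
  have hL1 : ∀ p q : ℝ, L (p • v₁ + q • v₂) = (p + q * Complex.I) * c := fun p q => by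
    rw [hL, hT, hv₁, hv₂, hlamJ]
  -- Preimages of `β₀` and of `β₀(J·,·)` are a real basis of `ℂ`.
  have hspan : ∀ v : ℂ, ∃ p q : ℝ, v = p • v₁ + q • v₂ := by
    have hli : LinearIndependent ℝ ![v₁, v₂] := by
      rw [LinearIndependent.pair_iff]
      intro p q h
      have := hL1 p q
      rw [h, _root_.map_zero] at this
      have h2 := (mul_eq_zero.1 this.symm).resolve_right hc0
      exact ⟨by simpa using congrArg Complex.re h2, by simpa using congrArg Complex.im h2⟩
    have hsp := hli.span_eq_top_of_card_eq_finrank (by simp)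
    intro v
    have hv : v ∈ Submodule.span ℝ (range ![v₁, v₂]) := by rw [hsp]; trivial
    obtain ⟨p, hp⟩ := (Submodule.mem_span_range_iff_exists_fun ℝ).1 hv
    exact ⟨p 0, p 1, by rw [← hp]; simp⟩
  -- That `T` has anti-invariant values is not assumed; it follows from surjectivity by this count
  -- of dimensions.
  have hanti : ∀ v, J.IsAntiInvariant x (T v) := fun v => by
    obtain ⟨p, q, rfl⟩ := hspan v
    rw [hT, hv₁, hv₂]
    exact IsAntiInvariant.add_smul J hβ₀ hβJ p q
  have hinj : ∀ v, L v = 0 → v = 0 := fun v hv => by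
    obtain ⟨p, q, rfl⟩ := hspan v
    rw [hL1] at hv
    have h2 := (mul_eq_zero.1 hv).resolve_right hc0
    have hp : p = 0 := by simpa using congrArg Complex.re h2
    have hq : q = 0 := by simpa using congrArg Complex.im h2
    simp [hp, hq]
  have hL10 : L 1 ≠ 0 := fun h => one_ne_zero (hinj 1 h)
  have hV1 : T 1 ≠ 0 := fun h => hL10 (by
    rw [hL, h, 𝓔.map_zero, _root_.map_zero])
  obtain ⟨a, b, hab⟩ := IsAntiInvariant.exists_eq J (hanti 1) hV1 (hanti Complex.I)
  have hLI : L Complex.I = (a + b * Complex.I) * L 1 := by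
    rw [hL, hL, hab, hlamJ]
  refine ⟨hinj, a, b, fun hb => ?_, hLI, ?_, fun h => ⟨a, b, h, hab⟩⟩
  · have h1 : L (Complex.I - (a : ℂ)) = 0 := by
      have e : (Complex.I - (a : ℂ)) = Complex.I - a • (1 : ℂ) := by simp
      rw [e, map_sub, map_smul, hLI, hb]; simp
    have := congrArg Complex.im (hinj _ h1)
    simp at this
  · rintro ⟨a', b', hb', hab'⟩
    have h1 : L Complex.I = (a' + b' * Complex.I) * L 1 := by
      rw [hL, hL, hab', hlamJ]
    have h2 := mul_right_cancel₀ hL10 (hLI.symm.trans h1)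
    have h3 : b = b' := by simpa using congrArg Complex.im h2
    rwa [h3]

/-- The derivative of a complex coordinate at an intersection with the zero section. -/
theorem hasFDerivAt_frame_vec (lam : V →L[ℂ] ℂ) {s : C(Disk, J.AntiInvBundle)} {z : Disk} {x : M}
    (hx : (s z).1.proj = x) (hz : z ∈ J.intersectionSet s) {B' : ℂ →L[ℝ] Bil}
    (hB : HasFDerivAt (fun w => bc x (s (toDisk w)).1) B' z) :
    HasFDerivAt (fun w => lam (𝓔.lineSection.vec s w)) ((𝓔.coordFunctional lam x x).comp B') z := by
  have hxs : x ∈ (chartAt R4 x).source := mem_chart_source R4 x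
  have hB0 : bc x (s (toDisk z)).1 = 0 := by
    rw [toDisk_coe]
    have h0 : (s z).1.snd = 0 := hz
    have h1 : bc x ⟨(s z).1.proj, (s z).1.snd⟩ = 0 := by
      rw [h0]; exact bc_zero (by rwa [hx])
    exact h1
  have hcs : ContinuousAt (fun w => (s (toDisk w)).1.proj) (z : ℂ) :=
    ((FiberBundle.continuous_proj Bil (BilinFiber M)).comp
      (continuous_subtype_val.comp s.continuous)).continuousAt.comp (continuousAt_toDisk z)
  have hsrcz : (s (toDisk z)).1.proj ∈ (chartAt R4 x).source := by rw [toDisk_coe, hx]; exact hxs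
  have hsrc : ∀ᶠ w in 𝓝 (z : ℂ), (s (toDisk w)).1.proj ∈ (chartAt R4 x).source :=
    hcs ((chartAt R4 x).open_source.mem_nhds hsrcz)
  have hΦc : ContinuousAt (fun w => 𝓔.coordFunctional lam x (s (toDisk w)).1.proj) (z : ℂ) :=
    ContinuousAt.comp (g := 𝓔.coordFunctional lam x)
      ((𝓔.continuousOn_coordFunctional lam x).continuousAt
        ((chartAt R4 x).open_source.mem_nhds hsrcz)) hcs
  have h := hasFDerivAt_clm_apply_of_eq_zero hΦc hB hB0
  simp only [toDisk_coe, hx] at h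
  refine h.congr_of_eventuallyEq ?_
  filter_upwards [hsrc] with w hw
  rw [𝓔.coordFunctional_apply lam hw]
  have := bcInv_bc hw (s (toDisk w)).1.snd
  change lam (𝓔.E ⟨_, (s (toDisk w)).1.snd⟩) = _
  rw [← this]

theorem add_smul_of_eq_bcInv {x₀ x : M} (hx : x ∈ (chartAt R4 x₀).source)
    {T : ℂ → BilinFiber M x} {B' : ℂ →L[ℝ] Bil} (hT : ∀ v, T v = bcInv x₀ x (B' v))
    (v w : ℂ) (a b : ℝ) : T (a • v + b • w) = a • T v + b • T w := by
  rw [hT, hT, hT, map_add, map_smul, map_smul, bcInv_add_smul hx]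

theorem exists_hasFDerivAt_frame_vec (lam : V →L[ℂ] ℂ) {s : C(Disk, J.AntiInvBundle)} {z : Disk}
    (hz : z ∈ J.intersectionSet s)
    (hsm : ContMDiffAt 𝓘(ℝ, ℂ) ((𝓡 4).prod 𝓘(ℝ, Bil)) ∞ (fun w : Disk => (s w).1) z) :
    ∃ L : ℂ →L[ℝ] ℂ, HasFDerivAt (fun w => lam (𝓔.lineSection.vec s w)) L z ∧
      (∀ (v w : ℂ) (a b : ℝ), J.verticalDeriv s z (a • v + b • w) =
        a • J.verticalDeriv s z v + b • J.verticalDeriv s z w) ∧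
      ∀ v, L v = lam (𝓔.E ⟨(s z).1.proj, J.verticalDeriv s z v⟩) := by
  have hxs : (s z).1.proj ∈ (chartAt R4 (s z).1.proj).source := mem_chart_source R4 _
  have hbs : ContMDiffAt 𝓘(ℝ, ℂ) 𝓘(ℝ, Bil) ∞ (fun w : Disk => bc (s z).1.proj (s w).1) z :=
    (contMDiffAt_totalSpace.1 hsm).2
  have hV := verticalDeriv_eq s z (hbs.mdifferentiableAt (by simp))
  have hBd := ((contMDiffAt_iff_toDisk.1 hbs).differentiableAt (by simp)).hasFDerivAt
  refine ⟨_, 𝓔.hasFDerivAt_frame_vec lam rfl hz hBd, fun v w a b => ?_, fun v => ?_⟩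
  · exact add_smul_of_eq_bcInv hxs hV v w a b
  · rw [hV]
    exact 𝓔.coordFunctional_apply lam hxs _

/-- At a point of transverse intersection with the zero section, the local index is
the sign of the intersection. -/
theorem hasLocalIndex_of_transverse {s : C(Disk, J.AntiInvBundle)} (hs : J.IsTransverse s)
    {z : Disk} (hz : z ∈ J.intersectionSet s) {lam : V →L[ℂ] ℂ}
    (hlam : IsFrame (𝓔.lineSection.P (s z)) lam) :
    HasLocalIndex (fun w => lam (𝓔.lineSection.vec s w)) z (J.intersectionSign s z) ∧
      ∀ᶠ w in 𝓝[≠] z, w ∉ J.intersectionSet s := by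
  obtain ⟨L, hfd, hVlin, hLv⟩ := 𝓔.exists_hasFDerivAt_frame_vec lam hz (hs z hz).1.self_of_nhds
  obtain ⟨hinj, a, b, hb, hLI, hsign⟩ := 𝓔.exists_eq_mul_of_surjective (T := J.verticalDeriv s z)
    hVlin (hs z hz).2 hlam hLv
  have him : (a + b * Complex.I : ℂ).im = b := by simp
  have hf0 : lam (𝓔.lineSection.vec s z) = 0 := by
    rw [LineSection.vec, toDisk_coe, (𝓔.lineSection_E_eq_zero_iff (s z)).2 hz, _root_.map_zero]
  refine ⟨?_, ?_⟩
  · have hfc : ∀ᶠ w in 𝓝 (z : ℂ), ContinuousAt (fun w => lam (𝓔.lineSection.vec s w)) w := by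
      have : Metric.ball (0 : ℂ) 1 ∈ 𝓝 (z : ℂ) :=
        Metric.isOpen_ball.mem_nhds (by simpa using norm_coe_lt z)
      filter_upwards [this] with w hw
      exact lam.continuous.continuousAt.comp
        ((LineSection.continuousOn_vec s.continuous).continuousAt (Metric.isOpen_ball.mem_nhds hw))
    have hsign' : J.intersectionSign s z = if 0 < (a + b * Complex.I : ℂ).im then 1 else -1 := by
      rw [him]
      unfold AlmostComplexStructure.intersectionSign
      by_cases h : 0 < b
      · exact (if_pos (hsign.2 h)).trans (if_pos h).symm
      · exact (if_neg fun h' => h (hsign.1 h')).trans (if_neg h).symm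
    rw [hsign']
    exact hasLocalIndex_of_hasFDerivAt hfd hfc hf0 (fun h => one_ne_zero (hinj 1 h)) hLI
      (by rwa [him])
  · have hker : LinearMap.ker (L : ℂ →ₗ[ℝ] ℂ) = ⊥ := LinearMap.ker_eq_bot'.2 hinj
    obtain ⟨K, -, hK⟩ := (L : ℂ →ₗ[ℝ] ℂ).exists_antilipschitzWith hker
    have h1 := hfd.eventually_ne (c := 0) ⟨K, hK⟩
    rw [eventually_nhdsWithin_iff] at h1 ⊢
    have h2 := continuous_subtype_val.continuousAt (x := z) h1
    filter_upwards [h2] with w hw hwz hwS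
    refine hw (fun h => hwz (Subtype.ext h)) ?_
    have := (𝓔.lineSection_E_eq_zero_iff (s w)).2 hwS
    simp only [LineSection.vec, toDisk_coe, this, _root_.map_zero]

/-- A transverse map without zeros near the boundary has finitely many zeros, and its index is
the number of zeros counted with signs. -/
theorem mapIndex_signedCount {s : C(Disk, J.AntiInvBundle)} (hs : J.IsTransverse s)
    (hK : IsCompact (J.intersectionSet s)) :
    (J.intersectionSet s).Finite ∧ 𝓔.lineSection.MapIndex s (J.signedCount s) := by
  have hex : ∀ z, ∃ lam : V →L[ℂ] ℂ, IsFrame (𝓔.lineSection.P (s z)) lam := fun z =>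
    (𝓔.lineSection.isLineProj _).exists_frame
  choose lam hlam using hex
  have hfin : (J.intersectionSet s).Finite := hK.finite_of_isolated fun z hz =>
    (𝓔.hasLocalIndex_of_transverse hs hz (hlam z)).2
  refine ⟨hfin, ?_⟩
  rw [AlmostComplexStructure.signedCount, finsum_mem_eq_finite_toFinset_sum _ hfin]
  refine LineSection.mapIndex_sum s.continuous _ _ lam (fun z hz => ?_) (fun z _ => hlam z)
    fun z hz => ?_
  · rw [Set.Finite.mem_toFinset]
    exact (𝓔.lineSection_E_eq_zero_iff _).1 hz
  · rw [Set.Finite.mem_toFinset] at hz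
    exact (𝓔.hasLocalIndex_of_transverse hs hz (hlam z)).1

end BundleEmbedding

end Transverse

/-! ### Admissibility -/

section Admissible

variable {X : Type*} [TopologicalSpace X] {C : Set X}

theorem admissible_comp_isProperMap {σ : C(Disk, X)} (hσ : Admissible C σ) {θ : C(Disk, Disk)}
    (hθ : IsProperMap θ) : Admissible C (σ.comp θ) := by
  obtain ⟨K, hK, hd⟩ := hσ
  refine ⟨θ ⁻¹' K, hθ.isCompact_preimage hK, hd.mono_right (closure_mono ?_)⟩
  rintro _ ⟨z, hz, rfl⟩
  exact ⟨θ z, hz, rfl⟩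

theorem isCompact_preimage_of_admissible (hC : IsClosed C) {σ : C(Disk, X)}
    (hσ : Admissible C σ) : IsCompact (σ ⁻¹' C) := by
  obtain ⟨K, hK, hd⟩ := hσ
  refine hK.of_isClosed_subset (hC.preimage σ.continuous) fun z hz => ?_
  by_contra hzK
  exact disjoint_left.1 hd hz (subset_closure ⟨z, hzK, rfl⟩)

/-- Near the edge of disk `i` the point `θ i z` is either outside `K`, where admissibility of `σ`
helps, or in the compact set `Q` left of `K` after removing the other disks and a neighbourhood of
the zeros in this one. The image of `Q` is compact and misses `C`. -/
theorem admissible_comp_of_disjoint_cover [T2Space X] (hC : IsClosed C) {σ : C(Disk, X)}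
    (hσ : Admissible C σ) {ι : Type*} {θ : ι → C(Disk, Disk)} (hemb : ∀ i, IsEmbedding (θ i))
    (hopen : ∀ i, IsOpen (range (θ i)))
    (hdis : Pairwise fun i j => Disjoint (range (θ i)) (range (θ j)))
    (hcov : σ ⁻¹' C ⊆ ⋃ i, range (θ i)) (i : ι) : Admissible C (σ.comp (θ i)) := by
  have hpre := LineSection.isCompact_preimage_of_disjoint_cover hemb hopen hdis
    (isCompact_preimage_of_admissible hC hσ) hcov i
  obtain ⟨K, hK, hd⟩ := hσ
  have : LocallyCompactSpace Disk := unitDisk.isOpen.locallyCompactSpace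
  obtain ⟨N, hN, hsub⟩ := exists_compact_superset hpre
  have hoN : IsOpen (θ i '' interior N) :=
    ((⟨hemb i, hopen i⟩ : IsOpenEmbedding (θ i)).isOpenMap) _ isOpen_interior
  set Q : Set Disk := K \ (θ i '' interior N ∪ ⋃ j ∈ {j | j ≠ i}, range (θ j)) with hQ
  have hQc : IsCompact Q := hK.diff (hoN.union (isOpen_biUnion fun j _ => hopen j))
  have hQd : Disjoint C (σ '' Q) := by
    rw [disjoint_left]
    rintro _ hz ⟨z, hzQ, rfl⟩
    obtain ⟨j, hj⟩ := mem_iUnion.1 (hcov hz)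
    by_cases hji : j = i
    · subst hji
      obtain ⟨w, rfl⟩ := hj
      exact hzQ.2 (.inl ⟨w, hsub hz, rfl⟩)
    · exact hzQ.2 (.inr (mem_biUnion (show j ∈ {j | j ≠ i} from hji) hj))
  refine ⟨N, hN, ?_⟩
  have h1 : (σ.comp (θ i)) '' Nᶜ ⊆ σ '' Kᶜ ∪ σ '' Q := by
    rintro _ ⟨z, hz, rfl⟩
    by_cases hzK : θ i z ∈ K
    · refine .inr ⟨θ i z, ⟨hzK, ?_⟩, rfl⟩
      rintro (⟨w, hw, hwz⟩ | h)
      · rw [(hemb i).injective hwz] at hw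
        exact hz (interior_subset hw)
      · obtain ⟨j, hj, hzj⟩ := mem_iUnion₂.1 h
        exact disjoint_left.1 (hdis hj) hzj ⟨z, rfl⟩
    · exact .inl ⟨θ i z, hzK, rfl⟩
  have h2 := closure_mono h1
  rw [closure_union, (hQc.image σ.continuous).isClosed.closure_eq] at h2
  exact (disjoint_union_right.2 ⟨hd, hQd⟩).mono_right h2

end Admissible

/-! ### The index of `Γ_α ∘ σ` and the axioms that follow from it. -/

section Section

variable {M : Type*} [TopologicalSpace M] [ChartedSpace R4 M] [IsManifold (𝓡 4) ∞ M]
  {J : AlmostComplexStructure M} {V : Type*} [NormedAddCommGroup V] [NormedSpace ℂ V]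
  (α : AntiInvariantForm J)

namespace BundleEmbedding

theorem isClosed_zeroSection (𝓔 : BundleEmbedding J V) : IsClosed J.zeroSection := by
  have : J.zeroSection = 𝓔.lineSection.E ⁻¹' {0} := by
    ext y; exact (𝓔.lineSection_E_eq_zero_iff y).symm
  rw [this]
  exact isClosed_singleton.preimage 𝓔.lineSection.continuous_E

theorem toSection_mem_zeroSection (x : M) : α.toSection x ∈ J.zeroSection ↔ x ∈ α.zeroSet := Iff.rfl

theorem isClosed_zeroSet (𝓔 : BundleEmbedding J V) : IsClosed α.zeroSet :=
  𝓔.isClosed_zeroSection.preimage α.toSection.continuous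

/-- The points `y` with the same image under the embedding as `Γ_α(π y)` form a closed set
containing `Γ_α(M)`. So a limit on the zero section lies over a zero of `α`, which is in the closure
of `f '' A`. -/
theorem disjoint_zeroSection_closure (𝓔 : BundleEmbedding J V) {T : Type*} {f : T → M} {A : Set T}
    (h : Disjoint α.zeroSet (closure (f '' A))) :
    Disjoint J.zeroSection (closure ((fun t => α.toSection (f t)) '' A)) := by
  have hπ : Continuous fun y : J.AntiInvBundle => y.1.proj :=
    (FiberBundle.continuous_proj Bil (BilinFiber M)).comp continuous_subtype_val
  have hcl : IsClosed {y : J.AntiInvBundle |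
      𝓔.lineSection.E y = 𝓔.lineSection.E (α.toSection y.1.proj)} :=
    isClosed_eq 𝓔.lineSection.continuous_E
      (𝓔.lineSection.continuous_E.comp (α.toSection.continuous.comp hπ))
  have h1 : closure ((fun t => α.toSection (f t)) '' A) ⊆ {y : J.AntiInvBundle |
      𝓔.lineSection.E y = 𝓔.lineSection.E (α.toSection y.1.proj)} :=
    closure_minimal (by rintro _ ⟨t, -, rfl⟩; rfl) hcl
  have h2 : closure ((fun t => α.toSection (f t)) '' A) ⊆
      (fun y : J.AntiInvBundle => y.1.proj) ⁻¹' closure (f '' A) :=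
    closure_minimal (by rintro _ ⟨t, ht, rfl⟩; exact subset_closure ⟨t, ht, rfl⟩)
      (isClosed_closure.preimage hπ)
  rw [disjoint_left] at h ⊢
  intro y hy hyc
  refine h ?_ (h2 hyc)
  rw [← toSection_mem_zeroSection, ← 𝓔.lineSection_E_eq_zero_iff, ← h1 hyc]
  exact (𝓔.lineSection_E_eq_zero_iff y).2 hy

theorem admissible_toSection_comp (𝓔 : BundleEmbedding J V) {σ : C(Disk, M)} (h : Admissible α.zeroSet σ) :
    Admissible J.zeroSection (α.toSection.comp σ) := by
  obtain ⟨K, hK, hd⟩ := h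
  exact ⟨K, hK, 𝓔.disjoint_zeroSection_closure α hd⟩

theorem vec_ne_zero_of_admissible (𝓔 : BundleEmbedding J V) {s : C(Disk, J.AntiInvBundle)}
    (h : Admissible J.zeroSection s) :
    ∃ K : Set Disk, IsCompact K ∧ ∀ z ∉ K, 𝓔.lineSection.E (s z) ≠ 0 := by
  obtain ⟨K, hK, hd⟩ := h
  refine ⟨K, hK, fun z hz h0 => ?_⟩
  exact disjoint_left.1 hd ((𝓔.lineSection_E_eq_zero_iff _).1 h0) (subset_closure ⟨z, hz, rfl⟩)

theorem vec_ne_zero_of_admissibleHomotopy (𝓔 : BundleEmbedding J V) {s₀ s₁ : C(Disk, J.AntiInvBundle)}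
    {h : s₀.Homotopy s₁} (hh : AdmissibleHomotopy J.zeroSection h) :
    ∃ K : Set Disk, IsCompact K ∧ ∀ t, ∀ z ∉ K, 𝓔.lineSection.E (h (t, z)) ≠ 0 := by
  obtain ⟨K, hK, hd⟩ := hh
  refine ⟨K, hK, fun t z hz h0 => ?_⟩
  exact disjoint_left.1 hd ((𝓔.lineSection_E_eq_zero_iff _).1 h0)
    (subset_closure ⟨(t, z), hz, rfl⟩)

/-- The signed count of a transverse perturbation is the index. -/
theorem mapIndex_of_isTransversePerturbation (𝓔 : BundleEmbedding J V) {σ : C(Disk, M)} {s : C(Disk, J.AntiInvBundle)}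
    (h : α.IsTransversePerturbation σ s) : (J.intersectionSet s).Finite ∧
      𝓔.lineSection.MapIndex (α.toSection.comp σ) (J.signedCount s) := by
  obtain ⟨⟨h, hh⟩, ht⟩ := h
  obtain ⟨K, hK, hz⟩ := 𝓔.vec_ne_zero_of_admissibleHomotopy hh
  have hc : IsCompact (J.intersectionSet s) := by
    refine hK.of_isClosed_subset (𝓔.isClosed_zeroSection.preimage s.continuous) fun z hz' => ?_
    by_contra hzK
    have := hz 1 z hzK
    rw [h.apply_one] at this
    exact this ((𝓔.lineSection_E_eq_zero_iff _).2 hz')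
  obtain ⟨hfin, hidx⟩ := 𝓔.mapIndex_signedCount ht hc
  exact ⟨hfin, hidx.homotopy h.symm hK fun t z hzK => hz _ z hzK⟩

variable {α}

theorem mapIndex_intersectionNumber (𝓔 : BundleEmbedding J V) (σ : AdmissibleMap α.zeroSet)
    (h : α.HasSmallTransversePerturbations σ.1) :
    𝓔.lineSection.MapIndex (α.toSection.comp σ.1) (α.intersectionNumber σ) := by
  obtain ⟨s, h, hh, ht, -⟩ := h univ isOpen_univ fun _ => mem_univ _
  have hex : ∃ s, α.IsTransversePerturbation σ.1 s := ⟨s, ⟨h, hh⟩, ht⟩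
  rw [AntiInvariantForm.intersectionNumber, dif_pos hex]
  exact (𝓔.mapIndex_of_isTransversePerturbation α hex.choose_spec).2

/-- By uniqueness of the index, the perturbation chosen in the definition of `intersectionNumber` is
immaterial. -/
theorem intersectionNumber_eq (𝓔 : BundleEmbedding J V) (σ : AdmissibleMap α.zeroSet)
    (h : α.HasSmallTransversePerturbations σ.1) {k : ℤ}
    (hk : 𝓔.lineSection.MapIndex (α.toSection.comp σ.1) k) : α.intersectionNumber σ = k :=
  (𝓔.mapIndex_intersectionNumber σ h).unique (α.toSection.comp σ.1).continuous hk

/-- All axioms are statements about `MapIndex`. Only positivity depends on more than topology, and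
it is passed in as `hpos`. -/
theorem isPositiveCohomologyAssignment [T2Space M] (𝓔 : BundleEmbedding J V)
    (hsmall : ∀ σ : AdmissibleMap α.zeroSet, α.HasSmallTransversePerturbations σ.1)
    (hpos : ∀ (σ : AdmissibleMap α.zeroSet) (k : ℤ), J.IsHolomorphicEmbedding σ.1 →
      (∃ z, σ.1 z ∈ α.zeroSet) → 𝓔.lineSection.MapIndex (α.toSection.comp σ.1) k → 0 < k) :
    J.IsPositiveCohomologyAssignment α.zeroSet α.intersectionNumber where
  eq_zero σ hσ := 𝓔.intersectionNumber_eq σ (hsmall σ)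
    (LineSection.mapIndex_zero (α.toSection.comp σ.1).continuous fun z hz =>
      hσ z ((𝓔.lineSection_E_eq_zero_iff _).1 hz))
  homotopy σ₀ σ₁ h hh := by
    symm
    refine 𝓔.intersectionNumber_eq σ₁ (hsmall σ₁) ?_
    let H : (α.toSection.comp σ₀.1).Homotopy (α.toSection.comp σ₁.1) :=
      (ContinuousMap.Homotopy.refl α.toSection).comp h
    have hH : ∀ p, H p = α.toSection (h p) := fun p => rfl
    obtain ⟨K, hK, hd⟩ := hh
    have hH' : AdmissibleHomotopy J.zeroSection H :=
      ⟨K, hK, 𝓔.disjoint_zeroSection_closure α hd⟩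
    obtain ⟨K', hK', hz⟩ := 𝓔.vec_ne_zero_of_admissibleHomotopy hH'
    exact (𝓔.mapIndex_intersectionNumber σ₀ (hsmall σ₀)).homotopy H hK' hz
  degree σ θ k hθ hk := by
    have h := admissible_comp_isProperMap σ.2 hθ
    refine ⟨h, 𝓔.intersectionNumber_eq ⟨_, h⟩ (hsmall ⟨_, h⟩) ?_⟩
    obtain ⟨K, hK, hz⟩ := 𝓔.vec_ne_zero_of_admissible (𝓔.admissible_toSection_comp α σ.2)
    exact (𝓔.mapIndex_intersectionNumber σ (hsmall σ)).comp_degree hK hz hθ hk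
  additive σ ι θ hemb ho hdis hcov := by
    have h := admissible_comp_of_disjoint_cover (𝓔.isClosed_zeroSet α) σ.2 hemb
      (fun i => isOpen_range_of_preservesOrientation (hemb i).injective (ho i)) hdis hcov
    have hset : {z | 𝓔.lineSection.E (α.toSection.comp σ.1 z) = 0} = σ.1 ⁻¹' α.zeroSet := by
      ext z; exact 𝓔.lineSection_E_eq_zero_iff _
    exact ⟨h, (𝓔.mapIndex_intersectionNumber σ (hsmall σ)).additive
      (by rw [hset]; exact isCompact_preimage_of_admissible (𝓔.isClosed_zeroSet α) σ.2) hemb ho hdis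
      (by rw [hset]; exact hcov) fun i => 𝓔.mapIndex_intersectionNumber ⟨_, h i⟩ (hsmall ⟨_, h i⟩)⟩
  pos σ hσ hz := hpos σ _ hσ hz (𝓔.mapIndex_intersectionNumber σ (hsmall σ))

end BundleEmbedding

end Section

/-! ### Complex multiplication on `Λ_J⁻` -/

section ComplexMul

variable {M : Type*} [TopologicalSpace M] [ChartedSpace R4 M] [IsManifold (𝓡 4) ∞ M]
  {J : AlmostComplexStructure M}

/-- The multiplication by complex numbers on the fibres of `Λ_J⁻`. -/
noncomputable def cmul (c : ℂ) (y : J.AntiInvBundle) : J.AntiInvBundle :=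
  ⟨⟨y.1.proj, c.re • y.1.snd + c.im • y.1.snd.comp (J.toFun y.1.proj)⟩,
    IsAntiInvariant.add_smul J y.2 (IsAntiInvariant.comp_J J y.2) _ _⟩

theorem bc_cmul {x₀ : M} (c : ℂ) {y : J.AntiInvBundle} (hy : y.1.proj ∈ (chartAt R4 x₀).source) :
    bc x₀ (cmul c y).1 =
      c.re • bc x₀ y.1 + c.im • (bc x₀ y.1).comp (jc J x₀ y.1.proj) := by
  rw [← bc_comp_J J hy]
  exact bc_add_smul hy _ _ _ _

theorem continuous_cmul : Continuous fun p : ℂ × J.AntiInvBundle => cmul p.1 p.2 := by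
  refine Continuous.subtype_mk (continuous_iff_continuousAt.2 fun ⟨c₀, y₀⟩ => ?_) _
  have hπ : Continuous fun p : ℂ × J.AntiInvBundle => p.2.1.proj :=
    (FiberBundle.continuous_proj Bil (BilinFiber M)).comp (continuous_subtype_val.comp continuous_snd)
  set A : Set (ℂ × J.AntiInvBundle) := {p | p.2.1.proj ∈ (chartAt R4 y₀.1.proj).source}
  have hA : IsOpen A := (chartAt R4 y₀.1.proj).open_source.preimage hπ
  have h1 : ContinuousOn (fun p : ℂ × J.AntiInvBundle => bc y₀.1.proj p.2.1) A :=
    (continuousOn_bc y₀.1.proj).comp (continuous_subtype_val.comp continuous_snd).continuousOn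
      fun p hp => hp
  have h2 : ContinuousOn (fun p : ℂ × J.AntiInvBundle => jc J y₀.1.proj p.2.1.proj) A :=
    (continuousOn_jc J y₀.1.proj).comp hπ.continuousOn fun p hp => hp
  have h3 : ContinuousOn (fun p : ℂ × J.AntiInvBundle => p.1.re • bc y₀.1.proj p.2.1 +
      p.1.im • (bc y₀.1.proj p.2.1).comp (jc J y₀.1.proj p.2.1.proj)) A :=
    ((Complex.continuous_re.comp continuous_fst).continuousOn.smul h1).add
      ((Complex.continuous_im.comp continuous_fst).continuousOn.smul (h1.clm_comp h2))
  have h4 := (continuousOn_mk_bcInv y₀.1.proj).comp (hπ.continuousOn.prodMk h3)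
    fun p hp => ⟨hp, trivial⟩
  refine (h4.congr fun p hp => ?_).continuousAt (hA.mem_nhds (mem_chart_source R4 _))
  have h5 := bc_cmul p.1 hp
  simp only [Function.comp_apply]
  rw [← h5]
  exact congrArg (TotalSpace.mk' Bil p.2.1.proj) (bcInv_bc hp (cmul p.1 p.2).1.snd).symm

variable {V : Type*} [NormedAddCommGroup V] [NormedSpace ℂ V] (𝓔 : BundleEmbedding J V)

namespace BundleEmbedding

theorem E_cmul (c : ℂ) (y : J.AntiInvBundle) :
    𝓔.lineSection.E (cmul c y) = c • 𝓔.lineSection.E y := by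
  have h : 𝓔.E ⟨y.1.proj, c.re • y.1.snd + c.im • y.1.snd.comp (J.toFun y.1.proj)⟩ =
      c • 𝓔.E ⟨y.1.proj, y.1.snd⟩ := by
    rw [𝓔.map_add_smul, 𝓔.map_J, smul_smul, ← add_smul, Complex.re_add_im]
  exact h

theorem ext_of_E_eq {y y' : J.AntiInvBundle} (h : y.1.proj = y'.1.proj)
    (hE : 𝓔.lineSection.E y = 𝓔.lineSection.E y') : y = y' := by
  obtain ⟨⟨x, b⟩, hb⟩ := y
  obtain ⟨⟨x', b'⟩, hb'⟩ := y'
  obtain rfl : x = x' := h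
  have h1 : 𝓔.E ⟨x, (1 : ℝ) • b + (-1 : ℝ) • b'⟩ = 0 := by
    have : 𝓔.E ⟨x, b⟩ = 𝓔.E ⟨x, b'⟩ := hE
    rw [𝓔.map_add_smul, this, ← add_smul]; simp
  have h2 := 𝓔.eq_zero _ _ (IsAntiInvariant.add_smul J hb hb' 1 (-1)) h1
  have h3 : b = b' := by
    ext u v
    have := congrArg (fun B : BilinFiber M x => B u v) h2
    simp only [add_apply, smul_apply, smul_eq_mul, zero_apply] at this
    linarith
  subst h3
  rfl

/-- A nowhere vanishing lift of a map of a smaller disk, with the coordinate of the map in it. -/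
theorem exists_lift (s : C(Disk, J.AntiInvBundle)) {R : ℝ} (hR0 : 0 < R) (hR : R < 1) :
    ∃ (φ : ℂ → J.AntiInvBundle) (f : ℂ → ℂ), Continuous φ ∧ Continuous f ∧
      (∀ z, 𝓔.lineSection.E (φ z) ≠ 0) ∧
      (∀ z, ‖z‖ ≤ R → s (toDisk z) = cmul (f z) (φ z)) ∧
      ∀ z, f z = 0 → ∃ w, ‖w‖ ≤ R ∧ 𝓔.lineSection.vec s w = 0 ∧ (‖w‖ < R → w = z) := by
  obtain ⟨ψ, hψ, hf⟩ := LineSection.exists_frame_lines (Λ := 𝓔.lineSection) s.continuous hR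
  -- In each fibre over the smaller disk take the point on which the frame is `1`. The coordinate of
  -- any other point of the fibre is then its value under the frame.
  have hex : ∀ z : ℂ, ∃ y : J.AntiInvBundle, y.1.proj = (s (toDisk z)).1.proj ∧
      (z ∈ Metric.closedBall 0 R → ψ z (𝓔.lineSection.E y) = 1) := fun z => by
    obtain ⟨β, hβ, hβ0⟩ := exists_isAntiInvariant_ne_zero J (s (toDisk z)).1.proj
    set y : J.AntiInvBundle := ⟨⟨_, β⟩, hβ⟩
    have hy : 𝓔.lineSection.E y ≠ 0 := fun h => hβ0 ((𝓔.lineSection_E_eq_zero_iff y).1 h)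
    refine ⟨cmul (ψ z (𝓔.lineSection.E y))⁻¹ y, rfl, fun hz => ?_⟩
    rw [E_cmul, map_smul, smul_eq_mul, inv_mul_cancel₀]
    exact fun h => hy (hf z hz _ (𝓔.P_E _ _ hβ) h)
  choose φ hφp hφ1 using hex
  have hπs : ContinuousOn (fun z => (s (toDisk z)).1.proj) (Metric.ball 0 1) :=
    ((FiberBundle.continuous_proj Bil (BilinFiber M)).comp
      (continuous_subtype_val.comp s.continuous)).comp_continuousOn continuousOn_toDisk
  have hsub := LineSection.closedBall_subset hR
  have hframe : ∀ z ∈ Metric.closedBall (0 : ℂ) R, ∀ y : J.AntiInvBundle,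
      y.1.proj = (s (toDisk z)).1.proj → y = cmul (ψ z (𝓔.lineSection.E y)) (φ z) :=
    fun z hz y hy => by
      refine 𝓔.ext_of_E_eq (hy.trans (hφp z).symm) ?_
      have hP : 𝓔.P (s (toDisk z)).1.proj (𝓔.lineSection.E y) = 𝓔.lineSection.E y := by
        rw [← hy]; exact 𝓔.P_E _ _ y.2
      have hP' : 𝓔.P (s (toDisk z)).1.proj (𝓔.lineSection.E (φ z)) = 𝓔.lineSection.E (φ z) := by
        rw [← hφp z]; exact 𝓔.P_E _ _ (φ z).2
      rw [E_cmul, ← sub_eq_zero]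
      refine hf z hz _ ?_ ?_
      · change 𝓔.P (s (toDisk z)).1.proj _ = _
        rw [map_sub, map_smul, hP, hP']
      · rw [map_sub, map_smul, hφ1 z hz, smul_eq_mul, mul_one, sub_self]
  -- The choice was pointwise; continuity follows by normalizing a continuous local section with the
  -- frame, which gives the same points.
  have hφc : ContinuousOn φ (Metric.closedBall 0 R) := fun z₀ hz₀ => by
    obtain ⟨U, β, hU, hx₀, -, hβc, hβ⟩ := exists_local_section J (s (toDisk z₀)).1.proj
    set A : Set ℂ := Metric.closedBall 0 R ∩ (fun z => (s (toDisk z)).1.proj) ⁻¹' U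
    have hAn : A ∈ 𝓝[Metric.closedBall 0 R] z₀ :=
      inter_mem self_mem_nhdsWithin (((hπs.mono hsub) z₀ hz₀) (hU.mem_nhds hx₀))
    have hz₀A : z₀ ∈ A := ⟨hz₀, hx₀⟩
    set b : ℂ → J.AntiInvBundle := fun z => by
      classical
      exact if h : (s (toDisk z)).1.proj ∈ U then ⟨⟨_, β _⟩, (hβ _ h).1⟩ else φ z with hb
    have hbp : ∀ z ∈ A, (b z).1 = ⟨(s (toDisk z)).1.proj, β (s (toDisk z)).1.proj⟩ := fun z hz => by
      exact congrArg Subtype.val (dif_pos (show (s (toDisk z)).1.proj ∈ U from hz.2))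
    have hbc : ContinuousOn b A := by
      refine Topology.IsInducing.subtypeVal.continuousOn_iff.2 (ContinuousOn.congr ?_ hbp)
      exact hβc.comp (hπs.mono (inter_subset_left.trans hsub)) fun z hz => hz.2
    have hb0 : ∀ z ∈ A, 𝓔.lineSection.E (b z) ≠ 0 := fun z hz h => by
      have h1 := (𝓔.lineSection_E_eq_zero_iff _).1 h
      have h2 : (b z).1.snd = 0 := h1
      rw [hbp z hz] at h2
      exact (hβ _ hz.2).2 h2
    have hbψ : ∀ z ∈ A, ψ z (𝓔.lineSection.E (b z)) ≠ 0 := fun z hz h => by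
      refine hb0 z hz (hf z hz.1 _ ?_ h)
      have := 𝓔.P_E _ _ (b z).2
      have hp : (b z).1.proj = (s (toDisk z)).1.proj := by rw [hbp z hz]
      change 𝓔.P (s (toDisk z)).1.proj _ = _
      rw [← hp]; exact this
    have hEb := 𝓔.lineSection.continuous_E.comp_continuousOn hbc
    have h1 : ContinuousOn (fun z => cmul (ψ z (𝓔.lineSection.E (b z)))⁻¹ (b z)) A :=
      continuous_cmul.comp_continuousOn
        ((((hψ.mono inter_subset_left).clm_apply hEb).inv₀ hbψ).prodMk hbc)
    have h2 : ∀ z ∈ A, φ z = cmul (ψ z (𝓔.lineSection.E (b z)))⁻¹ (b z) := fun z hz => by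
      have hp : (b z).1.proj = (s (toDisk z)).1.proj := by rw [hbp z hz]
      refine 𝓔.ext_of_E_eq ((hφp z).trans hp.symm) ?_
      conv_rhs => rw [hframe z hz.1 (b z) hp]
      rw [E_cmul, E_cmul, map_smul, hφ1 z hz.1, smul_eq_mul, mul_one, smul_smul,
        inv_mul_cancel₀ (hbψ z hz), one_smul]
    exact ((h1.congr h2) z₀ hz₀A).mono_of_mem_nhdsWithin hAn
  have hvec := (LineSection.continuousOn_vec (Λ := 𝓔.lineSection) s.continuous).mono hsub
  have hr : ∀ z, radialRetract R z ∈ Metric.closedBall (0 : ℂ) R := fun z => by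
    simpa using norm_radialRetract_le hR0 z
  have hrc := (continuous_radialRetract hR0).continuousOn (s := univ)
  -- Both functions are extended radially to the plane. A zero of the extended coordinate comes from
  -- the retracted point, which is the point itself when it is strictly inside.
  refine ⟨fun z => φ (radialRetract R z),
    fun z => ψ (radialRetract R z) (𝓔.lineSection.vec s (radialRetract R z)),
    continuousOn_univ.1 (hφc.comp hrc fun z _ => hr z),
    continuousOn_univ.1 ((hψ.clm_apply hvec).comp hrc fun z _ => hr z), fun z h => ?_,
    fun z hz => ?_, fun z hz => ?_⟩
  · have := hφ1 _ (hr z)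
    rw [h, _root_.map_zero] at this
    exact zero_ne_one this
  · simp only [radialRetract_of_le hR0 hz]
    exact hframe z (by simpa using hz) _ rfl
  · refine ⟨_, norm_radialRetract_le hR0 z, hf _ (hr z) _ (𝓔.lineSection.P_E _) hz,
      fun h => radialRetract_of_norm_lt hR0 h⟩

end BundleEmbedding

end ComplexMul

/-- A map of the plane close to the identity that is constant near the points of a finite set. -/
theorem exists_collapse (S : Finset ℂ) {U : Set ℂ} (hU : IsOpen U) (hS : ∀ z ∈ S, z ∈ U) :
    ∀ δ : ℝ, 0 < δ → ∃ κ : ℂ → ℂ, Continuous κ ∧ (∀ z, ‖κ z - z‖ ≤ δ) ∧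
      (∀ z ∈ S, ∀ᶠ w in 𝓝 z, κ w = z) ∧ ∃ K ⊆ U, IsCompact K ∧ ∀ z ∉ K, κ z = z := by
  classical
  induction S using Finset.induction_on with
  | empty => exact fun δ hδ => ⟨id, continuous_id, by simp [hδ.le], by simp, ∅, by simp⟩
  | insert a S ha ih =>
    intro δ hδ
    -- With `κ` moving points by at most `δ / 3`, pulling towards `a` within distance `ρ ≤ δ / 3`
    -- adds at most `‖z - a‖ + ‖κ z - z‖`, hence at most `2δ / 3`.
    obtain ⟨κ, hκ, hκδ, hκS, K, hKU, hK, hκK⟩ := ih (fun z hz => hS z (Finset.mem_insert_of_mem hz))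
      (δ / 3) (by positivity)
    have hnhds : U ∩ (↑S : Set ℂ)ᶜ ∈ 𝓝 a := inter_mem
      (hU.mem_nhds (hS a (Finset.mem_insert_self a S)))
      (S.finite_toSet.isClosed.isOpen_compl.mem_nhds (by simpa using ha))
    obtain ⟨η, hη, hηU⟩ := Metric.nhds_basis_closedBall.mem_iff.1 hnhds
    set ρ := min η (δ / 3) with hρ
    have hρ0 : 0 < ρ := lt_min hη (by positivity)
    -- A bump that is `1` within `ρ / 2` of `a`, where the new map is constant, and `0` beyond `ρ`,
    -- where it is `κ`.
    set b : ℂ → ℝ := fun z => max 0 (min 1 (2 - 2 * ‖z - a‖ / ρ)) with hb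
    have hbc : Continuous b := by fun_prop
    have hb0 : ∀ z, 0 ≤ b z := fun z => le_max_left _ _
    have hb1 : ∀ z, b z ≤ 1 := fun z => max_le zero_le_one (min_le_left _ _)
    have hbout : ∀ z, ρ ≤ ‖z - a‖ → b z = 0 := fun z hz => by
      have : 2 - 2 * ‖z - a‖ / ρ ≤ 0 := by
        rw [sub_nonpos, le_div_iff₀ hρ0]; linarith
      exact max_eq_left ((min_le_right _ _).trans this)
    have hbin : ∀ z, ‖z - a‖ ≤ ρ / 2 → b z = 1 := fun z hz => by
      have : 1 ≤ 2 - 2 * ‖z - a‖ / ρ := by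
        have : 2 * ‖z - a‖ / ρ ≤ 1 := by rw [div_le_one hρ0]; linarith
        linarith
      simp only [hb, min_eq_left this]; norm_num
    refine ⟨fun z => κ z + b z • (a - κ z), by fun_prop, fun z => ?_, fun z hz => ?_,
      K ∪ Metric.closedBall a ρ, ?_, hK.union (isCompact_closedBall a ρ), fun z hz => ?_⟩
    · rcases le_or_gt ρ ‖z - a‖ with h | h
      · simp only [hbout z h, zero_smul, add_zero]
        exact (hκδ z).trans (by linarith)
      · have h1 : ‖b z • (a - κ z)‖ ≤ ‖a - κ z‖ := by
          rw [norm_smul, Real.norm_of_nonneg (hb0 z)]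
          exact mul_le_of_le_one_left (norm_nonneg _) (hb1 z)
        have h2 : ‖a - κ z‖ ≤ ‖z - a‖ + ‖κ z - z‖ := by
          have : a - κ z = -(z - a) - (κ z - z) := by ring
          rw [this]
          exact (norm_sub_le _ _).trans (by rw [norm_neg])
        have h3 := hκδ z
        have h4 : ρ ≤ δ / 3 := min_le_right _ _
        calc ‖κ z + b z • (a - κ z) - z‖ = ‖(κ z - z) + b z • (a - κ z)‖ := by congr 1; ring
          _ ≤ ‖κ z - z‖ + ‖b z • (a - κ z)‖ := norm_add_le _ _
          _ ≤ δ := by linarith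
    · rcases Finset.mem_insert.1 hz with rfl | hz
      · filter_upwards [Metric.closedBall_mem_nhds z (half_pos hρ0)] with w hw
        rw [hbin w (by simpa [dist_eq_norm] using hw)]; simp
      · have hza : z ∉ Metric.closedBall a ρ := fun h =>
          (hηU (Metric.closedBall_subset_closedBall (min_le_left _ _) h)).2 hz
        filter_upwards [hκS z hz, Metric.isClosed_closedBall.isOpen_compl.mem_nhds hza] with w hw hw'
        rw [hbout w (not_lt.1 fun h => hw' (mem_closedBall_iff_norm.2 h.le)), hw]; simp
    · exact union_subset hKU fun z hz =>
        (hηU (Metric.closedBall_subset_closedBall (min_le_left _ _) hz)).1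
    · simp only [mem_union, not_or] at hz
      simp only [hbout z (not_lt.1 fun h => hz.2 (mem_closedBall_iff_norm.2 h.le)), hκK z hz.1]
      simp

/-! ### Existence of small transverse perturbations. -/

section SmallPerturbation

variable {M : Type*} [TopologicalSpace M] [ChartedSpace R4 M] [IsManifold (𝓡 4) ∞ M]
  {J : AlmostComplexStructure M}

theorem contMDiffAt_cmul {g : ℂ → ℂ} {z : Disk} (hg : ContDiffAt ℝ ∞ g (z : ℂ))
    (y : J.AntiInvBundle) :
    ContMDiffAt 𝓘(ℝ, ℂ) ((𝓡 4).prod 𝓘(ℝ, Bil)) ∞ (fun w : Disk => (cmul (g w) y).1) z := by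
  rw [contMDiffAt_totalSpace]
  refine ⟨contMDiffAt_const, ?_⟩
  have hy : y.1.proj ∈ (chartAt R4 y.1.proj).source := mem_chart_source R4 _
  have h : ContMDiffAt 𝓘(ℝ, ℂ) 𝓘(ℝ, Bil) ∞ (fun w : Disk => bc y.1.proj (cmul (g w) y).1) z := by
    simp only [bc_cmul _ hy]
    rw [contMDiffAt_iff_toDisk]
    have hg' : ContDiffAt ℝ ∞ (fun w => g (toDisk w : Disk)) (z : ℂ) :=
      hg.congr_of_eventuallyEq ((eventually_coe_toDisk z).mono fun w hw => congrArg g hw)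
    exact ((Complex.reCLM.contDiff.contDiffAt.comp _ hg').smul contDiffAt_const).add
      ((Complex.imCLM.contDiff.contDiffAt.comp _ hg').smul contDiffAt_const)
  exact h

theorem exists_clm_apply_eq_of_det_ne_zero {A : ℂ →L[ℝ] ℂ} (hA : A.det ≠ 0) (c : ℂ) : ∃ v, A v = c := by
  have h : (A : ℂ →ₗ[ℝ] ℂ).range = ⊤ := LinearMap.range_eq_top.2
    (LinearMap.equivOfDetNeZero (A : ℂ →ₗ[ℝ] ℂ) hA).surjective
  exact LinearMap.range_eq_top.1 h c

/-- Near `z` the map stays in the fibre through `y` and is `g` times `y`, so its smoothness and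
transversality are those of the complex function `g`. -/
theorem verticalDeriv_surjective {s : C(Disk, J.AntiInvBundle)} {z : Disk} {g : ℂ → ℂ}
    {y : J.AntiInvBundle} (hy0 : y.1.snd ≠ 0) (hg : ∀ᶠ w in 𝓝 (z : ℂ), ContDiffAt ℝ ∞ g w)
    (hdet : (fderiv ℝ g z).det ≠ 0) (hs : ∀ᶠ w in 𝓝 z, s w = cmul (g w) y) :
    (∀ᶠ w in 𝓝 z, ContMDiffAt 𝓘(ℝ, ℂ) ((𝓡 4).prod 𝓘(ℝ, Bil)) ∞ (fun w' : Disk => (s w').1) w) ∧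
    ∀ β : BilinFiber M (s z).1.proj, J.IsAntiInvariant (s z).1.proj β →
      ∃ v : ℂ, J.verticalDeriv s z v = β := by
  have hsm : ∀ᶠ w in 𝓝 z, ContMDiffAt 𝓘(ℝ, ℂ) ((𝓡 4).prod 𝓘(ℝ, Bil)) ∞
      (fun w' : Disk => (s w').1) w := by
    filter_upwards [hs.eventually_nhds, continuous_subtype_val.continuousAt (x := z) hg]
      with w hw hgw
    exact (contMDiffAt_cmul hgw y).congr_of_eventuallyEq (hw.mono fun w' hw' => congrArg _ hw')
  refine ⟨hsm, fun β hβ => ?_⟩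
  have hxs : (s z).1.proj ∈ (chartAt R4 (s z).1.proj).source := mem_chart_source R4 _
  have hbs : ContMDiffAt 𝓘(ℝ, ℂ) 𝓘(ℝ, Bil) ∞ (fun w : Disk => bc (s z).1.proj (s w).1) z :=
    (contMDiffAt_totalSpace.1 hsm.self_of_nhds).2
  have hV := BundleEmbedding.verticalDeriv_eq s z (hbs.mdifferentiableAt (by simp))
  have hpy : y.1.proj = (s z).1.proj := by rw [hs.self_of_nhds]; rfl
  obtain ⟨B, hB, hB0, hBs⟩ : ∃ B : Bil, AntiInv (jc J (s z).1.proj (s z).1.proj) B ∧ B ≠ 0 ∧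
      ∀ c, bc (s z).1.proj (cmul c y).1 =
        c.re • B + c.im • B.comp (jc J (s z).1.proj (s z).1.proj) := by
    generalize (s z).1.proj = x at hpy hxs
    subst hpy
    exact ⟨bc y.1.proj y.1, (isAntiInvariant_iff J hxs y.1.snd).1 y.2,
      fun h => hy0 ((bc_eq_zero_iff hxs _).1 h), fun c => bc_cmul c hxs⟩
  obtain ⟨a, b, hab⟩ := hB.exists_eq (jc_sq J hxs) hB0 ((isAntiInvariant_iff J hxs β).1 hβ)
  obtain ⟨v, hv⟩ := exists_clm_apply_eq_of_det_ne_zero hdet ⟨a, b⟩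
  refine ⟨v, (hV v).trans ?_⟩
  have hder : HasFDerivAt (fun w => bc (s z).1.proj (s (toDisk w)).1)
      ((Complex.reCLM.comp (fderiv ℝ g z)).smulRight B +
        (Complex.imCLM.comp (fderiv ℝ g z)).smulRight
          (B.comp (jc J (s z).1.proj (s z).1.proj))) (z : ℂ) := by
    have hgd := (hg.self_of_nhds.differentiableAt (by simp)).hasFDerivAt
    have h1 := (Complex.reCLM.hasFDerivAt.comp (z : ℂ) hgd).smul_const B
    have h2 := (Complex.imCLM.hasFDerivAt.comp (z : ℂ) hgd).smul_const
      (B.comp (jc J (s z).1.proj (s z).1.proj))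
    refine (h1.add h2).congr_of_eventuallyEq ?_
    have hs' : ∀ᶠ w in 𝓝 (z : ℂ), s (toDisk w) = cmul (g (toDisk w : Disk)) y := by
      have := continuousAt_toDisk z
      rw [ContinuousAt, toDisk_coe] at this
      exact this hs
    filter_upwards [hs', eventually_coe_toDisk z] with w hw hw'
    rw [hw, hBs, hw']
    rfl
  rw [hder.fderiv]
  have e : ((Complex.reCLM.comp (fderiv ℝ g z)).smulRight B +
        (Complex.imCLM.comp (fderiv ℝ g z)).smulRight
          (B.comp (jc J (s z).1.proj (s z).1.proj))) v = bc (s z).1.proj ⟨(s z).1.proj, β⟩ := by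
    rw [hab]
    simp [hv]
  rw [e]
  exact bcInv_bc hxs β

variable {V : Type*} [NormedAddCommGroup V] [NormedSpace ℂ V] {α : AntiInvariantForm J}

/-- In a trivialization the map is `f · φ`. The coefficient `f` is replaced by a generic `g`, and
`φ` by `φ ∘ κ` with `κ` constant near the zeros of `g`; no smoothness of `σ` is then needed there.
-/
theorem BundleEmbedding.hasSmallTransversePerturbations (𝓔 : BundleEmbedding J V) {σ : C(Disk, M)}
    (hσ : Admissible α.zeroSet σ) : α.HasSmallTransversePerturbations σ := by
  intro W hW hgraph
  set s : C(Disk, J.AntiInvBundle) := α.toSection.comp σ with hs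
  have hsadm := 𝓔.admissible_toSection_comp α hσ
  obtain ⟨K₀, hK₀, hd₀⟩ := hsadm
  have hz₀ : ∀ z, s z ∈ J.zeroSection → z ∈ K₀ := fun z hz => by
    by_contra h
    exact disjoint_left.1 hd₀ hz (subset_closure ⟨z, h, rfl⟩)
  -- Radii `r₀ < r < R < 1`: the zeros lie within `r₀`, the changes are made within `r`, and the
  -- trivialization lives on `R`.
  obtain ⟨r₀, hr₀0, hr₀1, hr₀⟩ := exists_norm_le_of_isCompact hK₀
  obtain ⟨r, hr₀r, hr1⟩ := exists_between hr₀1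
  obtain ⟨R, hrR, hR1⟩ := exists_between hr1
  have hr0 : 0 < r := hr₀0.trans_lt hr₀r
  have hR0 : 0 < R := hr0.trans hrR
  obtain ⟨φ, f, hφ, hf, hφ0, hsφ, hfz⟩ := 𝓔.exists_lift s hR0 hR1
  have hfU : ∀ z ∉ Metric.ball (0 : ℂ) r, f z ≠ 0 := fun z hz h => by
    obtain ⟨w, hwR, hw0, hwz⟩ := hfz z h
    have h1 := hr₀ _ (hz₀ _ ((𝓔.lineSection_E_eq_zero_iff _).1 hw0))
    rw [coe_toDisk (hwR.trans_lt hR1)] at h1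
    rw [← hwz (by linarith)] at hz
    exact hz (by simpa using h1.trans_lt hr₀r)
  -- a uniform neighbourhood on which everything stays in `W`
  obtain ⟨ε, hε, hεW⟩ : ∃ ε > 0, ∀ z : ℂ, ‖z‖ ≤ r → ∀ a b : ℂ, ‖a‖ < ε → ‖b‖ < ε →
      (toDisk z, cmul (f z + a) (φ (z + b))) ∈ W := by
    set Ψ : ℂ × (ℂ × ℂ) → Disk × J.AntiInvBundle := fun p =>
      (toDisk p.1, cmul (f p.1 + p.2.1) (φ (p.1 + p.2.2))) with hΨ
    have hΨc : ContinuousOn Ψ (Metric.ball 0 1 ×ˢ univ) := by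
      refine ContinuousOn.prodMk (continuousOn_toDisk.comp continuousOn_fst fun p hp => hp.1) ?_
      refine (continuous_cmul.comp (Continuous.prodMk ?_ (hφ.comp ?_))).continuousOn <;> fun_prop
    have hopen : IsOpen ((Metric.ball (0 : ℂ) 1 ×ˢ univ) ∩ Ψ ⁻¹' W) :=
      hΨc.isOpen_inter_preimage (Metric.isOpen_ball.prod isOpen_univ) hW
    obtain ⟨u, v, -, hv, hu, h0v, huv⟩ := generalized_tube_lemma
      (isCompact_closedBall (0 : ℂ) r) (isCompact_singleton (x := ((0, 0) : ℂ × ℂ))) hopen (by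
        rintro ⟨z, p⟩ ⟨hz, rfl⟩
        refine ⟨⟨Metric.closedBall_subset_ball hr1 hz, trivial⟩, ?_⟩
        have h1 := hsφ z ((by simpa using hz : ‖z‖ ≤ r).trans hrR.le)
        simp only [hΨ, mem_preimage, add_zero]
        rw [← h1]
        exact hgraph _)
    obtain ⟨ε, hε, hεv⟩ := Metric.isOpen_iff.1 hv _ (h0v rfl)
    refine ⟨ε, hε, fun z hz a b ha hb => (huv ⟨hu (by simpa using hz), hεv ?_⟩ :
      (z, (a, b)) ∈ _).2⟩
    rw [Metric.mem_ball, dist_eq_norm]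
    simpa [Prod.norm_def] using ⟨ha, hb⟩
  obtain ⟨g, hg, ⟨K, hKU, hK, hgK⟩, hgε, S, hS, hS'⟩ := exists_generic_perturbation hf
    Metric.isOpen_ball Metric.isBounded_ball hfU hε
  obtain ⟨κ, hκ, hκε, hκS, K', hK'U, hK', hκK'⟩ := exists_collapse S
    (Metric.isOpen_ball (x := (0 : ℂ)) (ε := r)) (fun z hz => (hS' z hz).1) (ε / 2) (by positivity)
  set Q := K ∪ K' with hQ
  have hQc : IsCompact Q := hK.union hK'
  have hQU : Q ⊆ Metric.ball 0 r := union_subset hKU hK'U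
  -- The homotopy moves the coefficient and the base point linearly at the same time; both
  -- displacements stay below `ε`.
  obtain ⟨H, hHc, hH⟩ : ∃ H : ℝ × ℂ → J.AntiInvBundle, Continuous H ∧ ∀ t z, H (t, z) =
      cmul (f z + (t : ℂ) * (g z - f z)) (φ (z + (t : ℂ) * (κ z - z))) := by
    refine ⟨fun p => cmul (f p.2 + (p.1 : ℂ) * (g p.2 - f p.2)) (φ (p.2 + (p.1 : ℂ) * (κ p.2 - p.2))),
      continuous_cmul.comp (Continuous.prodMk ?_ (hφ.comp ?_)), fun t z => rfl⟩ <;> fun_prop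
  have hHs : ∀ (t : ℝ) (z : Disk), (z : ℂ) ∉ Q → ‖(z : ℂ)‖ ≤ R → H (t, z) = s z := fun t z hz hzR => by
    rw [hH, hgK _ fun h => hz (.inl h), hκK' _ fun h => hz (.inr h)]
    simp only [sub_self, mul_zero, add_zero]
    rw [← hsφ _ hzR, toDisk_coe]
  -- `H` agrees with `s` off the compact set `Q`, which is well inside radius `R`, so the two pieces
  -- glue continuously.
  obtain ⟨G, hGH, hGout⟩ : ∃ G : ℝ × Disk → J.AntiInvBundle,
      (∀ (t : ℝ) (z : Disk), ‖(z : ℂ)‖ < R → G (t, z) = H (t, z)) ∧ ∀ (t : ℝ) (z : Disk), ¬ ‖(z : ℂ)‖ < R → G (t, z) = s z := by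
    classical
    exact ⟨fun p => if ‖(p.2 : ℂ)‖ < R then H (p.1, p.2) else s p.2, fun t z h => if_pos h,
      fun t z h => if_neg h⟩
  have hGs : ∀ (t : ℝ) (z : Disk), (z : ℂ) ∉ Q → G (t, z) = s z := fun t z hz => by
    by_cases h : ‖(z : ℂ)‖ < R
    · rw [hGH t z h, hHs t z hz h.le]
    · exact hGout t z h
  have hGc : Continuous G := by
    rw [continuous_iff_continuousAt]
    rintro ⟨t, z⟩
    by_cases hz : ‖(z : ℂ)‖ < R
    · have h1 : Continuous fun p : ℝ × Disk => H (p.1, p.2) := hHc.comp (by fun_prop)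
      refine h1.continuousAt.congr ?_
      have h2 : IsOpen {p : ℝ × Disk | ‖(p.2 : ℂ)‖ < R} := isOpen_lt (by fun_prop) continuous_const
      filter_upwards [h2.mem_nhds hz] with p hp
      exact (hGH p.1 p.2 hp).symm
    · have h1 : Continuous fun p : ℝ × Disk => s p.2 := s.continuous.comp continuous_snd
      refine h1.continuousAt.congr ?_
      have h2 : IsOpen {p : ℝ × Disk | (p.2 : ℂ) ∉ Q} :=
        hQc.isClosed.isOpen_compl.preimage (by fun_prop)
      have h3 : (z : ℂ) ∉ Q := fun h => hz (by
        have := hQU h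
        rw [mem_ball_zero_iff] at this; linarith)
      filter_upwards [h2.mem_nhds h3] with p hp
      exact (hGs p.1 p.2 hp).symm
  have hG0 : ∀ z, G (0, z) = s z := fun z => by
    by_cases h : ‖(z : ℂ)‖ < R
    · rw [hGH _ z h, hH, Complex.ofReal_zero, zero_mul, add_zero, zero_mul, add_zero,
        ← hsφ _ h.le, toDisk_coe]
    · exact hGout _ z h
  obtain ⟨s', hs'⟩ : ∃ s' : C(Disk, J.AntiInvBundle), ∀ z, s' z = G (1, z) :=
    ⟨⟨fun z => G (1, z), hGc.comp (by fun_prop)⟩, fun z => rfl⟩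
  obtain ⟨h, hval⟩ : ∃ h : s.Homotopy s', ∀ (t : unitInterval) (z : Disk),
      h (t, z) = G ((t : ℝ), z) :=
    ⟨{ toFun := fun p => G (p.1, p.2)
       continuous_toFun := hGc.comp (by fun_prop)
       map_zero_left := fun z => by simpa using hG0 z
       map_one_left := fun z => by simp [hs'] }, fun t z => rfl⟩
  refine ⟨s', h, ⟨K₀ ∪ Subtype.val ⁻¹' Q, hK₀.union ?_, hd₀.mono_right (closure_mono ?_)⟩, ?_, ?_⟩
  · refine Topology.IsInducing.subtypeVal.isCompact_preimage' hQc fun z hz => ?_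
    have : ‖z‖ < 1 := (mem_ball_zero_iff.1 (hQU hz)).trans hr1
    exact ⟨toDisk z, coe_toDisk this⟩
  · rintro _ ⟨⟨t, z⟩, hz, rfl⟩
    have hz' : z ∉ K₀ ∪ Subtype.val ⁻¹' Q := hz
    rw [mem_union, not_or] at hz'
    exact ⟨z, hz'.1, (hval t z ▸ hGs t z hz'.2).symm⟩
  · intro z hz
    have hzero : s' z ∈ J.zeroSection := hz
    have hzr : ‖(z : ℂ)‖ < R := by
      by_contra hc
      have h1 : s' z = s z := (hs' z).trans (hGout _ z hc)
      rw [h1] at hzero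
      exact hc ((hr₀ z (hz₀ z hzero)).trans_lt (hr₀r.trans hrR))
    have hs'z : ∀ w : Disk, ‖(w : ℂ)‖ < R → s' w = cmul (g w) (φ (κ w)) := fun w hw => by
      rw [hs', hGH _ w hw, hH, Complex.ofReal_one, one_mul, one_mul, add_sub_cancel, add_sub_cancel]
    have hzS : (z : ℂ) ∈ S := by
      rw [hs'z z hzr, ← 𝓔.lineSection_E_eq_zero_iff, 𝓔.E_cmul] at hzero
      exact (hS _).1 ((smul_eq_zero.1 hzero).resolve_right (hφ0 _))
    obtain ⟨-, hgs, hdet⟩ := hS' _ hzS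
    refine verticalDeriv_surjective (y := φ z) (fun h0 => hφ0 z
      ((𝓔.lineSection_E_eq_zero_iff _).2 h0)) hgs hdet ?_
    have h2 : IsOpen {w : Disk | ‖(w : ℂ)‖ < R} := isOpen_lt (by fun_prop) continuous_const
    filter_upwards [h2.mem_nhds hzr, continuous_subtype_val.continuousAt (x := z) (hκS _ hzS)]
      with w hw hκw
    rw [hs'z w hw, hκw]
  · intro t z
    rw [hval]
    by_cases hzQ : (z : ℂ) ∈ Q
    · have hzr : ‖(z : ℂ)‖ < r := mem_ball_zero_iff.1 (hQU hzQ)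
      have h1 : G ((t : ℝ), z) = H (t, z) := hGH _ z (hzr.trans hrR)
      have ht : ‖((t : ℝ) : ℂ)‖ ≤ 1 := by
        rw [Complex.norm_real, Real.norm_of_nonneg t.2.1]; exact t.2.2
      have h2 := hεW z hzr.le ((t : ℝ) * (g z - f z)) ((t : ℝ) * (κ z - z))
        (by
          rw [norm_mul]
          exact (mul_le_of_le_one_left (norm_nonneg _) ht).trans_lt (hgε _))
        (by
          rw [norm_mul]
          exact (mul_le_of_le_one_left (norm_nonneg _) ht).trans_lt
            ((hκε _).trans_lt (half_lt_self hε)))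
      rw [toDisk_coe] at h2
      rw [h1, hH]
      exact h2
    · rw [hGs t z hzQ]
      exact hgraph z

end SmallPerturbation

/-! ### The Cauchy–Riemann operator and the Cauchy transform -/

section CauchyTransform

open MeasureTheory

/-- The Cauchy–Riemann operator. -/
noncomputable def dbar (f : ℂ → ℂ) (z : ℂ) : ℂ :=
  (fderiv ℝ f z 1 + Complex.I * fderiv ℝ f z Complex.I) / 2

theorem dbar_of_hasFDerivAt {f : ℂ → ℂ} {L : ℂ →L[ℝ] ℂ} {z : ℂ} (h : HasFDerivAt f L z) :
    dbar f z = (L 1 + Complex.I * L Complex.I) / 2 := by rw [dbar, h.fderiv]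

theorem dbar_mul {f g : ℂ → ℂ} {z : ℂ} (hf : DifferentiableAt ℝ f z) (hg : DifferentiableAt ℝ g z) :
    dbar (fun w => f w * g w) z = dbar f z * g z + f z * dbar g z := by
  have h : HasFDerivAt (fun w => f w * g w) _ z := hf.hasFDerivAt.mul hg.hasFDerivAt
  rw [dbar_of_hasFDerivAt h, dbar, dbar]
  simp only [add_apply, smul_apply, smul_eq_mul]
  ring

theorem dbar_sub {f g : ℂ → ℂ} {z : ℂ} (hf : DifferentiableAt ℝ f z) (hg : DifferentiableAt ℝ g z) :
    dbar (fun w => f w - g w) z = dbar f z - dbar g z := by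
  have h : HasFDerivAt (fun w => f w - g w) _ z := hf.hasFDerivAt.sub hg.hasFDerivAt
  rw [dbar_of_hasFDerivAt h, dbar, dbar]
  simp only [sub_apply]
  ring

theorem dbar_cexp_neg {u : ℂ → ℂ} {z : ℂ} (hu : DifferentiableAt ℝ u z) :
    dbar (fun w => Complex.exp (-u w)) z = -(Complex.exp (-u z) * dbar u z) := by
  have h1 := (Complex.hasDerivAt_exp (-u z)).hasFDerivAt.restrictScalars ℝ
  have h2 := h1.comp z hu.hasFDerivAt.neg
  have h3 : HasFDerivAt (fun w => Complex.exp (-u w)) _ z := h2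
  rw [dbar_of_hasFDerivAt h3, dbar]
  simp
  ring

theorem differentiableAt_of_dbar_eq_zero {f : ℂ → ℂ} {z : ℂ} (hf : DifferentiableAt ℝ f z)
    (h : dbar f z = 0) : DifferentiableAt ℂ f z := by
  rw [differentiableAt_complex_iff_differentiableAt_real]
  refine ⟨hf, ?_⟩
  have h1 : fderiv ℝ f z 1 + Complex.I * fderiv ℝ f z Complex.I = 0 := by
    have := (div_eq_zero_iff.1 h).resolve_right two_ne_zero
    exact this
  rw [smul_eq_mul]
  linear_combination -Complex.I * h1 + (fderiv ℝ f z Complex.I) * Complex.I_mul_I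

theorem contDiff_dbar {f : ℂ → ℂ} {n : ℕ∞} (hf : ContDiff ℝ (n + 1) f) : ContDiff ℝ n (dbar f) := by
  have h := hf.fderiv_right (m := n) le_rfl
  unfold dbar
  exact ((h.clm_apply contDiff_const).add (contDiff_const.mul (h.clm_apply contDiff_const))).div_const 2

theorem locallyIntegrable_inv : LocallyIntegrable (fun w : ℂ => w⁻¹) := by
  refine locallyIntegrable_of_norm_le_rpow (C := 1) (α := 1) (by simp) (by simp)
    (.of_forall fun w => ?_) (by fun_prop)
  rw [norm_inv, one_mul, Real.rpow_neg_one]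

/-- The Cauchy transform. -/
noncomputable def cauchyTransform (g : ℂ → ℂ) (z : ℂ) : ℂ :=
  (Real.pi : ℂ)⁻¹ * ∫ w : ℂ, w⁻¹ * g (z - w)

open scoped Convolution in
theorem cauchyTransform_eq (g : ℂ → ℂ) : cauchyTransform g = fun z => (Real.pi : ℂ)⁻¹ *
    ((fun w : ℂ => w⁻¹) ⋆[ContinuousLinearMap.mul ℝ ℂ, volume] g) z := rfl

theorem contDiff_cauchyTransform {g : ℂ → ℂ} {n : ℕ∞} (hg : ContDiff ℝ n g)
    (hc : HasCompactSupport g) : ContDiff ℝ n (cauchyTransform g) := by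
  rw [cauchyTransform_eq]
  exact contDiff_const.mul (hc.contDiff_convolution_right _ locallyIntegrable_inv hg)

theorem dbar_cauchyTransform_eq {g : ℂ → ℂ} (hg : ContDiff ℝ 1 g) (hc : HasCompactSupport g) (z : ℂ) :
    dbar (cauchyTransform g) z = cauchyTransform (dbar g) z := by
  have h1 := (hc.hasFDerivAt_convolution_right (ContinuousLinearMap.mul ℝ ℂ) locallyIntegrable_inv
    hg z).const_mul (Real.pi : ℂ)⁻¹
  have hgc : Continuous (fderiv ℝ g) := hg.continuous_fderiv one_ne_zero
  have h2 := fun v => convolution_precompR_apply (ContinuousLinearMap.mul ℝ ℂ) locallyIntegrable_inv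
    (hc.fderiv ℝ) hgc z v
  have hint : ∀ v, Integrable fun w : ℂ => w⁻¹ * fderiv ℝ g (z - w) v := fun v => by
    have h3 : HasCompactSupport fun w => fderiv ℝ g w v :=
      (hc.fderiv ℝ).mono fun w hw h0 => hw (by simp [h0])
    exact h3.convolutionExists_right (ContinuousLinearMap.mul ℝ ℂ) locallyIntegrable_inv
      (hgc.clm_apply continuous_const) z
  rw [cauchyTransform_eq, dbar_of_hasFDerivAt h1, cauchyTransform]
  simp only [smul_apply, h2, smul_eq_mul]
  simp only [convolution_def, ContinuousLinearMap.mul_apply', dbar]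
  rw [mul_left_comm, ← mul_add, mul_div_assoc, ← integral_const_mul, ← integral_add (hint 1)
    ((hint Complex.I).const_mul _), ← integral_div]
  congr 2
  ext w
  ring

theorem hasDerivAt_ray (θ r : ℝ) :
    HasDerivAt (fun r : ℝ => (r : ℂ) * Complex.exp (θ * Complex.I)) (Complex.exp (θ * Complex.I)) r := by
  simpa using (Complex.ofRealCLM.hasDerivAt (x := r)).mul_const (Complex.exp (θ * Complex.I))

theorem hasDerivAt_circle (r θ : ℝ) :
    HasDerivAt (fun θ : ℝ => (r : ℂ) * Complex.exp (θ * Complex.I))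
      (r * (Complex.I * Complex.exp (θ * Complex.I))) θ := by
  have h1 : HasDerivAt (fun θ : ℝ => (θ : ℂ) * Complex.I) Complex.I θ := by
    simpa using (Complex.ofRealCLM.hasDerivAt (x := θ)).mul_const Complex.I
  have := (h1.cexp.const_mul (r : ℂ))
  rwa [mul_comm (Complex.exp _) Complex.I] at this

/-- The Cauchy–Pompeiu formula for functions with compact support. -/
theorem integral_inv_mul_dbar {g : ℂ → ℂ} (hg : ContDiff ℝ 1 g) (hc : HasCompactSupport g) :
    ∫ w : ℂ, w⁻¹ * dbar g w = -(Real.pi * g 0) := by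
  obtain ⟨R, hR0, hR⟩ := hc.isCompact.isBounded.exists_pos_norm_lt
  have hgR : ∀ w, R ≤ ‖w‖ → g w = 0 := fun w hw => by
    by_contra h
    exact absurd (hR w (subset_tsupport _ h)) (not_lt.2 hw)
  have hDR : ∀ w, R ≤ ‖w‖ → fderiv ℝ g w = 0 := fun w hw => by
    by_contra h
    exact absurd (hR w (tsupport_fderiv_subset ℝ (subset_tsupport _ h))) (not_lt.2 hw)
  have hDc : Continuous (fderiv ℝ g) := hg.continuous_fderiv one_ne_zero
  have hgd : Differentiable ℝ g := hg.differentiable one_ne_zero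
  set e : ℝ → ℂ := fun θ => Complex.exp (θ * Complex.I) with he
  have hec : Continuous e := by fun_prop
  have hen : ∀ θ, ‖e θ‖ = 1 := fun θ => Complex.norm_exp_ofReal_mul_I θ
  -- In polar coordinates `r · w⁻¹ ∂̄g` is `(A + iB) / 2`, where `A` is the radial derivative and
  -- `B` the angular derivative divided by `r`. Along each ray `A` integrates to `-g 0`, and along
  -- each circle `B` integrates to zero.
  set A : ℝ × ℝ → ℂ := fun p => fderiv ℝ g (p.1 * e p.2) (e p.2) with hA
  set B : ℝ × ℝ → ℂ := fun p => fderiv ℝ g (p.1 * e p.2) (Complex.I * e p.2) with hB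
  have hAc : Continuous A := (hDc.comp (by fun_prop)).clm_apply (by fun_prop)
  have hBc : Continuous B := (hDc.comp (by fun_prop)).clm_apply (by fun_prop)
  set S : Set (ℝ × ℝ) := Ioc 0 R ×ˢ Ioo (-Real.pi) Real.pi with hS
  have hint : ∀ F : ℝ × ℝ → ℂ, Continuous F → IntegrableOn F S := fun F hF =>
    (hF.continuousOn.integrableOn_compact (isCompact_Icc.prod isCompact_Icc)).mono_set
      (prod_mono Ioc_subset_Icc_self Ioo_subset_Icc_self)
  have hpolar : ∫ w : ℂ, w⁻¹ * dbar g w = ∫ p in S, (A p + Complex.I * B p) / 2 := by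
    rw [← Complex.integral_comp_polarCoord_symm]
    have h1 : ∀ p ∈ polarCoord.target, p.1 • ((Complex.polarCoord.symm p)⁻¹ *
        dbar g (Complex.polarCoord.symm p)) = (A p + Complex.I * B p) / 2 := fun p hp => by
      have hp0 : (p.1 : ℂ) ≠ 0 := by
        have : 0 < p.1 := hp.1
        exact_mod_cast this.ne'
      have h2 : Complex.polarCoord.symm p = p.1 * e p.2 := by
        rw [Complex.polarCoord_symm_apply]
        simp only [he, Complex.exp_mul_I, Complex.ofReal_cos, Complex.ofReal_sin]
      have h3 : e p.2 = Real.cos p.2 + Real.sin p.2 * Complex.I := by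
        simp only [he, Complex.exp_mul_I, Complex.ofReal_cos, Complex.ofReal_sin]
      have h4 : e p.2 = Real.cos p.2 • (1 : ℂ) + Real.sin p.2 • Complex.I := by
        rw [h3]; simp
      have h5 : Complex.I * e p.2 = (-Real.sin p.2) • (1 : ℂ) + Real.cos p.2 • Complex.I := by
        rw [h3]; simp only [Complex.real_smul, Complex.ofReal_neg]
        linear_combination (Real.sin p.2 : ℂ) * Complex.I_mul_I
      have h6 : (e p.2)⁻¹ = Real.cos p.2 - Real.sin p.2 * Complex.I := by
        refine inv_eq_of_mul_eq_one_right ?_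
        rw [h3]
        have := Complex.cos_sq_add_sin_sq (p.2 : ℂ)
        push_cast
        linear_combination this - (Complex.sin p.2) ^ 2 * Complex.I_mul_I
      rw [h2, Complex.real_smul, mul_inv, ← mul_assoc, ← mul_assoc, mul_inv_cancel₀ hp0, one_mul, dbar,
        h6]
      have h7 : A p = Real.cos p.2 * fderiv ℝ g (p.1 * e p.2) 1 +
          Real.sin p.2 * fderiv ℝ g (p.1 * e p.2) Complex.I := by
        simp only [hA]
        conv_lhs => rw [h4]
        rw [map_add, map_smul, map_smul, ← h4]; rfl
      have h8 : B p = -Real.sin p.2 * fderiv ℝ g (p.1 * e p.2) 1 +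
          Real.cos p.2 * fderiv ℝ g (p.1 * e p.2) Complex.I := by
        simp only [hB]
        rw [h5, map_add, map_smul, map_smul]; simp
      rw [h7, h8]
      linear_combination (-Real.sin p.2 * fderiv ℝ g (p.1 * e p.2) Complex.I / 2) * Complex.I_mul_I
    rw [setIntegral_congr_fun polarCoord.open_target.measurableSet h1]
    refine setIntegral_eq_of_subset_of_forall_sdiff_eq_zero polarCoord.open_target.measurableSet
      ?_ ?_
    · exact prod_mono Ioc_subset_Ioi_self subset_rfl
    · rintro p ⟨hp, hpS⟩
      have h0 : (0 : ℝ) < p.1 := hp.1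
      have h2 : R ≤ ‖(p.1 : ℂ) * e p.2‖ := by
        rw [norm_mul, hen, mul_one, Complex.norm_real, Real.norm_of_nonneg h0.le]
        by_contra h
        exact hpS ⟨⟨h0, (not_le.1 h).le⟩, hp.2⟩
      simp only [hA, hB, hDR _ h2]; simp
  have hIA : ∫ p in S, A p = -(2 * Real.pi * g 0) := by
    have h0 : ∫ p in S, A p = ∫ θ in Ioo (-Real.pi) Real.pi, ∫ r in Ioc 0 R, A (r, θ) := by
      have := hint A hAc
      rw [hS, IntegrableOn, Measure.volume_eq_prod, ← Measure.prod_restrict] at this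
      rw [hS, Measure.volume_eq_prod, ← Measure.prod_restrict, integral_prod_symm A this]
    rw [h0]
    have h1 : ∀ θ : ℝ, ∫ r in Ioc 0 R, A (r, θ) = -g 0 := fun θ => by
      rw [← intervalIntegral.integral_of_le hR0.le]
      have h2 : ∀ r ∈ uIcc 0 R, HasDerivAt (fun r : ℝ => g (r * e θ)) (A (r, θ)) r := fun r _ =>
        (hgd _).hasFDerivAt.comp_hasDerivAt r (hasDerivAt_ray θ r)
      rw [intervalIntegral.integral_eq_sub_of_hasDerivAt h2
        ((hAc.comp (by fun_prop : Continuous fun r : ℝ => (r, θ))).intervalIntegrable _ _)]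
      rw [hgR (R * e θ) (by simp [hen, abs_of_pos hR0])]
      simp
    simp only [h1]
    simp [Real.pi_pos.le]
    left
    ring
  have hIB : ∫ p in S, B p = 0 := by
    rw [hS, Measure.volume_eq_prod, setIntegral_prod _ (hint B hBc)]
    refine setIntegral_eq_zero_of_forall_eq_zero fun r hr => ?_
    have hr0 : (r : ℂ) ≠ 0 := by exact_mod_cast hr.1.ne'
    have h2 : ∀ θ ∈ uIcc (-Real.pi) Real.pi,
        HasDerivAt (fun θ : ℝ => (r : ℂ)⁻¹ * g (r * e θ)) (B (r, θ)) θ := fun θ _ => by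
      have h3 := (hgd _).hasFDerivAt.comp_hasDerivAt θ (hasDerivAt_circle r θ)
      have h4 := h3.const_mul (r : ℂ)⁻¹
      refine h4.congr_deriv ?_
      have : (r : ℂ) * (Complex.I * Complex.exp (θ * Complex.I)) = r • (Complex.I * e θ) := by simp [he]
      rw [this, map_smul, Complex.real_smul, inv_mul_cancel_left₀ hr0]
    rw [← integral_Ioc_eq_integral_Ioo, ← intervalIntegral.integral_of_le (by linarith [Real.pi_pos])]
    rw [intervalIntegral.integral_eq_sub_of_hasDerivAt h2
        ((hBc.comp (by fun_prop : Continuous fun θ : ℝ => (r, θ))).intervalIntegrable _ _)]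
    simp [he, Complex.exp_neg]
  rw [hpolar, integral_div, integral_add (hint A hAc) ((hint B hBc).const_mul _), integral_const_mul,
    hIA, hIB]
  ring

/-- The operator passes under the convolution to `g`, and the substitution `w ↦ z - w` reduces the
claim to the Cauchy–Pompeiu formula at the origin. -/
theorem dbar_cauchyTransform {g : ℂ → ℂ} (hg : ContDiff ℝ 1 g) (hc : HasCompactSupport g) (z : ℂ) :
    dbar (cauchyTransform g) z = g z := by
  rw [dbar_cauchyTransform_eq hg hc, cauchyTransform]
  set γ : ℂ → ℂ := fun w => g (z - w) with hγ
  have hγ1 : ContDiff ℝ 1 γ := hg.comp (contDiff_const.sub contDiff_id)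
  have hγc : HasCompactSupport γ := hc.comp_homeomorph (Homeomorph.subLeft z)
  have hd : ∀ w, dbar g (z - w) = -dbar γ w := fun w => by
    have h1 : HasFDerivAt γ ((fderiv ℝ g (z - w)).comp (-ContinuousLinearMap.id ℝ ℂ)) w :=
      (hg.differentiable one_ne_zero (z - w)).hasFDerivAt.comp w ((hasFDerivAt_id w).const_sub z)
    rw [dbar_of_hasFDerivAt h1, dbar]
    simp; ring
  simp only [hd, mul_neg]
  rw [integral_neg, integral_inv_mul_dbar hγ1 hγc, neg_neg]
  simp [hγ]

theorem norm_cauchyTransform_le {g : ℂ → ℂ} {N : ℝ} (hN : ∀ w, ‖g w‖ ≤ N) {z : ℂ} {S : ℝ}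
    (h : ∀ w, S ≤ ‖w‖ → g (z - w) = 0) :
    ‖cauchyTransform g z‖ ≤ (Real.pi⁻¹ * ∫ w in Metric.ball (0 : ℂ) S, ‖w⁻¹‖) * N := by
  have hint : IntegrableOn (fun w : ℂ => ‖w⁻¹‖) (Metric.ball 0 S) :=
    ((locallyIntegrable_inv.integrableOn_isCompact (isCompact_closedBall 0 S)).mono_set
      Metric.ball_subset_closedBall).norm
  have h1 : ∫ w : ℂ, w⁻¹ * g (z - w) = ∫ w in Metric.ball (0 : ℂ) S, w⁻¹ * g (z - w) := by
    refine (setIntegral_eq_integral_of_forall_compl_eq_zero fun w hw => ?_).symm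
    rw [h w (by simpa using hw), mul_zero]
  rw [cauchyTransform, norm_mul, h1, norm_inv, Complex.norm_real, Real.norm_of_nonneg Real.pi_pos.le,
    mul_assoc, ← integral_mul_const]
  refine mul_le_mul_of_nonneg_left ?_ (by positivity)
  refine norm_integral_le_of_norm_le (hint.mul_const N) (.of_forall fun w => ?_)
  rw [norm_mul]
  exact mul_le_mul_of_nonneg_left (hN _) (norm_nonneg _)

theorem tendsto_cauchyTransform {g : ℕ → ℂ → ℂ} {a : ℂ → ℂ} {N : ℝ} (hg : ∀ n, Continuous (g n))
    (hN : ∀ n w, ‖g n w‖ ≤ N) {z : ℂ} {S : ℝ} (h : ∀ n w, S ≤ ‖w‖ → g n (z - w) = 0)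
    (ha : ∀ w, Tendsto (fun n => g n w) atTop (𝓝 (a w))) :
    Tendsto (fun n => cauchyTransform (g n) z) atTop (𝓝 (cauchyTransform a z)) := by
  refine Tendsto.const_mul _ ?_
  have hint : Integrable ((Metric.ball 0 S).indicator fun w : ℂ => ‖w⁻¹‖ * N) := by
    rw [integrable_indicator_iff Metric.isOpen_ball.measurableSet]
    exact (((locallyIntegrable_inv.integrableOn_isCompact (isCompact_closedBall 0 S)).mono_set
      Metric.ball_subset_closedBall).norm).mul_const N
  refine tendsto_integral_of_dominated_convergence _ (fun n => ?_) hint (fun n => ?_)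
    (.of_forall fun w => (ha _).const_mul _)
  · exact locallyIntegrable_inv.aestronglyMeasurable.mul
      ((hg n).comp (by fun_prop)).aestronglyMeasurable
  · refine .of_forall fun w => ?_
    by_cases hw : w ∈ Metric.ball (0 : ℂ) S
    · rw [indicator_of_mem hw, norm_mul]
      exact mul_le_mul_of_nonneg_left (hN _ _) (norm_nonneg _)
    · rw [indicator_of_notMem hw, h n w (by simpa using hw), mul_zero, norm_zero]

end CauchyTransform

/-! ### The similarity principle -/

section Similarity

open MeasureTheory

theorem hasLocalIndex_pos_of_analyticAt {H : ℂ → ℂ} {z : ℂ} (hH : AnalyticAt ℂ H z) (h0 : H z = 0)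
    (hne : ¬ ∀ᶠ w in 𝓝 z, H w = 0) : ∃ k : ℤ, 0 < k ∧ HasLocalIndex H z k := by
  obtain ⟨n, h, hh, hhz, hev⟩ := hH.exists_eventuallyEq_pow_smul_nonzero_iff.2 hne
  have hn : 0 < n := by
    rw [Nat.pos_iff_ne_zero]
    rintro rfl
    have := hev.self_of_nhds
    rw [h0] at this
    simp at this
    exact hhz this.symm
  refine ⟨n, by exact_mod_cast hn, ?_⟩
  have h1 := ((hasLocalIndex_sub z).zpow n).mul
    (hasLocalIndex_zero (hh.eventually_analyticAt.mono fun w hw => hw.continuousAt) hhz)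
  rw [mul_one, add_zero] at h1
  refine h1.congr (nhdsWithin_le_nhds ?_)
  filter_upwards [hev] with w hw
  rw [hw, zpow_natCast, smul_eq_mul]

/-- Argument principle: the zeros are isolated since `H` does not vanish on the circle, each has
positive index, and the centre is one of them. -/
theorem circleIndex_pos_of_differentiableOn {H : ℂ → ℂ} {c : ℂ} {r R : ℝ} (hr : 0 < r) (hrR : r < R)
    (hH : DifferentiableOn ℂ H (Metric.ball c R)) (h0 : H c = 0)
    (hne : ∀ z ∈ Metric.sphere c r, H z ≠ 0) {k : ℤ} (hk : CircleIndex H c r k) : 0 < k := by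
  classical
  have han : AnalyticOnNhd ℂ H (Metric.ball c R) := hH.analyticOnNhd Metric.isOpen_ball
  have hsub : Metric.closedBall c r ⊆ Metric.ball c R := Metric.closedBall_subset_ball hrR
  have hiso : ∀ z ∈ Metric.ball c R, ¬ ∃ᶠ w in 𝓝[≠] z, H w = 0 := fun z hz hfr => by
    have h1 := han.eqOn_zero_of_preconnected_of_frequently_eq_zero
      (convex_ball c R).isPreconnected hz hfr
    have h2 := circleMap_mem_sphere c hr.le 0
    exact hne _ h2 (h1 (hsub (Metric.sphere_subset_closedBall h2)))
  set Z : Set ℂ := Metric.closedBall c r ∩ H ⁻¹' {0} with hZ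
  have hZc : IsCompact Z := (isCompact_closedBall c r).of_isClosed_subset
    ((hH.continuousOn.mono hsub).preimage_isClosed_of_isClosed Metric.isClosed_closedBall
      isClosed_singleton) inter_subset_left
  have hZf : Z.Finite := hZc.finite_of_isolated fun z hz => by
    have := hiso z (hsub hz.1)
    rw [not_frequently] at this
    filter_upwards [this] with w hw hwZ using hw hwZ.2
  have hex : ∀ z, ∃ m : ℤ, z ∈ Z → 0 < m ∧ HasLocalIndex H z m := fun z => by
    by_cases hz : z ∈ Z
    · obtain ⟨m, hm⟩ := hasLocalIndex_pos_of_analyticAt (han z (hsub hz.1)) hz.2 fun h =>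
        hiso z (hsub hz.1) (h.filter_mono nhdsWithin_le_nhds).frequently
      exact ⟨m, fun _ => hm⟩
    · exact ⟨0, fun h => absurd h hz⟩
  choose m hm using hex
  have h1 := circleIndex_sum hr.le hZf.toFinset m H (hH.continuousOn.mono hsub)
    (fun z hz => by
      rw [Set.Finite.mem_toFinset] at hz
      rcases (Metric.mem_closedBall.1 hz.1).lt_or_eq with h | h
      · exact h
      · exact absurd hz.2 (hne z h))
    (fun z hz hzS h => hzS (by rw [Set.Finite.mem_toFinset]; exact ⟨hz, h⟩))
    (fun z hz => (hm z ((Set.Finite.mem_toFinset _).1 hz)).2)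
  rw [hk.unique h1]
  have hcZ : c ∈ Z := ⟨Metric.mem_closedBall_self hr.le, h0⟩
  exact Finset.sum_pos (fun z hz => (hm z ((Set.Finite.mem_toFinset _).1 hz)).1)
    ⟨c, (Set.Finite.mem_toFinset _).2 hcZ⟩

/-- The constant in the estimate for the Cauchy transform of functions supported in a disk. -/
noncomputable def cauchyConst (R : ℝ) : ℝ := Real.pi⁻¹ * ∫ w in Metric.ball (0 : ℂ) (5 * R), ‖w⁻¹‖

theorem eq_zero_of_five_mul_le {g : ℂ → ℂ} {c z : ℂ} {R : ℝ} (hg : ∀ w, w ∉ Metric.ball c (3 * R) → g w = 0)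
    (hz : z ∈ Metric.ball c (2 * R)) {w : ℂ} (hw : 5 * R ≤ ‖w‖) : g (z - w) = 0 := by
  refine hg _ fun h => ?_
  rw [mem_ball_iff_norm] at h hz
  have : ‖w‖ ≤ ‖z - c‖ + ‖z - w - c‖ := by
    have e : w = (z - c) - (z - w - c) := by ring
    conv_lhs => rw [e]
    exact norm_sub_le _ _
  linarith

/-- A solution of `|∂̄f| ≤ C|f|` is, up to a bounded factor, a limit of holomorphic functions. -/
theorem exists_holomorphic_approx {f : ℂ → ℂ} (hf : ContDiff ℝ 2 f) {c : ℂ} {R C : ℝ} (hR : 0 < R)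
    (hC : 0 ≤ C) (hb : ∀ z ∈ Metric.ball c (3 * R), ‖dbar f z‖ ≤ C * ‖f z‖) :
    ∃ (M : ℝ) (u H : ℕ → ℂ → ℂ) (v : ℂ → ℂ) (δ : ℕ → ℝ), (∀ n, Continuous (u n)) ∧
      (∀ n, ∀ z ∈ Metric.ball c R, ‖u n z‖ ≤ M) ∧
      (∀ z ∈ Metric.ball c R, Tendsto (fun n => u n z) atTop (𝓝 (v z))) ∧
      (∀ n, DifferentiableOn ℂ (H n) (Metric.ball c R)) ∧ Tendsto δ atTop (𝓝 0) ∧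
      ∀ n, ∀ z ∈ Metric.ball c R, ‖H n z - f z * Complex.exp (-u n z)‖ ≤ δ n := by
  -- Three concentric disks: the first cut-off is `1` on the support of the second, and the second
  -- is `1` where the functions must be holomorphic.
  let χ₁ : ContDiffBump c := ⟨2 * R, 3 * R, by positivity, by linarith⟩
  let χ₂ : ContDiffBump c := ⟨R, 2 * R, hR, by linarith⟩
  have hfd : Differentiable ℝ f := hf.differentiable two_ne_zero
  have hf1 : ContDiff ℝ 1 f := hf.of_le one_le_two
  have hdb : ContDiff ℝ 1 (dbar f) := contDiff_dbar (n := 1) (by norm_num; exact hf)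
  -- One would solve `∂̄u = ∂̄f / f`, but the quotient is not smooth at the zeros of `f`. Adding `ε
  -- n` to the denominator `|f|²` makes it `C¹` and keeps the bound `C`.
  set ε : ℕ → ℝ := fun n => 1 / ((n : ℝ) + 1) with hε
  have hε0 : ∀ n, 0 < ε n := fun n => by positivity
  have hεlim : Tendsto ε atTop (𝓝 0) := tendsto_one_div_add_atTop_nhds_zero_nat
  have hconj : ∀ z, f z * (starRingEnd ℂ) (f z) = ((‖f z‖ ^ 2 : ℝ) : ℂ) := fun z => by
    rw [Complex.mul_conj, Complex.normSq_eq_norm_sq]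
  have hden : ∀ n z, f z * (starRingEnd ℂ) (f z) + (ε n : ℂ) = ((‖f z‖ ^ 2 + ε n : ℝ) : ℂ) :=
    fun n z => by rw [hconj]; push_cast; rfl
  have hden0 : ∀ n z, 0 < ‖f z‖ ^ 2 + ε n := fun n z => by have := hε0 n; positivity
  have hden1 : ∀ n z, f z * (starRingEnd ℂ) (f z) + (ε n : ℂ) ≠ 0 := fun n z => by
    rw [hden]; exact_mod_cast (hden0 n z).ne'
  have hcf : ContDiff ℝ 1 fun z => (starRingEnd ℂ) (f z) := Complex.conjCLE.contDiff.comp hf1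
  have hχ1 : ∀ z, z ∉ Metric.ball c (3 * R) → χ₁ z = 0 := fun z hz =>
    χ₁.zero_of_le_dist (not_lt.1 hz)
  have hχ2 : ∀ z, z ∉ Metric.ball c (2 * R) → χ₂ z = 0 := fun z hz =>
    χ₂.zero_of_le_dist (not_lt.1 hz)
  have hχc : ∀ χ : ContDiffBump c, ContDiff ℝ 1 fun z => (χ z : ℂ) := fun χ =>
    Complex.ofRealCLM.contDiff.comp χ.contDiff
  have hχn : ∀ (χ : ContDiffBump c) (z : ℂ), ‖(χ z : ℂ)‖ ≤ 1 := fun χ z => by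
    rw [Complex.norm_real, Real.norm_of_nonneg χ.nonneg]; exact χ.le_one
  set g : ℕ → ℂ → ℂ := fun n z => χ₁ z * ((starRingEnd ℂ) (f z) * dbar f z /
    (f z * (starRingEnd ℂ) (f z) + (ε n : ℂ))) with hg
  have hgc : ∀ n, ContDiff ℝ 1 (g n) := fun n => by
    simp only [hg, div_eq_mul_inv]
    exact (hχc χ₁).mul ((hcf.mul hdb).mul (((hf1.mul hcf).add contDiff_const).inv (hden1 n)))
  have hg0 : ∀ n w, w ∉ Metric.ball c (3 * R) → g n w = 0 := fun n w hw => by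
    simp only [hg]; rw [hχ1 w hw]; simp
  have hgcs : ∀ n, HasCompactSupport (g n) := fun n =>
    HasCompactSupport.intro (isCompact_closedBall c (3 * R)) fun w hw =>
      hg0 n w fun h => hw (Metric.ball_subset_closedBall h)
  have hgn : ∀ n w, ‖g n w‖ ≤ C := fun n w => by
    by_cases hw : w ∈ Metric.ball c (3 * R)
    · have h1 : ‖(starRingEnd ℂ) (f w) * dbar f w / (f w * (starRingEnd ℂ) (f w) + (ε n : ℂ))‖ ≤ C := by
        rw [norm_div, norm_mul, RCLike.norm_conj, hden, Complex.norm_real,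
          Real.norm_of_nonneg (hden0 n w).le, div_le_iff₀ (hden0 n w)]
        have h2 := mul_le_mul_of_nonneg_left (hb w hw) (norm_nonneg (f w))
        have h3 := mul_nonneg hC (hε0 n).le
        nlinarith
      simp only [hg]
      rw [norm_mul]
      exact (mul_le_of_le_one_left (norm_nonneg _) (hχn χ₁ w)).trans h1
    · rw [hg0 n w hw, norm_zero]; exact hC
  set a : ℂ → ℂ := fun z => χ₁ z * ((starRingEnd ℂ) (f z) * dbar f z /
    (f z * (starRingEnd ℂ) (f z))) with ha
  have hga : ∀ w, Tendsto (fun n => g n w) atTop (𝓝 (a w)) := fun w => by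
    by_cases hw : f w = 0
    · simp only [hg, ha, hw]; simp
    · have h1 : f w * (starRingEnd ℂ) (f w) ≠ 0 := mul_ne_zero hw (by simpa using hw)
      have h2 : Tendsto (fun n => f w * (starRingEnd ℂ) (f w) + (ε n : ℂ)) atTop
          (𝓝 (f w * (starRingEnd ℂ) (f w) + ((0 : ℝ) : ℂ))) :=
        tendsto_const_nhds.add ((Complex.continuous_ofReal.tendsto 0).comp hεlim)
      rw [Complex.ofReal_zero, add_zero] at h2
      exact (tendsto_const_nhds.div h2 h1).const_mul _
  set u : ℕ → ℂ → ℂ := fun n => cauchyTransform (g n) with hu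
  have huc : ∀ n, ContDiff ℝ 1 (u n) := fun n => contDiff_cauchyTransform (n := 1) (hgc n) (hgcs n)
  have hud : ∀ n z, dbar (u n) z = g n z := fun n z => dbar_cauchyTransform (hgc n) (hgcs n) z
  set M := cauchyConst R * C with hM
  have hun : ∀ n, ∀ z ∈ Metric.ball c (2 * R), ‖u n z‖ ≤ M := fun n z hz =>
    norm_cauchyTransform_le (hgn n) fun w hw => eq_zero_of_five_mul_le (hg0 n) hz hw
  have hexpc : ∀ n, ContDiff ℝ 1 fun z => Complex.exp (-u n z) := fun n => (huc n).neg.cexp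
  have hexpn : ∀ n, ∀ z ∈ Metric.ball c (2 * R), ‖Complex.exp (-u n z)‖ ≤ Real.exp M :=
    fun n z hz => by
      refine (Complex.norm_exp_le_exp_norm _).trans (Real.exp_le_exp.2 ?_)
      rw [norm_neg]; exact hun n z hz
  -- The price of regularizing: `∂̄(f e^{-u})`, cut off. Subtracting its Cauchy transform from `f
  -- e^{-u}` gives a holomorphic function, and the correction tends to zero uniformly with `√(ε n)`.
  set k : ℕ → ℂ → ℂ := fun n z => χ₂ z * (Complex.exp (-u n z) * (dbar f z - f z * g n z)) with hk
  have hkc : ∀ n, ContDiff ℝ 1 (k n) := fun n =>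
    (hχc χ₂).mul ((hexpc n).mul (hdb.sub (hf1.mul (hgc n))))
  have hk0 : ∀ n w, w ∉ Metric.ball c (2 * R) → k n w = 0 := fun n w hw => by
    simp only [hk]; rw [hχ2 w hw]; simp
  have h23 : Metric.ball c (2 * R) ⊆ Metric.ball c (3 * R) := Metric.ball_subset_ball (by linarith)
  have h12 : Metric.ball c R ⊆ Metric.ball c (2 * R) := Metric.ball_subset_ball (by linarith)
  have hkcs : ∀ n, HasCompactSupport (k n) := fun n =>
    HasCompactSupport.intro (isCompact_closedBall c (2 * R)) fun w hw =>
      hk0 n w fun h => hw (Metric.ball_subset_closedBall h)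
  have hkn : ∀ n w, ‖k n w‖ ≤ Real.exp M * (C * √(ε n)) := fun n w => by
    by_cases hw : w ∈ Metric.ball c (2 * R)
    · have h1 : χ₁ w = 1 := χ₁.one_of_mem_closedBall (Metric.ball_subset_closedBall hw)
      have h2 : dbar f w - f w * g n w = ε n * dbar f w / (f w * (starRingEnd ℂ) (f w) + (ε n : ℂ)) := by
        simp only [hg, h1]
        have := hden1 n w
        field_simp
        push_cast
        ring
      have h3 : ‖dbar f w - f w * g n w‖ ≤ C * √(ε n) := by
        rw [h2, norm_div, norm_mul, hden, Complex.norm_real, Complex.norm_real,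
          Real.norm_of_nonneg (hden0 n w).le, Real.norm_of_nonneg (hε0 n).le,
          div_le_iff₀ (hden0 n w)]
        have h4 := mul_le_mul_of_nonneg_left (hb w (h23 hw)) (hε0 n).le
        -- With `q = √(ε n)` and `t = ‖f w‖` this is `q t ≤ t² + q²`, multiplied by `q`.
        have h5 : ε n * ‖f w‖ ≤ √(ε n) * (‖f w‖ ^ 2 + ε n) := by
          have h6 := Real.mul_self_sqrt (hε0 n).le
          have h7 := Real.sqrt_nonneg (ε n)
          set q := √(ε n)
          rw [← h6]
          nlinarith [sq_nonneg (‖f w‖ - q), norm_nonneg (f w), mul_nonneg h7 (sq_nonneg (‖f w‖ - q)),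
            mul_nonneg h7 (mul_nonneg h7 (norm_nonneg (f w)))]
        have h8 := mul_le_mul_of_nonneg_left h5 hC
        nlinarith
      simp only [hk]
      rw [norm_mul, norm_mul]
      refine (mul_le_of_le_one_left (by positivity) (hχn χ₂ w)).trans ?_
      exact mul_le_mul (hexpn n w hw) h3 (norm_nonneg _) (Real.exp_pos _).le
    · rw [hk0 n w hw, norm_zero]
      positivity
  refine ⟨M, u, fun n z => f z * Complex.exp (-u n z) - cauchyTransform (k n) z, cauchyTransform a,
    fun n => cauchyConst R * (Real.exp M * (C * √(ε n))), fun n => (huc n).continuous,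
    fun n z hz => hun n z (h12 hz), fun z hz => ?_, fun n z hz => ?_, ?_, fun n z hz => ?_⟩
  · exact tendsto_cauchyTransform (fun n => (hgc n).continuous) hgn
      (fun n w hw => eq_zero_of_five_mul_le (hg0 n) (h12 hz) hw) hga
  · refine (differentiableAt_of_dbar_eq_zero ?_ ?_).differentiableWithinAt
    · exact ((hfd z).mul ((hexpc n).differentiable one_ne_zero z)).sub
        ((contDiff_cauchyTransform (n := 1) (hkc n) (hkcs n)).differentiable one_ne_zero z)
    · rw [dbar_sub ((hfd z).fun_mul ((hexpc n).differentiable one_ne_zero z))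
        ((contDiff_cauchyTransform (n := 1) (hkc n) (hkcs n)).differentiable one_ne_zero z),
        dbar_mul (hfd z) ((hexpc n).differentiable one_ne_zero z),
        dbar_cexp_neg ((huc n).differentiable one_ne_zero z), dbar_cauchyTransform (hkc n) (hkcs n),
        hud]
      have h1 : χ₂ z = 1 := χ₂.one_of_mem_closedBall (Metric.ball_subset_closedBall hz)
      simp only [hk, h1]
      push_cast
      ring
  · have h1 : Tendsto (fun n => √(ε n)) atTop (𝓝 0) := by
      have := (Real.continuous_sqrt.tendsto 0).comp hεlim
      rwa [Real.sqrt_zero] at this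
    simpa using ((h1.const_mul C).const_mul (Real.exp M)).const_mul (cauchyConst R)
  · rw [sub_sub_cancel_left, norm_neg]
    exact norm_cauchyTransform_le (hkn n) fun w hw =>
      eq_zero_of_five_mul_le (fun w hw => hk0 n w fun h => hw (h23 h)) (h12 hz) hw

/-- A bounded pointwise limit of holomorphic functions is holomorphic. -/
theorem analyticAt_of_tendsto {H : ℕ → ℂ → ℂ} {F : ℂ → ℂ} {c : ℂ} {R A : ℝ} (hR : 0 < R)
    (hH : ∀ n, DifferentiableOn ℂ (H n) (Metric.ball c R)) (hA : ∀ n, ∀ z ∈ Metric.ball c R, ‖H n z‖ ≤ A)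
    (hF : ∀ z ∈ Metric.ball c R, Tendsto (fun n => H n z) atTop (𝓝 (F z))) : AnalyticAt ℂ F c := by
  obtain ⟨r, hr0, hrR⟩ : ∃ r : NNReal, 0 < r ∧ (r : ℝ) < R :=
    ⟨⟨R / 2, by positivity⟩, NNReal.coe_pos.1 (half_pos hR), half_lt_self hR⟩
  have hsub : Metric.closedBall c r ⊆ Metric.ball c R := Metric.closedBall_subset_ball hrR
  have hmem : ∀ θ, circleMap c r θ ∈ Metric.ball c R := fun θ =>
    hsub (Metric.sphere_subset_closedBall (circleMap_mem_sphere c r.coe_nonneg θ))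
  have hcont : ∀ n, Continuous fun θ => H n (circleMap c r θ) := fun n =>
    (hH n).continuousOn.comp_continuous (continuous_circleMap c r) hmem
  have hmeas : AEStronglyMeasurable (fun θ => F (circleMap c r θ)) :=
    aestronglyMeasurable_of_tendsto_ae atTop (fun n => (hcont n).aestronglyMeasurable)
      (.of_forall fun θ => hF _ (hmem θ))
  have hFA : ∀ z ∈ Metric.ball c R, ‖F z‖ ≤ A := fun z hz =>
    le_of_tendsto (hF z hz).norm (.of_forall fun n => hA n z hz)
  have hci : CircleIntegrable F c r := by
    exact (intervalIntegrable_const (c := A)).mono_fun' hmeas.restrict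
      (.of_forall fun θ => hFA _ (hmem θ))
  have hps := hasFPowerSeriesOn_cauchy_integral hci hr0
  refine hps.analyticAt.congr ?_
  filter_upwards [Metric.ball_mem_nhds c (NNReal.coe_pos.2 hr0)] with w hw
  have h1 : ∀ n, ((2 * Real.pi * Complex.I : ℂ)⁻¹ • ∮ z in C(c, r), (z - w)⁻¹ • H n z) = H n w :=
    fun n => Complex.two_pi_I_inv_smul_circleIntegral_sub_inv_smul_of_differentiable_on_off_countable
      countable_empty hw ((hH n).continuousOn.mono hsub) fun z hz =>
        (hH n).differentiableAt (Metric.isOpen_ball.mem_nhds (hsub (Metric.ball_subset_closedBall hz.1)))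
  have hwne : ∀ θ, circleMap c r θ - w ≠ 0 := fun θ h => by
    have h2 := circleMap_mem_sphere c r.coe_nonneg θ
    rw [sub_eq_zero] at h
    rw [h] at h2
    exact absurd (Metric.mem_sphere.1 h2) (Metric.mem_ball.1 hw).ne
  have hker : Continuous fun θ => (circleMap c r θ - w)⁻¹ :=
    ((continuous_circleMap c r).sub continuous_const).inv₀ hwne
  -- Dominated convergence carries the Cauchy integral formula over to the limit.
  have h2 : Tendsto (fun n => ∮ z in C(c, r), (z - w)⁻¹ • H n z) atTop
      (𝓝 (∮ z in C(c, r), (z - w)⁻¹ • F z)) := by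
    refine intervalIntegral.tendsto_integral_filter_of_dominated_convergence
      (fun θ => ‖deriv (circleMap c r) θ‖ * (‖(circleMap c r θ - w)⁻¹‖ * A)) (.of_forall fun n => ?_)
      (.of_forall fun n => .of_forall fun θ _ => ?_) ?_ (.of_forall fun θ _ => ?_)
    · simp only [deriv_circleMap]
      exact (Continuous.smul ((continuous_circleMap 0 r).mul continuous_const) (hker.smul (hcont n))).aestronglyMeasurable
    · rw [norm_smul, norm_smul]
      gcongr
      exact hA n _ (hmem θ)
    · simp only [deriv_circleMap]
      refine Continuous.intervalIntegrable ?_ _ _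
      exact ((continuous_circleMap 0 r).mul continuous_const).norm.mul (hker.norm.mul continuous_const)
    · exact ((hF _ (hmem θ)).const_smul _).const_smul _
  refine tendsto_nhds_unique (h2.const_smul _) ?_
  simp only [h1]
  exact hF w (hsub (Metric.ball_subset_closedBall hw))

/-- **The similarity principle**: a zero of a solution of `|∂̄f| ≤ C|f|` that does not vanish near
it is isolated and has positive index. -/
theorem eventually_eq_zero_or_hasLocalIndex_pos {f : ℂ → ℂ} (hf : ContDiff ℝ 2 f) {c : ℂ} {R C : ℝ}
    (hR : 0 < R) (hb : ∀ z ∈ Metric.ball c R, ‖dbar f z‖ ≤ C * ‖f z‖) (h0 : f c = 0) :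
    (∀ᶠ z in 𝓝 c, f z = 0) ∨ (∀ᶠ z in 𝓝[≠] c, f z ≠ 0) ∧ ∃ k : ℤ, 0 < k ∧ HasLocalIndex f c k := by
  -- The sign of `C` is not prescribed, so `|C|` is used; the radius `R / 3` leaves room for the
  -- cut-offs.
  obtain ⟨M, u, H, v, δ, huc, hun, hul, hH, hδ, hHf⟩ := exists_holomorphic_approx hf
    (show 0 < R / 3 by positivity) (abs_nonneg C) (fun z hz => (hb z (by
      rwa [mul_div_cancel₀ R three_ne_zero] at hz)).trans
        (mul_le_mul_of_nonneg_right (le_abs_self C) (norm_nonneg _)))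
  set ρ := R / 3
  have hρ : 0 < ρ := by positivity
  have hfc : Continuous f := hf.continuous
  have hexp : ∀ n, ∀ z ∈ Metric.ball c ρ, ‖Complex.exp (-u n z)‖ ≤ Real.exp M := fun n z hz => by
    refine (Complex.norm_exp_le_exp_norm _).trans (Real.exp_le_exp.2 ?_)
    rw [norm_neg]; exact hun n z hz
  have hexp' : ∀ n, ∀ z ∈ Metric.ball c ρ, Real.exp (-M) ≤ ‖Complex.exp (-u n z)‖ := fun n z hz => by
    rw [Complex.norm_exp, Real.exp_le_exp, Complex.neg_re, neg_le_neg_iff]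
    exact (Complex.re_le_norm _).trans (hun n z hz)
  obtain ⟨A₀, hA₀⟩ := (isCompact_closedBall c ρ).exists_bound_of_continuousOn hfc.continuousOn
  obtain ⟨Δ, hΔ⟩ := hδ.bddAbove_range
  have hHA : ∀ n, ∀ z ∈ Metric.ball c ρ, ‖H n z‖ ≤ Δ + A₀ * Real.exp M := fun n z hz => by
    have e : H n z = (H n z - f z * Complex.exp (-u n z)) + f z * Complex.exp (-u n z) := by ring
    rw [e]
    refine (norm_add_le _ _).trans (add_le_add ((hHf n z hz).trans (hΔ ⟨n, rfl⟩)) ?_)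
    rw [norm_mul]
    have h1 := hA₀ z (Metric.ball_subset_closedBall hz)
    exact mul_le_mul h1 (hexp n z hz) (norm_nonneg _) ((norm_nonneg _).trans h1)
  -- This function has the same zeros as `f`, which gives the alternative. The limit `v` is not
  -- known to be continuous here, so the index is computed below with a fixed `u n`.
  have hF : AnalyticAt ℂ (fun z => f z * Complex.exp (-v z)) c :=
    analyticAt_of_tendsto hρ hH hHA fun z hz => by
      have h1 : Tendsto (fun n => f z * Complex.exp (-u n z)) atTop
          (𝓝 (f z * Complex.exp (-v z))) :=
        ((Complex.continuous_exp.tendsto _).comp (hul z hz).neg).const_mul _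
      have h2 : Tendsto (fun n => H n z - f z * Complex.exp (-u n z)) atTop (𝓝 0) :=
        squeeze_zero_norm (fun n => hHf n z hz) hδ
      simpa using h2.add h1
  rcases hF.eventually_eq_zero_or_eventually_ne_zero with h | h
  · refine .inl (h.mono fun z hz => (mul_eq_zero.1 hz).resolve_right (Complex.exp_ne_zero _))
  · have hiso : ∀ᶠ z in 𝓝[≠] c, f z ≠ 0 := h.mono fun z hz h0 => hz (by simp [h0])
    refine .inr ⟨hiso, ?_⟩
    obtain ⟨k, hk⟩ := exists_hasLocalIndex (.of_forall fun z => hfc.continuousAt) hiso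
    refine ⟨k, ?_, hk⟩
    obtain ⟨r, ⟨⟨hkr, hne⟩, hrρ⟩, hr0 : 0 < r⟩ := (((hk.and (eventually_forall_ball
      (eventually_nhdsWithin_iff.1 hiso))).and (Iio_mem_nhds hρ |> nhdsWithin_le_nhds)).and
        self_mem_nhdsWithin).exists
    have hsub : Metric.closedBall c r ⊆ Metric.ball c ρ := Metric.closedBall_subset_ball hrρ
    have hne' : ∀ z ∈ Metric.sphere c r, f z ≠ 0 := fun z hz =>
      hne z (Metric.sphere_subset_closedBall hz) (Metric.ne_of_mem_sphere hz hr0.ne')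
    obtain ⟨m, hm, hmf⟩ := exists_pos_le_norm (isCompact_sphere c r) hfc.continuousOn hne'
    -- On the circle the modulus of `F` is at least `m e^{-M}`. Passing from `F` to `H n - H n c`
    -- costs `δ n` twice, which explains the factor one half. The new function vanishes at `c`, so
    -- its index is positive.
    obtain ⟨n, hn⟩ := (hδ.eventually_lt_const
      (show 0 < m * Real.exp (-M) / 2 by positivity)).exists
    set F : ℂ → ℂ := fun z => f z * Complex.exp (-u n z) with hFdef
    have hFk : CircleIndex F c r k := by
      have h1 : CircleIndex (fun z => Complex.exp (-u n z)) c r 0 := circleIndex_zero hr0.le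
        (Complex.continuous_exp.comp (huc n).neg).continuousOn fun z _ => Complex.exp_ne_zero _
      simpa using hkr.mul h1
    have hFc : Continuous F := hfc.mul (Complex.continuous_exp.comp (huc n).neg)
    have hHc : Continuous fun t => H n (circleMap c r t) :=
      (hH n).continuousOn.comp_continuous (continuous_circleMap c r) fun t =>
        hsub (Metric.sphere_subset_closedBall (circleMap_mem_sphere c hr0.le t))
    have hFm : ∀ z ∈ Metric.sphere c r, m * Real.exp (-M) ≤ ‖F z‖ := fun z hz => by
      simp only [hFdef]
      rw [norm_mul]
      exact mul_le_mul (hmf z hz) (hexp' n z (hsub (Metric.sphere_subset_closedBall hz)))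
        (Real.exp_pos _).le (norm_nonneg _)
    have hHcn : ‖H n c‖ ≤ δ n := by
      have := hHf n c (Metric.mem_ball_self hρ)
      rwa [h0, zero_mul, sub_zero] at this
    have hclose : ∀ z ∈ Metric.sphere c r, ‖(H n z - H n c) - F z‖ < ‖F z‖ := fun z hz => by
      have h1 := hHf n z (hsub (Metric.sphere_subset_closedBall hz))
      have e : (H n z - H n c) - F z = (H n z - F z) - H n c := by ring
      rw [e]
      have h2 := norm_sub_le (H n z - F z) (H n c)
      have h3 := hFm z hz
      linarith
    have hHk : CircleIndex (fun z => H n z - H n c) c r k := by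
      refine HasWindingNumber.of_close hFk (hFc.comp (continuous_circleMap c r))
        (hHc.sub continuous_const) (by rw [circleMap_two_pi]) (by rw [circleMap_two_pi]) fun t => ?_
      exact hclose _ (circleMap_mem_sphere c hr0.le t)
    refine circleIndex_pos_of_differentiableOn hr0 hrρ ((hH n).sub_const _) (sub_self _)
      (fun z hz hz0 => ?_) hHk
    have := hclose z hz
    rw [hz0, zero_sub, norm_neg] at this
    exact lt_irrefl _ this

end Similarity

/-! ### The Cauchy–Riemann inequality for closed anti-invariant forms along holomorphic disks -/

section Flat

theorem two_le_infty : (1 : WithTop ℕ∞) + 1 ≤ ∞ := by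
  exact WithTop.coe_le_coe.2 le_top

/-- A closed anti-invariant form near a holomorphic disk, in a chart: `f = B(u_x, n) - i B(u_y, n)`
satisfies an equation `∂̄f = O(B)`. -/
structure HolomorphicDisk (T : Set R4) (𝒥 : R4 → R4 →L[ℝ] R4) (B : R4 → Bil) (u : ℂ → R4)
    (z : ℂ) : Prop where
  isOpen : IsOpen T
  mem : u z ∈ T
  J_sq : ∀ y ∈ T, ∀ v, 𝒥 y (𝒥 y v) = -v
  antiInv : ∀ y ∈ T, AntiInv (𝒥 y) (B y)
  contDiffOn_J : ContDiffOn ℝ ∞ 𝒥 T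
  contDiffOn_B : ContDiffOn ℝ ∞ B T
  closed : ∀ y ∈ T, ∀ a b c : R4,
    fderiv ℝ B y a b c + fderiv ℝ B y b c a + fderiv ℝ B y c a b = 0
  contDiffAt : ∀ᶠ w in 𝓝 z, ContDiffAt ℝ ∞ u w
  holomorphic : ∀ᶠ w in 𝓝 z, fderiv ℝ u w Complex.I = 𝒥 (u w) (fderiv ℝ u w 1)

namespace HolomorphicDisk

variable {T : Set R4} {𝒥 : R4 → R4 →L[ℝ] R4} {B : R4 → Bil} {u : ℂ → R4} {z : ℂ}

theorem fderiv_B_swap (h : HolomorphicDisk T 𝒥 B u z) {y : R4} (hy : y ∈ T) (N a b : R4) :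
    fderiv ℝ B y N a b = -fderiv ℝ B y N b a := by
  have hB := ((h.contDiffOn_B.contDiffAt (h.isOpen.mem_nhds hy)).differentiableAt
    (by simp)).hasFDerivAt
  have h1 := (hB.clm_apply (hasFDerivAt_const a y)).clm_apply (hasFDerivAt_const b y)
  have h2 := ((hB.clm_apply (hasFDerivAt_const b y)).clm_apply (hasFDerivAt_const a y)).neg
  have h3 : (fun y => B y a b) =ᶠ[𝓝 y] fun y => -B y b a := by
    filter_upwards [h.isOpen.mem_nhds hy] with w hw using (h.antiInv w hw).1 a b
  have := congrArg (fun L : R4 →L[ℝ] ℝ => L N) (h1.unique (h2.congr_of_eventuallyEq h3))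
  simpa using this

/-- Differentiate `B(a, 𝒥a) = 0` with `a` constant: a derivative of `B` is traded for one of `𝒥`. -/
theorem fderiv_B_self_J (h : HolomorphicDisk T 𝒥 B u z) {y : R4} (hy : y ∈ T) (N a : R4) :
    fderiv ℝ B y N a (𝒥 y a) = -B y a (fderiv ℝ 𝒥 y N a) := by
  have hB := ((h.contDiffOn_B.contDiffAt (h.isOpen.mem_nhds hy)).differentiableAt
    (by simp)).hasFDerivAt
  have hJ := ((h.contDiffOn_J.contDiffAt (h.isOpen.mem_nhds hy)).differentiableAt
    (by simp)).hasFDerivAt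
  have h1 := (hB.clm_apply (hasFDerivAt_const a y)).clm_apply (hJ.clm_apply (hasFDerivAt_const a y))
  have h3 : (fun y => B y a (𝒥 y a)) =ᶠ[𝓝 y] fun _ => 0 := by
    filter_upwards [h.isOpen.mem_nhds hy] with w hw using (h.antiInv w hw).self_J (h.J_sq w hw) a
  have := congrArg (fun L : R4 →L[ℝ] ℝ => L N)
    (h1.unique ((hasFDerivAt_const (0 : ℝ) y).congr_of_eventuallyEq h3))
  simp at this
  linarith

theorem hasFDerivAt_apply_apply (h : HolomorphicDisk T 𝒥 B u z) {N : ℂ → R4}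
    (hN : DifferentiableAt ℝ N z) (a : ℂ) :
    ∃ L : ℂ →L[ℝ] ℝ, HasFDerivAt (fun w => B (u w) (fderiv ℝ u w a) (N w)) L z ∧ ∀ v, L v =
      fderiv ℝ B (u z) (fderiv ℝ u z v) (fderiv ℝ u z a) (N z) +
        B (u z) (fderiv ℝ (fderiv ℝ u) z v a) (N z) + B (u z) (fderiv ℝ u z a) (fderiv ℝ N z v) := by
  have hB := ((h.contDiffOn_B.contDiffAt (h.isOpen.mem_nhds h.mem)).differentiableAt
    (by simp)).hasFDerivAt
  have hu := (h.contDiffAt.self_of_nhds.differentiableAt (by simp)).hasFDerivAt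
  have hu2 : HasFDerivAt (fderiv ℝ u) (fderiv ℝ (fderiv ℝ u) z) z :=
    ((h.contDiffAt.self_of_nhds.fderiv_right (m := 1) two_le_infty).differentiableAt
      one_ne_zero).hasFDerivAt
  have h1 := ((hB.comp z hu).clm_apply (hu2.clm_apply (hasFDerivAt_const a z))).clm_apply
    hN.hasFDerivAt
  refine ⟨_, h1, fun v => ?_⟩
  simp
  ring

/-- The antisymmetrized derivative is of order zero in the form. -/
theorem exists_hasFDerivAt_pair (h : HolomorphicDisk T 𝒥 B u z) {N : ℂ → R4}
    (hN : DifferentiableAt ℝ N z) : ∃ P Q : ℂ →L[ℝ] ℝ,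
      HasFDerivAt (fun w => B (u w) (fderiv ℝ u w 1) (N w)) P z ∧
      HasFDerivAt (fun w => B (u w) (fderiv ℝ u w Complex.I) (N w)) Q z ∧
      P Complex.I - Q 1 = -B (u z) (fderiv ℝ u z 1) (fderiv ℝ 𝒥 (u z) (N z) (fderiv ℝ u z 1)) +
        B (u z) (fderiv ℝ u z 1) (fderiv ℝ N z Complex.I) -
        B (u z) (fderiv ℝ u z Complex.I) (fderiv ℝ N z 1) := by
  obtain ⟨P, hP, hP'⟩ := h.hasFDerivAt_apply_apply hN 1
  obtain ⟨Q, hQ, hQ'⟩ := h.hasFDerivAt_apply_apply hN Complex.I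
  refine ⟨P, Q, hP, hQ, ?_⟩
  have hsym : fderiv ℝ (fderiv ℝ u) z Complex.I 1 = fderiv ℝ (fderiv ℝ u) z 1 Complex.I :=
    (h.contDiffAt.self_of_nhds.isSymmSndFDerivAt (by simpa [one_add_one_eq_two] using two_le_infty)) _ _
  -- Closedness on `(u_x, N, u_y)` turns the derivatives of `B` along the disk into `D_N B(u_x,
  -- u_y)`, which is of order zero by `fderiv_B_self_J` as `u_y = 𝒥u_x`. The second derivatives of
  -- `u` cancel by symmetry.
  have h1 := h.closed _ h.mem (fderiv ℝ u z 1) (N z) (fderiv ℝ u z Complex.I)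
  have h2 := h.fderiv_B_swap h.mem (N z) (fderiv ℝ u z Complex.I) (fderiv ℝ u z 1)
  have h3 := h.fderiv_B_self_J h.mem (N z) (fderiv ℝ u z 1)
  rw [← h.holomorphic.self_of_nhds] at h3
  have h4 := h.fderiv_B_swap h.mem (fderiv ℝ u z 1) (N z) (fderiv ℝ u z Complex.I)
  rw [hP', hQ', hsym]
  linarith

/-- With `f = p - iq`, twice `∂̄f` is `(p_x + q_y) + i(p_y - q_x)`. The imaginary part is the
antisymmetrized derivative for `N = n`. Since `B(u_y, n) = B(u_x, 𝒥n)` and `B(u_y, 𝒥n) = -B(u_x,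
n)`, the real part is the one for `N = 𝒥n`. -/
theorem dbar_eq (h : HolomorphicDisk T 𝒥 B u z) (n : R4) :
    dbar (fun w => evalPair (𝒥 (u w)) (fderiv ℝ u w 1) n (B (u w))) z =
      (((-B (u z) (fderiv ℝ u z 1) (fderiv ℝ 𝒥 (u z) (𝒥 (u z) n) (fderiv ℝ u z 1)) +
        B (u z) (fderiv ℝ u z 1) (fderiv ℝ (fun w => 𝒥 (u w) n) z Complex.I) -
        B (u z) (fderiv ℝ u z Complex.I) (fderiv ℝ (fun w => 𝒥 (u w) n) z 1) : ℝ) : ℂ) +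
      Complex.I *
        ((-B (u z) (fderiv ℝ u z 1) (fderiv ℝ 𝒥 (u z) n (fderiv ℝ u z 1)) : ℝ) : ℂ)) / 2 := by
  have hN : DifferentiableAt ℝ (fun w => 𝒥 (u w) n) z := by
    have h1 := (h.contDiffOn_J.contDiffAt (h.isOpen.mem_nhds h.mem)).differentiableAt (by simp)
    have h2 := h.contDiffAt.self_of_nhds.differentiableAt (by simp)
    exact (h1.comp z h2).clm_apply (differentiableAt_const n)
  obtain ⟨P, Q, hP, hQ, hPQ⟩ := h.exists_hasFDerivAt_pair (differentiableAt_const (c := n))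
  obtain ⟨P', Q', hP', hQ', hPQ'⟩ := h.exists_hasFDerivAt_pair hN
  have hT : ∀ᶠ w in 𝓝 z, u w ∈ T :=
    h.contDiffAt.self_of_nhds.continuousAt (h.isOpen.mem_nhds h.mem)
  have e1 : Q = P' := by
    refine hQ.unique (hP'.congr_of_eventuallyEq ?_)
    filter_upwards [hT, h.holomorphic] with w hw hw'
    rw [hw', (h.antiInv _ hw).swap (h.J_sq _ hw)]
  have e2 : P = -Q' := by
    refine hP.unique (hQ'.neg.congr_of_eventuallyEq ?_)
    filter_upwards [hT, h.holomorphic] with w hw hw'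
    simp only [Pi.neg_apply]
    rw [hw', (h.antiInv _ hw).2, neg_neg]
  have hf : HasFDerivAt (fun w => evalPair (𝒥 (u w)) (fderiv ℝ u w 1) n (B (u w)))
      (Complex.ofRealCLM.comp P - (Complex.ofRealCLM.comp Q).smulRight Complex.I) z := by
    have h1 := (Complex.ofRealCLM.hasFDerivAt.comp z hP).sub
      ((Complex.ofRealCLM.hasFDerivAt.comp z hQ).mul_const' Complex.I)
    have h2 : HasFDerivAt (fun w => ((B (u w) (fderiv ℝ u w 1) n : ℝ) : ℂ) -
        ((B (u w) (fderiv ℝ u w Complex.I) n : ℝ) : ℂ) * Complex.I)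
        (Complex.ofRealCLM.comp P - (Complex.ofRealCLM.comp Q).smulRight Complex.I) z := by
      refine h1.congr_fderiv ?_
      ext v
      simp [mul_comm]
    refine h2.congr_of_eventuallyEq ?_
    filter_upwards [h.holomorphic] with w hw
    rw [evalPair, hw]
  rw [dbar_of_hasFDerivAt hf]
  have h5 : P 1 + Q Complex.I = P' Complex.I - Q' 1 := by rw [e1, e2]; simp; ring
  rw [hPQ'] at h5
  rw [← h5]
  have h6 : P Complex.I - Q 1 = -B (u z) (fderiv ℝ u z 1) (fderiv ℝ 𝒥 (u z) n (fderiv ℝ u z 1)) := by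
    rw [hPQ]; simp
  rw [← h6]
  simp
  linear_combination (-(Q Complex.I : ℂ)) * Complex.I_mul_I

theorem eventually_holomorphicDisk (h : HolomorphicDisk T 𝒥 B u z) :
    ∀ᶠ w in 𝓝 z, HolomorphicDisk T 𝒥 B u w := by
  have hT : ∀ᶠ w in 𝓝 z, u w ∈ T :=
    h.contDiffAt.self_of_nhds.continuousAt (h.isOpen.mem_nhds h.mem)
  filter_upwards [hT, eventually_eventually_nhds.2 h.contDiffAt,
    eventually_eventually_nhds.2 h.holomorphic] with w h1 h2 h3
  exact ⟨h.isOpen, h1, h.J_sq, h.antiInv, h.contDiffOn_J, h.contDiffOn_B, h.closed, h2, h3⟩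

theorem contDiffAt_J_comp (h : HolomorphicDisk T 𝒥 B u z) :
    ContDiffAt ℝ ∞ (fun w => 𝒥 (u w)) z :=
  (h.contDiffOn_J.contDiffAt (h.isOpen.mem_nhds h.mem)).comp z h.contDiffAt.self_of_nhds

theorem contDiffAt_B_comp (h : HolomorphicDisk T 𝒥 B u z) :
    ContDiffAt ℝ ∞ (fun w => B (u w)) z :=
  (h.contDiffOn_B.contDiffAt (h.isOpen.mem_nhds h.mem)).comp z h.contDiffAt.self_of_nhds

theorem contDiffAt_fderiv (h : HolomorphicDisk T 𝒥 B u z) :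
    ContDiffAt ℝ ∞ (fderiv ℝ u) z :=
  h.contDiffAt.self_of_nhds.fderiv_right (m := ∞) (by simp)

theorem contDiffAt_evalPair (h : HolomorphicDisk T 𝒥 B u z) (n : R4) :
    ContDiffAt ℝ ∞ (fun w => evalPair (𝒥 (u w)) (fderiv ℝ u w 1) n (B (u w))) z := by
  have h1 : ContDiffAt ℝ ∞ (fun w => fderiv ℝ u w 1) z :=
    h.contDiffAt_fderiv.clm_apply contDiffAt_const
  have h2 := (h.contDiffAt_B_comp.clm_apply h1).clm_apply (contDiffAt_const (c := n))
  have h3 := (h.contDiffAt_B_comp.clm_apply (h.contDiffAt_J_comp.clm_apply h1)).clm_apply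
    (contDiffAt_const (c := n))
  exact (Complex.ofRealCLM.contDiff.contDiffAt.comp z h2).sub
    ((Complex.ofRealCLM.contDiff.contDiffAt.comp z h3).mul contDiffAt_const)

theorem exists_norm_dbar_le (h : HolomorphicDisk T 𝒥 B u z) (n : R4) : ∃ C, ∀ᶠ w in 𝓝 z,
    ‖dbar (fun w => evalPair (𝒥 (u w)) (fderiv ℝ u w 1) n (B (u w))) w‖ ≤ C * ‖B (u w)‖ := by
  have hu : ContinuousAt (fderiv ℝ u) z := h.contDiffAt_fderiv.continuousAt
  have hJu : ContinuousAt (fun w => 𝒥 (u w)) z := h.contDiffAt_J_comp.continuousAt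
  have hDJ : ContinuousAt (fun w => fderiv ℝ 𝒥 (u w)) z :=
    (((h.contDiffOn_J.contDiffAt (h.isOpen.mem_nhds h.mem)).fderiv_right (m := ∞)
      (by simp)).continuousAt).comp h.contDiffAt.self_of_nhds.continuousAt
  have hDN : ContinuousAt (fderiv ℝ fun w => 𝒥 (u w) n) z :=
    ((h.contDiffAt_J_comp.clm_apply (contDiffAt_const (c := n))).fderiv_right (m := ∞)
      (by simp)).continuousAt
  let G : ℂ → ℝ := fun w =>
    ‖fderiv ℝ u w 1‖ * ‖fderiv ℝ 𝒥 (u w) (𝒥 (u w) n) (fderiv ℝ u w 1)‖ +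
      ‖fderiv ℝ u w 1‖ * ‖fderiv ℝ (fun w => 𝒥 (u w) n) w Complex.I‖ +
      ‖fderiv ℝ u w Complex.I‖ * ‖fderiv ℝ (fun w => 𝒥 (u w) n) w 1‖ +
      ‖fderiv ℝ u w 1‖ * ‖fderiv ℝ 𝒥 (u w) n (fderiv ℝ u w 1)‖
  have hu1 : ContinuousAt (fun w => fderiv ℝ u w 1) z := hu.clm_apply continuousAt_const
  have huI : ContinuousAt (fun w => fderiv ℝ u w Complex.I) z := hu.clm_apply continuousAt_const
  have hG : ContinuousAt G z :=
    (((hu1.norm.mul ((hDJ.clm_apply (hJu.clm_apply continuousAt_const)).clm_apply hu1).norm).add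
      (hu1.norm.mul (hDN.clm_apply continuousAt_const).norm)).add
      (huI.norm.mul (hDN.clm_apply continuousAt_const).norm)).add
      (hu1.norm.mul ((hDJ.clm_apply continuousAt_const).clm_apply hu1).norm)
  refine ⟨G z + 1, ?_⟩
  filter_upwards [h.eventually_holomorphicDisk,
    hG.eventually_lt continuousAt_const (lt_add_one (G z))] with w hw hlt
  rw [hw.dbar_eq n, norm_div, Complex.norm_ofNat]
  have hop : ∀ a b : R4, |B (u w) a b| ≤ ‖B (u w)‖ * (‖a‖ * ‖b‖) := fun a b => by
    rw [← mul_assoc]; exact (B (u w)).le_opNorm₂ a b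
  have key : ‖B (u w)‖ * G w ≤ (G z + 1) * ‖B (u w)‖ := by
    rw [mul_comm]; exact mul_le_mul_of_nonneg_right hlt.le (norm_nonneg _)
  refine le_trans (div_le_self (norm_nonneg _) one_le_two) (le_trans ?_ key)
  refine (norm_add_le _ _).trans ?_
  rw [norm_mul, Complex.norm_I, one_mul, Complex.norm_real, Complex.norm_real, norm_neg,
    Real.norm_eq_abs, Real.norm_eq_abs]
  have h1 := hop (fderiv ℝ u w 1) (fderiv ℝ 𝒥 (u w) (𝒥 (u w) n) (fderiv ℝ u w 1))
  have h2 := hop (fderiv ℝ u w 1) (fderiv ℝ (fun w => 𝒥 (u w) n) w Complex.I)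
  have h3 := hop (fderiv ℝ u w Complex.I) (fderiv ℝ (fun w => 𝒥 (u w) n) w 1)
  have h4 := hop (fderiv ℝ u w 1) (fderiv ℝ 𝒥 (u w) n (fderiv ℝ u w 1))
  have h5 : ∀ a b c : ℝ, |-a + b - c| ≤ |a| + |b| + |c| := fun a b c =>
    (abs_sub _ _).trans (add_le_add_left ((abs_add_le _ _).trans (by rw [abs_neg])) _)
  have h6 := h5 (B (u w) (fderiv ℝ u w 1) (fderiv ℝ 𝒥 (u w) (𝒥 (u w) n) (fderiv ℝ u w 1)))
    (B (u w) (fderiv ℝ u w 1) (fderiv ℝ (fun w => 𝒥 (u w) n) w Complex.I))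
    (B (u w) (fderiv ℝ u w Complex.I) (fderiv ℝ (fun w => 𝒥 (u w) n) w 1))
  simp only [G, mul_add]
  linarith

/-- Along a holomorphic disk a closed anti-invariant form, written as a multiple of a local frame
of the anti-invariant forms, vanishes identically or has isolated zeros of positive index. -/
theorem eventually_eq_zero_or_hasLocalIndex_pos (h : HolomorphicDisk T 𝒥 B u z)
    (himm : fderiv ℝ u z 1 ≠ 0) (h0 : B (u z) = 0) {b : ℂ → Bil}
    (hb : ∀ᶠ w in 𝓝 z, ContinuousAt b w) (hban : ∀ᶠ w in 𝓝 z, AntiInv (𝒥 (u w)) (b w))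
    (hb0 : b z ≠ 0) {Φ ψ : ℂ → ℂ} (hψ : ∀ᶠ w in 𝓝 z, ContinuousAt ψ w) (hψ0 : ψ z ≠ 0)
    (hΦ : ∀ᶠ w in 𝓝 z, ∀ s t : ℝ, B (u w) = s • b w + t • (b w).comp (𝒥 (u w)) →
      Φ w = (s + t * Complex.I) * ψ w) :
    (∀ᶠ w in 𝓝 z, B (u w) = 0) ∨ ((∀ᶠ w in 𝓝[≠] z, B (u w) ≠ 0) ∧
      ∃ k : ℤ, 0 < k ∧ HasLocalIndex Φ z k) := by
  -- A complex line has real dimension two, so some `n` is independent of `u_x` over `ℂ`; pairing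
  -- with it is then a complex coordinate on the anti-invariant forms.
  obtain ⟨n, hn⟩ : ∃ n : R4, ∀ s t : ℝ, n ≠ s • fderiv ℝ u z 1 + t • 𝒥 (u z) (fderiv ℝ u z 1) := by
    by_contra hcon
    push Not at hcon
    have htop : Submodule.span ℝ (range ![fderiv ℝ u z 1, 𝒥 (u z) (fderiv ℝ u z 1)]) = ⊤ := by
      refine Submodule.eq_top_iff'.2 fun v => ?_
      obtain ⟨s, t, hst⟩ := hcon v
      rw [Submodule.mem_span_range_iff_exists_fun]
      exact ⟨![s, t], by simp [Fin.sum_univ_two, hst]⟩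
    have h1 := finrank_range_le_card (R := ℝ) ![fderiv ℝ u z 1, 𝒥 (u z) (fderiv ℝ u z 1)]
    rw [Set.finrank, htop, finrank_top] at h1
    simp at h1
  obtain ⟨f, hf⟩ : ∃ f : ℂ → ℂ,
      f = fun w => evalPair (𝒥 (u w)) (fderiv ℝ u w 1) n (B (u w)) := ⟨_, rfl⟩
  obtain ⟨g, hg⟩ : ∃ g : ℂ → ℂ,
      g = fun w => evalPair (𝒥 (u w)) (fderiv ℝ u w 1) n (b w) := ⟨_, rfl⟩
  have hgc : ∀ᶠ w in 𝓝 z, ContinuousAt g w := by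
    filter_upwards [h.eventually_holomorphicDisk, hb] with w hw hbw
    have h1 := hw.contDiffAt_fderiv.continuousAt
    have h2 := hw.contDiffAt_J_comp.continuousAt
    have h3 : ContinuousAt (fun w => fderiv ℝ u w 1) w := h1.clm_apply continuousAt_const
    rw [hg]
    exact (Complex.continuous_ofReal.continuousAt.comp
      ((hbw.clm_apply h3).clm_apply continuousAt_const)).sub
      ((Complex.continuous_ofReal.continuousAt.comp
        ((hbw.clm_apply (h2.clm_apply h3)).clm_apply continuousAt_const)).mul continuousAt_const)
  have hg0 : g z ≠ 0 := fun h1 => by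
    have hre := congrArg Complex.re h1
    have him := congrArg Complex.im h1
    simp [hg, evalPair] at hre him
    exact hb0 (hban.self_of_nhds.eq_zero (h.J_sq _ h.mem) himm hn hre him)
  -- The same coefficient `s + ti` relates `B` to the frame `b`, `f` to `g` and `Φ` to `ψ`.
  have hcoef : ∀ᶠ w in 𝓝 z, ∃ s t : ℝ, B (u w) = s • b w + t • (b w).comp (𝒥 (u w)) ∧
      f w = (s + t * Complex.I) * g w ∧ Φ w = (s + t * Complex.I) * ψ w := by
    filter_upwards [h.eventually_holomorphicDisk, hban, hb.self_of_nhds.eventually_ne hb0, hΦ]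
      with w hw hbw hbw0 hΦw
    obtain ⟨s, t, hst⟩ := hbw.exists_eq (hw.J_sq _ hw.mem) hbw0 (hw.antiInv _ hw.mem)
    refine ⟨s, t, hst, ?_, hΦw s t hst⟩
    simp only [hf, hg]
    rw [hst, evalPair_add_smul, evalPair_comp_J (hw.J_sq _ hw.mem)]
    ring
  -- As `g` does not vanish near `z`, `f` controls `B`; this turns `|∂̄f| ≤ C|B|` into the
  -- hypothesis of the similarity principle.
  have hfB : ∃ C, ∀ᶠ w in 𝓝 z, ‖B (u w)‖ ≤ C * ‖f w‖ := by
    have h1 : ContinuousAt (fun w => (‖b w‖ + ‖b w‖ * ‖𝒥 (u w)‖) / ‖g w‖) z := by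
      have h2 := h.contDiffAt_J_comp.continuousAt
      have h3 := hb.self_of_nhds
      exact ContinuousAt.div (h3.norm.add (h3.norm.mul h2.norm)) hgc.self_of_nhds.norm (by simpa using hg0)
    refine ⟨(‖b z‖ + ‖b z‖ * ‖𝒥 (u z)‖) / ‖g z‖ + 1, ?_⟩
    filter_upwards [hcoef, h1.eventually_lt continuousAt_const (lt_add_one _),
      hgc.self_of_nhds.eventually_ne hg0] with w ⟨s, t, hst, hfw, _⟩ hlt hgw
    have hc : ‖f w‖ = ‖(s + t * Complex.I : ℂ)‖ * ‖g w‖ := by rw [hfw, norm_mul]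
    have hs : |s| ≤ ‖(s + t * Complex.I : ℂ)‖ := by
      simpa using Complex.abs_re_le_norm (s + t * Complex.I : ℂ)
    have ht : |t| ≤ ‖(s + t * Complex.I : ℂ)‖ := by
      simpa using Complex.abs_im_le_norm (s + t * Complex.I : ℂ)
    have h4 : ‖B (u w)‖ ≤ ‖(s + t * Complex.I : ℂ)‖ * (‖b w‖ + ‖b w‖ * ‖𝒥 (u w)‖) := by
      rw [hst, mul_add]
      refine (norm_add_le _ _).trans ?_
      rw [norm_smul, norm_smul, Real.norm_eq_abs, Real.norm_eq_abs]
      exact add_le_add (by gcongr) (by gcongr; exact ContinuousLinearMap.opNorm_comp_le _ _)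
    refine h4.trans ?_
    have h5 : 0 < ‖g w‖ := norm_pos_iff.2 hgw
    calc _ = (‖b w‖ + ‖b w‖ * ‖𝒥 (u w)‖) / ‖g w‖ * ‖f w‖ := by rw [hc]; field_simp
      _ ≤ _ := mul_le_mul_of_nonneg_right hlt.le (norm_nonneg _)
  obtain ⟨C₁, hC₁⟩ := h.exists_norm_dbar_le n
  rw [← hf] at hC₁
  obtain ⟨C₂, hC₂⟩ := hfB
  -- The similarity principle is stated for functions of class `C²` on the plane, so `f` is cut off
  -- away from `z`.
  obtain ⟨F, hF, hFf⟩ : ∃ F : ℂ → ℂ, ContDiff ℝ 2 F ∧ F =ᶠ[𝓝 z] f := by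
    have h1 : ∀ᶠ w in 𝓝 z, ContDiffAt ℝ ∞ f w := by
      filter_upwards [h.eventually_holomorphicDisk] with w hw
      rw [hf]; exact hw.contDiffAt_evalPair n
    obtain ⟨ε, hε, h1⟩ := Metric.eventually_nhds_iff_ball.1 h1
    let χ : ContDiffBump z := ⟨ε / 4, ε / 2, by positivity, by linarith⟩
    refine ⟨fun w => (χ w : ℂ) * f w, ?_, ?_⟩
    · rw [contDiff_iff_contDiffAt]
      intro w
      by_cases hw : w ∈ Metric.ball z ε
      · exact ((Complex.ofRealCLM.contDiff.comp χ.contDiff).contDiffAt).mul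
          ((h1 w hw).of_le (by simpa [one_add_one_eq_two] using two_le_infty))
      · have hw2 : w ∉ tsupport χ := fun hmem => by
          rw [χ.tsupport_eq] at hmem
          exact hw (Metric.closedBall_subset_ball (by change ε / 2 < ε; linarith) hmem)
        have h3 : (fun w => (χ w : ℂ) * f w) =ᶠ[𝓝 w] fun _ => 0 := by
          filter_upwards [(isClosed_tsupport χ).isOpen_compl.mem_nhds hw2] with v hv
          rw [image_eq_zero_of_notMem_tsupport hv]; simp
        exact contDiffAt_const.congr_of_eventuallyEq h3
    · filter_upwards [χ.eventuallyEq_one] with w hw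
      simp [hw]
  have hbound : ∀ᶠ w in 𝓝 z, ‖dbar F w‖ ≤ (max C₁ 0 * C₂) * ‖F w‖ := by
    filter_upwards [hC₁, hC₂, eventually_eventually_nhds.2 hFf] with w h1 h2 h3
    have h4 : dbar F w = dbar f w := by
      unfold dbar; rw [Filter.EventuallyEq.fderiv_eq h3]
    rw [h4, h3.self_of_nhds, mul_assoc]
    exact h1.trans (mul_le_mul (le_max_left _ _) h2 (norm_nonneg _) (le_max_right _ _))
  obtain ⟨R, hR, hball⟩ := Metric.eventually_nhds_iff_ball.1 hbound
  have hF0 : F z = 0 := by rw [hFf.self_of_nhds]; simp [hf, h0, evalPair]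
  rcases DiskIndex.eventually_eq_zero_or_hasLocalIndex_pos hF hR hball hF0 with hz | ⟨hne, k, hk, hkF⟩
  · left
    filter_upwards [hz, hFf, hC₂] with w h1 h2 h3
    rw [← h2, h1, norm_zero, mul_zero] at h3
    exact norm_le_zero_iff.1 h3
  · right
    refine ⟨?_, k, hk, ?_⟩
    · filter_upwards [hne, hFf.filter_mono nhdsWithin_le_nhds] with w h1 h2 h3
      rw [h2, hf] at h1
      exact h1 (by simp [h3, evalPair])
    -- `Φ` is `f` times `ψ / g`, which is continuous without zeros and does not affect the index.
    · have hq : HasLocalIndex (fun w => ψ w / g w) z 0 := by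
        refine hasLocalIndex_zero ?_ (div_ne_zero hψ0 hg0)
        filter_upwards [hψ, hgc, hgc.self_of_nhds.eventually_ne hg0] with w h1 h2 h3
          using h1.div h2 h3
      have h1 := hkF.mul hq
      rw [add_zero] at h1
      refine h1.congr (Filter.Eventually.filter_mono nhdsWithin_le_nhds ?_)
      filter_upwards [hFf, hcoef, hgc.self_of_nhds.eventually_ne hg0]
        with w h2 ⟨s, t, _, h3, h4⟩ h5
      rw [h2, h3, h4]
      field_simp

end HolomorphicDisk

end Flat

/-! ### Positivity on holomorphic disks -/

section Positivity

theorem symm_mem_chart_source {M : Type*} [TopologicalSpace M] [ChartedSpace R4 M] {x₀ : M} {y : R4}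
    (hy : y ∈ (extChartAt (𝓡 4) x₀).target) :
    (extChartAt (𝓡 4) x₀).symm y ∈ (chartAt R4 x₀).source := by
  rw [← extChartAt_source (𝓡 4)]
  exact (extChartAt (𝓡 4) x₀).map_target hy

variable {M : Type*} [TopologicalSpace M] [ChartedSpace R4 M] [IsManifold (𝓡 4) ∞ M]
  {J : AlmostComplexStructure M}

theorem tanTriv_symm_eq_mfderiv {x₀ : M} {y : R4} (hy : y ∈ (extChartAt (𝓡 4) x₀).target) (v : R4) :
    (tanTriv x₀).symm ((extChartAt (𝓡 4) x₀).symm y) v =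
      mfderiv 𝓘(ℝ, R4) (𝓡 4) (extChartAt (𝓡 4) x₀).symm y v := by
  have hx := symm_mem_chart_source hy
  have hb : (extChartAt (𝓡 4) x₀).symm y ∈ (tanTriv x₀).baseSet := by rwa [tanTriv_baseSet]
  have h := TangentBundle.symmL_trivializationAt (I := 𝓡 4) (𝕜 := ℝ) hx
  rw [← (tanTriv x₀).symmL_apply (R := ℝ) hb, h, (extChartAt (𝓡 4) x₀).right_inv hy]
  simp only [modelWithCornersSelf_coe, range_id, mfderivWithin_univ]
  rfl

theorem inChart_eq_bc (α : AntiInvariantForm J) {x₀ : M} {y : R4}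
    (hy : y ∈ (extChartAt (𝓡 4) x₀).target) :
    α.inChart x₀ y = bc x₀ ⟨(extChartAt (𝓡 4) x₀).symm y, α.toFun ((extChartAt (𝓡 4) x₀).symm y)⟩ := by
  ext a b
  rw [bc_apply (symm_mem_chart_source hy), tanTriv_symm_eq_mfderiv hy, tanTriv_symm_eq_mfderiv hy]
  rfl

set_option synthInstance.maxHeartbeats 400000 in
theorem contDiffOn_inChart (α : AntiInvariantForm J) (x₀ : M) :
    ContDiffOn ℝ ∞ (α.inChart x₀) (extChartAt (𝓡 4) x₀).target := by
  have h1 : ContMDiffOn (𝓡 4) 𝓘(ℝ, Bil) ∞ (fun x => bc x₀ ⟨x, α.toFun x⟩)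
      (chartAt R4 x₀).source :=
    ((bilTriv x₀).contMDiffOn_section_iff (chartAt R4 x₀).open_source
      (bilTriv_baseSet x₀).ge).1 α.smooth.contMDiffOn
  have h2 := h1.comp (contMDiffOn_extChartAt_symm (I := 𝓡 4) (n := ∞) x₀)
    fun y hy => symm_mem_chart_source hy
  exact (contMDiffOn_iff_contDiffOn.1 h2).congr fun y hy => inChart_eq_bc α hy

theorem contDiffOn_jc (x₀ : M) :
    ContDiffOn ℝ ∞ (fun y => jc J x₀ ((extChartAt (𝓡 4) x₀).symm y))
      (extChartAt (𝓡 4) x₀).target := by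
  have h1 : ContMDiffOn (𝓡 4) 𝓘(ℝ, R4 →L[ℝ] R4) ∞ (jc J x₀) (chartAt R4 x₀).source := by
    refine ((trivializationAt (R4 →L[ℝ] R4)
      (fun x : M => TangentSpace (𝓡 4) x →L[ℝ] TangentSpace (𝓡 4) x) x₀).contMDiffOn_section_iff
      (chartAt R4 x₀).open_source ?_).1 J.smooth.contMDiffOn
    rw [hom_trivializationAt_baseSet]
    exact fun x hx => ⟨hx, hx⟩
  exact contMDiffOn_iff_contDiffOn.1 (h1.comp (contMDiffOn_extChartAt_symm (I := 𝓡 4) (n := ∞) x₀)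
    fun y hy => symm_mem_chart_source hy)

theorem fderiv_extChartAt_comp {σ : Disk → M} (hσ : ContMDiff 𝓘(ℝ, ℂ) (𝓡 4) ∞ σ) {x₀ : M}
    {z : Disk} (hz : σ z ∈ (chartAt R4 x₀).source) (v : ℂ) :
    fderiv ℝ (fun w => extChartAt (𝓡 4) x₀ (σ (toDisk w))) (z : ℂ) v =
      (tanTriv x₀).continuousLinearMapAt ℝ (σ z) (mfderiv 𝓘(ℝ, ℂ) (𝓡 4) σ z v) := by
  have h1 : MDifferentiableAt (𝓡 4) 𝓘(ℝ, R4) (extChartAt (𝓡 4) x₀) (σ z) :=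
    mdifferentiableAt_extChartAt hz
  have h2 : MDifferentiableAt 𝓘(ℝ, ℂ) (𝓡 4) σ z := (hσ z).mdifferentiableAt (by simp)
  have h3 := mfderiv_eq_fderiv_toDisk (h1.comp z h2)
  have h4 := TangentBundle.continuousLinearMapAt_trivializationAt (I := 𝓡 4) (𝕜 := ℝ) hz
  rw [mfderiv_comp z h1 h2] at h3
  rw [h4]
  exact (congrArg (fun L : ℂ →L[ℝ] R4 => L v) h3).symm

theorem holomorphicDisk_extChartAt {α : AntiInvariantForm J} (hclosed : α.IsClosedForm)
    {σ : Disk → M} (hσ : J.IsHolomorphicEmbedding σ) (z : Disk) :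
    HolomorphicDisk (extChartAt (𝓡 4) (σ z)).target
      (fun y => jc J (σ z) ((extChartAt (𝓡 4) (σ z)).symm y)) (α.inChart (σ z))
      (fun w => extChartAt (𝓡 4) (σ z) (σ (toDisk w))) z ∧
    fderiv ℝ (fun w => extChartAt (𝓡 4) (σ z) (σ (toDisk w))) (z : ℂ) 1 ≠ 0 := by
  have hsrc : ∀ᶠ w in 𝓝 (z : ℂ), σ (toDisk w) ∈ (chartAt R4 (σ z)).source ∧
      ((toDisk w : Disk) : ℂ) = w := by
    refine Filter.Eventually.and ?_ (eventually_coe_toDisk z)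
    have h1 : ContinuousAt (fun w => σ (toDisk w)) (z : ℂ) :=
      hσ.smooth.continuous.continuousAt.comp (continuousAt_toDisk z)
    exact h1 ((chartAt R4 (σ z)).open_source.mem_nhds (by
      change σ (toDisk z) ∈ _; rw [toDisk_coe]; exact mem_chart_source R4 (σ z)))
  refine ⟨⟨isOpen_extChartAt_target (σ z), ?_, fun y hy => jc_sq J (symm_mem_chart_source hy),
    fun y hy => ?_, contDiffOn_jc (σ z), contDiffOn_inChart α (σ z), hclosed (σ z), ?_, ?_⟩, ?_⟩
  · rw [toDisk_coe]; exact mem_extChartAt_target (σ z)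
  · rw [inChart_eq_bc α hy]
    exact (isAntiInvariant_iff J (symm_mem_chart_source hy) _).1 (α.antiInvariant _)
  · filter_upwards [hsrc] with w ⟨hw, hw'⟩
    have h1 : ContMDiffAt 𝓘(ℝ, ℂ) 𝓘(ℝ, R4) ∞ (fun v : Disk => extChartAt (𝓡 4) (σ z) (σ v))
        (toDisk w) := (contMDiffAt_extChartAt' hw).comp _ (hσ.smooth _)
    rw [contMDiffAt_iff_toDisk, hw'] at h1
    exact h1
  · filter_upwards [hsrc] with w ⟨hw, hw'⟩
    have h1 := fderiv_extChartAt_comp hσ.smooth hw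
    have h2 := hσ.holomorphic (toDisk w) 1
    rw [hw'] at h1
    rw [mul_one] at h2
    rw [h1, h1, h2]
    rw [(extChartAt (𝓡 4) (σ z)).left_inv (by rwa [extChartAt_source]), jc_apply J hw,
      tanTriv_symm_map _ hw]
  · have hz := mem_chart_source R4 (σ z)
    rw [fderiv_extChartAt_comp hσ.smooth hz]
    intro h0
    have h1 := tanTriv_symm_map (σ z) hz (mfderiv 𝓘(ℝ, ℂ) (𝓡 4) σ z (1 : ℂ))
    have hb : σ z ∈ (tanTriv (σ z)).baseSet := by rwa [tanTriv_baseSet]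
    rw [h0, ← (tanTriv (σ z)).symmL_apply (R := ℝ) hb, map_zero] at h1
    have h2 : (1 : ℂ) = 0 := hσ.immersion z (h1.symm.trans (map_zero _).symm)
    exact one_ne_zero h2

variable {V : Type*} [NormedAddCommGroup V] [NormedSpace ℂ V] (𝓔 : BundleEmbedding J V)

namespace BundleEmbedding

/-- The alternative in a chart, transferred to `M`: the frame is a local section of `Λ_J⁻`, and the
function whose index is computed is the one that enters `MapIndex`. -/
theorem eventually_mem_zeroSet_or_hasLocalIndex_pos {α : AntiInvariantForm J}
    (hclosed : α.IsClosedForm) {σ : C(Disk, M)} (hσ : J.IsHolomorphicEmbedding σ) {z : Disk}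
    (hz : σ z ∈ α.zeroSet) {lam : V →L[ℂ] ℂ} (hlam : IsFrame (𝓔.P (σ z)) lam) :
    (∀ᶠ w in 𝓝 z, σ w ∈ α.zeroSet) ∨ ((∀ᶠ w in 𝓝[≠] z, σ w ∉ α.zeroSet) ∧ ∃ k : ℤ, 0 < k ∧
      HasLocalIndex (fun w => lam (𝓔.lineSection.vec (α.toSection.comp σ) w)) z k) := by
  obtain ⟨U, β, hU, hzU, hUs, hβc, hβ⟩ := exists_local_section J (σ z)
  obtain ⟨hdisk, himm⟩ := holomorphicDisk_extChartAt hclosed hσ z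
  have hσc : ContinuousAt (fun w => σ (toDisk w)) (z : ℂ) :=
    σ.continuous.continuousAt.comp (continuousAt_toDisk z)
  have hev : ∀ᶠ w in 𝓝 (z : ℂ), σ (toDisk w) ∈ U ∧ ((toDisk w : Disk) : ℂ) = w :=
    (hσc.eventually_mem (hU.mem_nhds (by rwa [toDisk_coe]))).and
      (eventually_coe_toDisk z)
  have hβσ : ∀ᶠ w in 𝓝 (z : ℂ), ContinuousAt
      (fun w => (⟨σ (toDisk w), β (σ (toDisk w))⟩ : BilinBundle M)) w := by
    filter_upwards [hev] with w ⟨hw, hw'⟩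
    have h1 : ContinuousAt toDisk w := by rw [← hw']; exact continuousAt_toDisk _
    exact ContinuousAt.comp (f := fun w => σ (toDisk w))
      (g := fun x => (⟨x, β x⟩ : BilinBundle M)) (hβc.continuousAt (hU.mem_nhds hw))
      (σ.continuous.continuousAt.comp h1)
  have hB : ∀ᶠ w in 𝓝 (z : ℂ), α.inChart (σ z) (extChartAt (𝓡 4) (σ z) (σ (toDisk w))) =
      bc (σ z) ⟨σ (toDisk w), α.toFun (σ (toDisk w))⟩ ∧
      (extChartAt (𝓡 4) (σ z)).symm (extChartAt (𝓡 4) (σ z) (σ (toDisk w))) = σ (toDisk w) := by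
    filter_upwards [hev] with w ⟨hw, _⟩
    have h1 : σ (toDisk w) ∈ (extChartAt (𝓡 4) (σ z)).source := by
      rw [extChartAt_source]; exact hUs hw
    rw [inChart_eq_bc α ((extChartAt (𝓡 4) (σ z)).map_source h1),
      (extChartAt (𝓡 4) (σ z)).left_inv h1]
    exact ⟨rfl, rfl⟩
  have hzero : ∀ᶠ w in 𝓝 (z : ℂ), (α.inChart (σ z) (extChartAt (𝓡 4) (σ z) (σ (toDisk w))) = 0 ↔
      σ (toDisk w) ∈ α.zeroSet) := by
    filter_upwards [hev, hB] with w ⟨hw, _⟩ ⟨hBw, _⟩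
    rw [hBw, bc_eq_zero_iff (hUs hw)]
    rfl
  have hmap : Filter.map ((↑) : Disk → ℂ) (𝓝 z) = 𝓝 (z : ℂ) :=
    unitDisk.isOpen.isOpenEmbedding_subtypeVal.map_nhds_eq z
  have hcoe : Tendsto ((↑) : Disk → ℂ) (𝓝 z) (𝓝 (z : ℂ)) := hmap.le
  have hcoe' : Tendsto ((↑) : Disk → ℂ) (𝓝[≠] z) (𝓝[≠] (z : ℂ)) :=
    tendsto_nhdsWithin_of_tendsto_nhds_of_eventually_within _ (hcoe.mono_left nhdsWithin_le_nhds)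
      (eventually_nhdsWithin_of_forall fun w hw h => hw (Subtype.ext h))
  have key := hdisk.eventually_eq_zero_or_hasLocalIndex_pos himm
    (by rw [hzero.self_of_nhds, toDisk_coe]; exact hz)
    (b := fun w => bc (σ z) ⟨σ (toDisk w), β (σ (toDisk w))⟩)
    (Φ := fun w => lam (𝓔.lineSection.vec (α.toSection.comp σ) w))
    (ψ := fun w => lam (𝓔.E ⟨σ (toDisk w), β (σ (toDisk w))⟩)) ?_ ?_ ?_ ?_ ?_ ?_
  · rcases key with h | ⟨h, k, hk, hidx⟩
    · left
      filter_upwards [hcoe.eventually (h.and hzero)] with w ⟨h1, h2⟩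
      simpa using h2.1 h1
    · right
      refine ⟨?_, k, hk, hidx⟩
      filter_upwards [hcoe'.eventually (h.and (hzero.filter_mono nhdsWithin_le_nhds))]
        with w ⟨h1, h2⟩ h3
      exact h1 (h2.2 (by simpa using h3))
  · filter_upwards [hβσ, hev] with w h1 ⟨h2, _⟩
    have hop : IsOpen {p : BilinBundle M | p.proj ∈ (chartAt R4 (σ z)).source} :=
      (chartAt R4 (σ z)).open_source.preimage (FiberBundle.continuous_proj Bil (BilinFiber M))
    exact ContinuousAt.comp (g := bc (σ z))
      ((continuousOn_bc (σ z)).continuousAt (hop.mem_nhds (hUs h2))) h1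
  · filter_upwards [hev, hB] with w ⟨h2, _⟩ ⟨_, h3⟩
    rw [h3]
    exact (isAntiInvariant_iff J (hUs h2) _).1 (hβ _ h2).1
  · rw [toDisk_coe]
    exact fun h => (hβ _ hzU).2 ((bc_eq_zero_iff (hUs hzU) _).1 h)
  · filter_upwards [hβσ] with w h1
    exact ContinuousAt.comp (g := fun p => lam (𝓔.E p))
      (lam.continuous.comp 𝓔.continuous_E).continuousAt h1
  · rw [toDisk_coe]
    exact fun h => (hβ _ hzU).2 (𝓔.eq_zero _ _ (hβ _ hzU).1
      (hlam _ (𝓔.P_E _ _ (hβ _ hzU).1) h))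
  · filter_upwards [hev, hB] with w ⟨h1, _⟩ ⟨h2, h3⟩ s t hst
    rw [h2, h3, ← bc_comp_J J (hUs h1), ← bc_add_smul (hUs h1)] at hst
    have h4 := congrArg (bcInv (σ z) (σ (toDisk w))) hst
    rw [bcInv_bc (hUs h1), bcInv_bc (hUs h1)] at h4
    change lam (𝓔.E ⟨σ (toDisk w), α.toFun (σ (toDisk w))⟩) = _
    rw [h4, 𝓔.map_add_smul, 𝓔.map_J]
    simp only [map_add, map_smul, smul_eq_mul]
    ring

/-- Unique continuation excludes interior zeros, so the zeros are finite in number with positive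
local indices, and the index is their sum. -/
theorem mapIndex_pos {α : AntiInvariantForm J} (hclosed : α.IsClosedForm)
    {σ : C(Disk, M)} (hadm : Admissible α.zeroSet σ) (hσ : J.IsHolomorphicEmbedding σ)
    (hne : ∃ z, σ z ∈ α.zeroSet) {k : ℤ} (hk : 𝓔.lineSection.MapIndex (α.toSection.comp σ) k) :
    0 < k := by
  have hZ := 𝓔.isClosed_zeroSet α
  have hcpt := isCompact_preimage_of_admissible hZ hadm
  choose lam hlam using fun z : Disk => (𝓔.isLineProj (σ z)).exists_frame
  have hloc := fun (z : Disk) (hz : σ z ∈ α.zeroSet) =>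
    𝓔.eventually_mem_zeroSet_or_hasLocalIndex_pos hclosed hσ hz (hlam z)
  obtain ⟨A, hA⟩ : ∃ A : Set Disk, A = {z | ∀ᶠ w in 𝓝 z, σ w ∈ α.zeroSet} := ⟨_, rfl⟩
  have hAS : A ⊆ σ ⁻¹' α.zeroSet := fun z hz => by
    rw [hA] at hz; exact Filter.Eventually.self_of_nhds hz
  have hclopen : IsClopen A := by
    -- A limit of interior zeros is a zero; if not itself interior it would be isolated, which the
    -- nearby zeros forbid.
    refine ⟨isClosed_of_closure_subset fun z hz => ?_, by rw [hA]; exact isOpen_setOfPred_eventually_nhds⟩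
    have hzS : σ z ∈ α.zeroSet := closure_minimal hAS (hZ.preimage σ.continuous) hz
    rcases hloc z hzS with h | ⟨h, -⟩
    · rw [hA]; exact h
    · obtain ⟨w, hw, hwA⟩ := ((mem_closure_iff_frequently.1 hz).and_eventually
        (eventually_nhdsWithin_iff.1 h)).exists
      by_contra hzA
      exact hwA (fun h => hzA (h ▸ hw)) (hAS hw)
  have : PreconnectedSpace Disk := isPreconnected_iff_preconnectedSpace.1
    (convex_ball (0 : ℂ) 1).isPreconnected
  -- Otherwise the whole disk would consist of zeros, but the zeros of an admissible disk are
  -- compact and the open disk is not.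
  have hAe : A = ∅ := by
    refine (isClopen_iff.1 hclopen).resolve_right fun huniv => ?_
    rw [huniv, univ_subset_iff] at hAS
    rw [hAS] at hcpt
    obtain ⟨r, h0, h1, hr⟩ := exists_norm_le_of_isCompact hcpt
    obtain ⟨s, hs, hs1⟩ := exists_between h1
    have h2 : ‖(s : ℂ)‖ = s := by simp [abs_of_nonneg (h0.trans hs.le)]
    have h3 := hr (toDisk s) trivial
    rw [coe_toDisk (by rw [h2]; exact hs1), h2] at h3
    linarith
  have hiso : ∀ z, σ z ∈ α.zeroSet → (∀ᶠ w in 𝓝[≠] z, σ w ∉ α.zeroSet) ∧ ∃ k : ℤ, 0 < k ∧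
      HasLocalIndex (fun w => lam z (𝓔.lineSection.vec (α.toSection.comp σ) w)) z k := fun z hz => by
    refine (hloc z hz).resolve_left fun h => ?_
    have : z ∈ A := by rw [hA]; exact h
    rw [hAe] at this
    exact this
  have hfin : (σ ⁻¹' α.zeroSet).Finite := hcpt.finite_of_isolated fun z hz => (hiso z hz).1
  have hκ : ∀ z, ∃ k : ℤ, σ z ∈ α.zeroSet → 0 < k ∧
      HasLocalIndex (fun w => lam z (𝓔.lineSection.vec (α.toSection.comp σ) w)) z k := fun z => by
    by_cases hz : σ z ∈ α.zeroSet
    · obtain ⟨k, hk⟩ := (hiso z hz).2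
      exact ⟨k, fun _ => hk⟩
    · exact ⟨0, fun h => absurd h hz⟩
  choose κ hκ using hκ
  have hsum := LineSection.mapIndex_sum (Λ := 𝓔.lineSection) (α.toSection.comp σ).continuous hfin.toFinset κ lam
    (fun z hz => by
      rw [hfin.mem_toFinset]; exact (𝓔.lineSection_E_eq_zero_iff _).1 hz)
    (fun z _ => hlam z) (fun z hz => (hκ z (hfin.mem_toFinset.1 hz)).2)
  rw [hk.unique (α.toSection.comp σ).continuous hsum]
  obtain ⟨z, hz⟩ := hne
  exact Finset.sum_pos (fun z hz => (hκ z (hfin.mem_toFinset.1 hz)).1)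
    ⟨z, hfin.mem_toFinset.2 hz⟩

end BundleEmbedding

end Positivity

end DiskIndex

theorem proposition3p3 {M : Type*} [TopologicalSpace M] [T2Space M] [CompactSpace M]
    [ConnectedSpace M] [ChartedSpace R4 M] [IsManifold (𝓡 4) ∞ M]
    (J : AlmostComplexStructure M) (α : AntiInvariantForm J)
    (hclosed : α.IsClosedForm) (hnontrivial : ∃ x, α.toFun x ≠ 0) :
    (∀ σ : AdmissibleMap α.zeroSet,
      Admissible J.zeroSection (α.toSection.comp σ.1) ∧
      α.HasSmallTransversePerturbations σ.1 ∧
      ∀ s, α.IsTransversePerturbation σ.1 s →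
        (J.intersectionSet s).Finite ∧ α.intersectionNumber σ = J.signedCount s) ∧
    J.IsPositiveCohomologyAssignment α.zeroSet α.intersectionNumber := by
  obtain ⟨n, ⟨𝓔⟩⟩ := DiskIndex.exists_bundleEmbedding J
  have hsmall : ∀ σ : AdmissibleMap α.zeroSet, α.HasSmallTransversePerturbations σ.1 :=
    fun σ => 𝓔.hasSmallTransversePerturbations σ.2
  refine ⟨fun σ => ⟨𝓔.admissible_toSection_comp α σ.2, hsmall σ, fun s hs => ?_⟩,
    𝓔.isPositiveCohomologyAssignment hsmall fun σ k hσ hne hk =>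
      𝓔.mapIndex_pos hclosed σ.2 hσ hne hk⟩
  obtain ⟨hfin, hidx⟩ := 𝓔.mapIndex_of_isTransversePerturbation α hs
  exact ⟨hfin, 𝓔.intersectionNumber_eq σ (hsmall σ) hidx⟩
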